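/- **Setting.** Let $e\ge 1$, let $\zeta\in\mathbb C$ be a primitive $e$-th root of unity, $\mathbf m=(m_0,\dots,m_{e-1})$ a tuple of positive integers, $n\ge 0$, and $F=\mathbb C(q,t)$ with $q,t$ independent indeterminates. Let $\mathcal P_{n,e}$ be the set of $e$-tuples $\alpha=(\alpha^{(0)},\dots,\alpha^{(e-1)})$ of partitions of total size $n$. Upper indices $k$ are read modulo $e$. For $l\ge 0$ put $\mathbf m+l=(m_0+l,\dots,m_{e-1}+l)$. For any tuple $\mathbf m$ let $x_{\mathbf m}$ be the variables $x^{(k)}_j$ ($0\le k\le e-1$, $1\le j\le m_k$) and $S_{\mathbf m}=\prod_k S_{m_k}$. Let $\Xi^n_F$ be the inverse limit over $l$ of the spaces of $S_{\mathbf m+l}$-invariant homogeneous polynomials of degree $n$ in $F[x_{\mathbf m+l}]$, the transition maps setting the last variable of each row to $0$. In it we have $m_\alpha=\prod_k m_{\alpha^{(k)}}(x^{(k)})$, $s_\alpha=\prod_k s_{\alpha^{(k)}}(x^{(k)})$ (monomial and Schur functions) and $p_\alpha=\prod_k\prod_j p^{(k)}_{\alpha^{(k)}_j}$ (over the non-zero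 parts), where $p^{(i)}_r=\sum_k\zeta^{ik}\sum_j (x^{(k)}_j)^r$. Let $\langle\ ,\ \rangle$ be the form on $\Xi^n_F$ that is linear in the first and conjugate-linear in the second variable (complex conjugation acts on $F$ fixing $q,t$) with $$\langle p_\alpha,p_\beta\rangle=\delta_{\alpha\beta}\,e^{l(\alpha)}\prod_k z_{\alpha^{(k)}}\prod_k\prod_{j}\frac{1-\zeta^kq^{\alpha^{(k)}_j}}{1-\zeta^kt^{\alpha^{(k)}_j}},$$ where $z_\lambda=\prod_i i^{n_i}n_i!$ for $\lambda=(1^{n_1},2^{n_2},\dots)$, $l(\alpha)$ is the number of non-zero parts of $\alpha$, and $j$ runs over the non-zero parts. **Symbols.** Let $\delta^{(k)}=(m_k-1,\dots,1,0)$. Represent $\alpha\in\mathcal P_{n,e}$ by its symbol $\Lambda(\alpha)=\alpha+\delta$ taken for $\mathbf m+l$ with $l$ large (the notions below do not depend on $l$). Write $\alpha\sim\beta$ if $\Lambda(\alpha),\Lambda(\beta)$ have the same entries with multiplicities; the classes are the *families*. Write $\alpha<\beta$ if the entries of $\Lambda(\alpha)$, arranged in decreasing order, form a partition strictly smaller in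 the dominance order than the one formed by the entries of $\Lambda(\beta)$. Let $a(\alpha)=\sum\min\{\lambda,\lambda'\}-\sum\min\{\mu,\mu'\}$, over unordered pairs of entries of $\Lambda(\alpha)$ and of $\delta$ respectively. A total order $\prec$ on $\mathcal P_{n,e}$ is *admissible* if $\alpha\prec\beta$ implies $a(\alpha)\ge a(\beta)$ and every family is an interval. **Macdonald functions.** For an admissible $\prec$, the Macdonald functions $P^\pm_{\Lambda(\alpha)}\in\Xi^n_F$ ($\alpha\in\mathcal P_{n,e}$) are the unique functions such that $P^\pm_{\Lambda(\alpha)}-s_\alpha$ is an $F$-linear combination of the $s_\beta$ with $\beta\prec\alpha$, $\beta\not\sim\alpha$, and $\langle P^+_{\Lambda(\alpha)},P^-_{\Lambda(\beta)}\rangle=0$ unless $\alpha\sim\beta$. **The operators.** Let $\mathcal I$ be the set of $\mathbf i=(i_0,\dots,i_{e-1})$ with $1\le i_k\le m_k$, and $M=\sum_k m_k$. For a matrix $\beta=(\beta^{(k)}_j)$ of non-negative integers put $\langle\beta,\mathbf i\rangle=\sum_k\beta^{(k)}_{i_k}$, and let $\beta_{\mathbf i\pm}$ be obtained from $\beta$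 by replacing, for all $k$, the entry at $(k,i_k)$ by $\beta^{(k\pm1)}_{i_{k\pm1}}$. Let $T^\pm_{q,\mathbf i}$ replace $x^{(k)}_{i_k}$ by $q\,x^{(k\mp1)}_{i_{k\mp1}}$ for all $k$. With $a_\delta(x)=\sum_{w\in S_{\mathbf m}}\varepsilon(w)\,x^{w(\delta)}$, define on $S_{\mathbf m}$-invariant polynomials $$D^1_{\mathbf m,\pm}=a_\delta(x)^{-1}\sum_{w\in S_{\mathbf m}}\varepsilon(w)\sum_{\mathbf i\in\mathcal I}x^{w(\delta)_{\mathbf i\pm}}\,t^{\langle w(\delta),\mathbf i\rangle}\,T^\pm_{q,\mathbf i},\qquad E^\pm_{\mathbf m}=t^{-M}D^1_{\mathbf m,\pm}-\sum_{\mathbf i\in\mathcal I,\ \delta_{\mathbf i\pm}=\delta}t^{\langle\delta,\mathbf i\rangle-M}.$$ The operators $E^\pm_{\mathbf m+l}$ define an operator $E^\pm$ on $\Xi^n_F$. Let $h^\pm_{\alpha\beta}\in F$ be given by $E^\pm m_\alpha=\sum_\beta h^\pm_{\alpha\beta}m_\beta$, and for a family $\mathcal F$ put $H^\pm_{\mathcal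 F,\mathcal F}=(h^\pm_{\alpha\beta})_{\alpha,\beta\in\mathcal F}$. **Conjecture A** (for a sign $\pm$). For any two distinct families $\mathcal F,\mathcal F'$ in $\mathcal P_{n,e}$, the matrices $H^\pm_{\mathcal F,\mathcal F}$ and $H^\pm_{\mathcal F',\mathcal F'}$ have no common eigenvalue in an algebraic closure of $F$. **Theorem 3.6.** The objects above are well defined: the matrix $(h^\pm_{\alpha\beta})$ exists, and for each admissible $\prec$ there is exactly one system $(P^\pm_{\Lambda(\alpha)})_\alpha$ of Macdonald functions. Let a sign be fixed and suppose that Conjecture A holds for it. Then for each admissible $\prec$ the Macdonald functions of that sign are characterized by two properties: a family $(R_\alpha)_{\alpha\in\mathcal P_{n,e}}$ in $\Xi^n_F$ satisfies $$R_\alpha=m_\alpha+\sum_{\beta<\alpha}w_{\alpha\beta}\,m_\beta\quad(\text{for some } w_{\alpha\beta}\in F),\qquad E^\pm R_\alpha=\sum_{\beta\sim\alpha}h^\pm_{\alpha\beta}R_\beta\qquad\text{for all }\alpha$$ if and only if $R_\alpha=P^\pm_{\Lambda(\alpha)}$ for all $\alpha$. In particular the functions $P^\pm_{\Lambda(\alpha)}$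 do not depend on the admissible total order $\prec$. -/

import Mathlib

open MvPolynomial

/-! ### The coefficient field `F = ℂ(q, t)` -/

/-- The field `F = ℂ(q, t)` of rational functions in two independent indeterminates. -/
abbrev Fqt : Type := FractionRing (MvPolynomial (Fin 2) ℂ)

/-- The indeterminate `q` as an element of `F`. -/
noncomputable def qF : Fqt := algebraMap (MvPolynomial (Fin 2) ℂ) Fqt (X 0)

/-- The indeterminate `t` as an element of `F`. -/
noncomputable def tF : Fqt := algebraMap (MvPolynomial (Fin 2) ℂ) Fqt (X 1)

/-- A complex number as a constant of `F`. -/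
noncomputable def cF (z : ℂ) : Fqt := algebraMap (MvPolynomial (Fin 2) ℂ) Fqt (C z)

/-- The conjugation of `F`: complex conjugation on `ℂ`, fixing `q` and `t`. -/
noncomputable def conjF : Fqt ≃+* Fqt :=
  IsFractionRing.ringEquivOfRingEquiv
    (MvPolynomial.mapEquiv (Fin 2) (starRingAut : RingAut ℂ))

/-! ### `e`-partitions -/

/-- An `e`-partition of size `n`: an `e`-tuple of partitions (Young diagrams, rows = parts)
of total size `n`. The `j`-th part (counted from `0`) of the `k`-th partition of `α` is
`(α.1 k).rowLen j`, its number of non-zero parts is `(α.1 k).colLen 0`, and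
`(α.1 k).rowLens` is the list of its non-zero parts. -/
def EPartition (e n : ℕ) : Type := {α : Fin e → YoungDiagram // ∑ k, (α k).card = n}

theorem YoungDiagram.cells_subset_of_card_le {μ : YoungDiagram} {n : ℕ} (h : μ.card ≤ n) :
    μ.cells ⊆ Finset.range n ×ˢ Finset.range n := by
  rintro ⟨i, j⟩ hij
  have hrow : (μ.row i).card ≤ μ.card := Finset.card_le_card (Finset.filter_subset _ _)
  have hcol : (μ.col j).card ≤ μ.card := Finset.card_le_card (Finset.filter_subset _ _)
  rw [← YoungDiagram.rowLen_eq_card] at hrow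
  rw [← YoungDiagram.colLen_eq_card] at hcol
  have h1 : j < μ.rowLen i := YoungDiagram.mem_iff_lt_rowLen.1 hij
  have h2 : i < μ.colLen j := YoungDiagram.mem_iff_lt_colLen.1 hij
  simp only [Finset.mem_product, Finset.mem_range]
  omega

instance EPartition.instFinite (e n : ℕ) : Finite (EPartition e n) := by
  let f : EPartition e n → (Fin e → ((Finset.range n ×ˢ Finset.range n).powerset)) :=
    fun α k => ⟨(α.1 k).cells, Finset.mem_powerset.2 (YoungDiagram.cells_subset_of_card_le
      ((Finset.single_le_sum (f := fun k => (α.1 k).card) (fun _ _ => Nat.zero_le _)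
        (Finset.mem_univ k)).trans_eq α.2))⟩
  refine Finite.of_injective f fun α β h => Subtype.ext (funext fun k => ?_)
  exact YoungDiagram.ext (congrArg Subtype.val (congrFun h k))

noncomputable instance EPartition.instFintype (e n : ℕ) : Fintype (EPartition e n) :=
  Fintype.ofFinite _

/-! ### Finitely many variables `x_j^{(k)}`, `0 ≤ k ≤ e - 1`, `1 ≤ j ≤ m_k` -/

/-- The index set of the variables `x_j^{(k)}`; the column index `j` is counted from `0`. -/
abbrev Box {e : ℕ} (m : Fin e → ℕ) : Type := Σ k : Fin e, Fin (m k)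

/-- The polynomial ring `F[x_m]`. -/
abbrev PolyF {e : ℕ} (m : Fin e → ℕ) : Type := MvPolynomial (Box m) Fqt

/-- The group `S_m = S_{m_0} × ⋯ × S_{m_{e-1}}`. -/
abbrev RowPerm {e : ℕ} (m : Fin e → ℕ) : Type := ∀ k : Fin e, Equiv.Perm (Fin (m k))

/-- The sign character of `S_m`. -/
def RowPerm.sgn {e : ℕ} {m : Fin e → ℕ} (w : RowPerm m) : ℤ :=
  ∏ k, ((Equiv.Perm.sign (w k) : ℤˣ) : ℤ)

/-- The action of `S_m` on matrices `(β_j^{(k)})` of non-negative integers. -/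
def RowPerm.act {e : ℕ} {m : Fin e → ℕ} (w : RowPerm m) (β : Box m → ℕ) : Box m → ℕ :=
  fun b => β ⟨b.1, (w b.1)⁻¹ b.2⟩

/-- The monomial `x^β = ∏ (x_j^{(k)}) ^ β_j^{(k)}`. -/
noncomputable def xpow {e : ℕ} {m : Fin e → ℕ} (β : Box m → ℕ) : PolyF m :=
  ∏ b, X b ^ β b

/-- The alternant `a_β(x) = ∑_w ε(w) w(x^β)`. -/
noncomputable def alternant {e : ℕ} {m : Fin e → ℕ} (β : Box m → ℕ) : PolyF m :=
  ∑ w : RowPerm m, w.sgn • xpow (w.act β)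

/-- `δ^{(k)} = (m_k - 1, …, 1, 0)`. -/
def delta {e : ℕ} (m : Fin e → ℕ) : Box m → ℕ := fun b => m b.1 - 1 - b.2

open scoped Classical in
/-- The quotient `g / f` in a polynomial ring when `f` divides `g` (unique for `f ≠ 0`),
and `0` otherwise. -/
noncomputable def exactQuot {R : Type*} [CommRing R] (g f : R) : R :=
  if h : f ∣ g then h.choose else 0

/-- The parts of an `e`-partition, written as a matrix with rows of lengths `m_k`. -/
def partsMatrix {e n : ℕ} (m : Fin e → ℕ) (α : EPartition e n) : Box m → ℕ :=
  fun b => (α.1 b.1).rowLen b.2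

/-- Each `α^{(k)}` has at most `m_k` non-zero parts. -/
def Fits {e n : ℕ} (m : Fin e → ℕ) (α : EPartition e n) : Prop :=
  ∀ k, (α.1 k).colLen 0 ≤ m k

open scoped Classical in
/-- The monomial symmetric polynomial `m_α(x) = ∏_k m_{α^{(k)}}(x^{(k)})`: the sum of the
distinct monomials in the `S_m`-orbit of `x^α` (zero if some `α^{(k)}` has too many parts). -/
noncomputable def monoPoly {e n : ℕ} (m : Fin e → ℕ) (α : EPartition e n) : PolyF m :=
  if Fits m α then
    ∑ β ∈ Finset.univ.image (fun w : RowPerm m => w.act (partsMatrix m α)), xpow β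
  else 0

open scoped Classical in
/-- The Schur polynomial `s_α(x) = ∏_k s_{α^{(k)}}(x^{(k)}) = a_{α + δ}(x) / a_δ(x)`
(zero if some `α^{(k)}` has too many parts). -/
noncomputable def schurPoly {e n : ℕ} (m : Fin e → ℕ) (α : EPartition e n) : PolyF m :=
  if Fits m α then exactQuot (alternant (partsMatrix m α + delta m)) (alternant (delta m)) else 0

/-- `p_r^{(i)}(x) = ∑_k ζ^{ik} p_r(x^{(k)})` for `r ≥ 1`. -/
noncomputable def twistedPsum {e : ℕ} (ζ : ℂ) (m : Fin e → ℕ) (i r : ℕ) : PolyF m :=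
  ∑ k : Fin e, C (cF (ζ ^ (i * (k : ℕ)))) * ∑ j : Fin (m k), X (⟨k, j⟩ : Box m) ^ r

/-- `p_α(x) = ∏_k ∏_j p^{(k)}_{α_j^{(k)}}(x)`, over the non-zero parts of `α`. -/
noncomputable def powerPoly {e n : ℕ} (ζ : ℂ) (m : Fin e → ℕ) (α : EPartition e n) : PolyF m :=
  ∏ k : Fin e, ((α.1 k).rowLens.map (twistedPsum ζ m k)).prod

/-! ### Symmetric functions in infinitely many variables, as an inverse limit -/

/-- `m` shifted `l` times: `(m_0 + l, …, m_{e-1} + l)`. -/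
abbrev shiftBy {e : ℕ} (m : Fin e → ℕ) (l : ℕ) : Fin e → ℕ := fun k => m k + l

/-- Sequences of polynomials, the `l`-th one in the variables `x_{m + (l, …, l)}`. -/
abbrev PolySeq {e : ℕ} (m : Fin e → ℕ) : Type := ∀ l : ℕ, PolyF (shiftBy m l)

/-- The restriction `ρ : F[x_{m + (l + 1, …, l + 1)}] → F[x_{m + (l, …, l)}]` which sends the
last variable of each row to `0`. -/
noncomputable def restr {e : ℕ} (m : Fin e → ℕ) (l : ℕ) :
    PolyF (shiftBy m (l + 1)) →ₐ[Fqt] PolyF (shiftBy m l) :=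
  aeval fun b => if h : (b.2 : ℕ) < m b.1 + l then X ⟨b.1, ⟨b.2, h⟩⟩ else 0

/-- The space `Ξ_F^n` of symmetric functions of degree `n`: the inverse limit along `ρ` of
the spaces of `S_{m + (l, …, l)}`-invariant homogeneous polynomials of degree `n`. -/
def Xi {e : ℕ} (m : Fin e → ℕ) (n : ℕ) : Submodule Fqt (PolySeq m) where
  carrier := {f | ∀ l, (f l).IsHomogeneous n ∧
    (∀ w : RowPerm (shiftBy m l), rename (Equiv.sigmaCongrRight w) (f l) = f l) ∧
    restr m l (f (l + 1)) = f l}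
  add_mem' := by
    intro f g hf hg l
    refine ⟨(hf l).1.add (hg l).1, fun w => ?_, ?_⟩
    · simp only [Pi.add_apply, map_add, (hf l).2.1 w, (hg l).2.1 w]
    · simp only [Pi.add_apply, map_add, (hf l).2.2, (hg l).2.2]
  zero_mem' := by
    intro l
    exact ⟨isHomogeneous_zero _ _ _, fun w => map_zero _, map_zero _⟩
  smul_mem' := by
    intro c f hf l
    refine ⟨?_, fun w => ?_, ?_⟩
    · simpa [MvPolynomial.smul_eq_C_mul] using (hf l).1.C_mul c
    · simp only [Pi.smul_apply, map_smul, (hf l).2.1 w]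
    · simp only [Pi.smul_apply, map_smul, (hf l).2.2]

/-- The monomial symmetric function `m_α`. -/
noncomputable def monoSym {e n : ℕ} (m : Fin e → ℕ) (α : EPartition e n) : PolySeq m :=
  fun l => monoPoly (shiftBy m l) α

/-- The Schur function `s_α`. -/
noncomputable def schurSym {e n : ℕ} (m : Fin e → ℕ) (α : EPartition e n) : PolySeq m :=
  fun l => schurPoly (shiftBy m l) α

/-- The power sum symmetric function `p_α`. -/
noncomputable def powerSym {e n : ℕ} (ζ : ℂ) (m : Fin e → ℕ) (α : EPartition e n) : PolySeq m :=
  fun l => powerPoly ζ (shiftBy m l) α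

/-! ### The scalar product -/

/-- `z_λ = ∏_i i^{n_i} n_i!` for the partition `λ = (1^{n_1}, 2^{n_2}, …)`. -/
def zPart (μ : YoungDiagram) : ℕ :=
  ∏ i ∈ μ.rowLens.toFinset, i ^ μ.rowLens.count i * (μ.rowLens.count i).factorial

/-- `z_α = e^{l(α)} ∏_k z_{α^{(k)}}`. -/
def zE {e n : ℕ} (α : EPartition e n) : ℕ :=
  e ^ (∑ k, (α.1 k).colLen 0) * ∏ k, zPart (α.1 k)

/-- `z_α(q, t) = z_α ∏_k ∏_j (1 - ζ^k q^{α_j^{(k)}}) / (1 - ζ^k t^{α_j^{(k)}})`,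
over the non-zero parts of `α`. -/
noncomputable def zqt {e n : ℕ} (ζ : ℂ) (α : EPartition e n) : Fqt :=
  (zE α : Fqt) * ∏ k : Fin e, ((α.1 k).rowLens.map fun a =>
    (1 - cF (ζ ^ (k : ℕ)) * qF ^ a) / (1 - cF (ζ ^ (k : ℕ)) * tF ^ a)).prod

/-- The coordinates `(c_α)` of a symmetric function `f = ∑_α c_α p_α` of degree `n` with respect
to the basis `(p_α)` of `Ξ_F^n`. -/
noncomputable def powerCoord {e : ℕ} (ζ : ℂ) (m : Fin e → ℕ) (n : ℕ) (f : PolySeq m) :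
    EPartition e n → Fqt :=
  Function.invFun (fun c : EPartition e n → Fqt => ∑ α, c α • powerSym ζ m α) f

/-- The sesquilinear form on `Ξ_F^n` (linear in the first variable, conjugate-linear in the
second one) with `⟨p_α, p_β⟩ = δ_{α β} z_α(q, t)`. -/
noncomputable def scalarProd {e : ℕ} (ζ : ℂ) (m : Fin e → ℕ) (n : ℕ) (f g : PolySeq m) : Fqt :=
  ∑ α : EPartition e n, powerCoord ζ m n f α * conjF (powerCoord ζ m n g α) * zqt ζ α

/-! ### Symbols of type `(1, 0)`, families, orders

A symbol and its shifts represent the same class of symbols. An `e`-partition of size `n` has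
at most `n` parts in each row, so it is represented by a symbol with `m_k + n` entries in row
`k`; this common representative is used throughout. Similarity, the dominance order and the
`a`-function do not change under shifts. -/

/-- The symbol `Λ(α) = α + δ` with `m_k + n` entries in row `k`. -/
def symbol {e n : ℕ} (m : Fin e → ℕ) (α : EPartition e n) : Box (shiftBy m n) → ℕ :=
  partsMatrix (shiftBy m n) α + delta (shiftBy m n)

/-- The entries of the symbol `Λ(α)`, with multiplicities. -/
def symbolEntries {e n : ℕ} (m : Fin e → ℕ) (α : EPartition e n) : Multiset ℕ :=
  Finset.univ.val.map (symbol m α)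

/-- `α ∼ β`: the symbols have the same entries with multiplicities. The equivalence classes are
the families. -/
def SimilarSymbols {e n : ℕ} (m : Fin e → ℕ) (α β : EPartition e n) : Prop :=
  symbolEntries m α = symbolEntries m β

/-- Sum of the `k` largest elements of `s`. -/
def topSum (s : Multiset ℕ) (k : ℕ) : ℕ := ((s.sort (· ≥ ·)).take k).sum

/-- `α < β`: the entries of `Λ(α)`, arranged in decreasing order, form a partition which is
strictly smaller, in the dominance order, than the one formed by the entries of `Λ(β)`. -/
def FamilyLT {e n : ℕ} (m : Fin e → ℕ) (α β : EPartition e n) : Prop :=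
  ¬ SimilarSymbols m α β ∧ ∀ k, topSum (symbolEntries m α) k ≤ topSum (symbolEntries m β) k

open scoped Classical in
/-- The sum of `min (λ, λ')` over the unordered pairs of entries of a symbol. -/
noncomputable def pairMinSum {e : ℕ} {m : Fin e → ℕ} (S : Box m → ℕ) : ℕ :=
  ∑ z : Sym2 (Box m) with ¬ z.IsDiag, (z.map S).inf

/-- The `a`-function `a(Λ) = ∑ min (λ, λ') - ∑ min (μ, μ')`, over the unordered pairs of
entries of `Λ` and of `Λ⁰ = δ`, respectively. -/
noncomputable def aFun {e n : ℕ} (m : Fin e → ℕ) (α : EPartition e n) : ℤ :=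
  (pairMinSum (symbol m α) : ℤ) - (pairMinSum (delta (shiftBy m n)) : ℤ)

/-- The total orders `≺` used to construct the Macdonald functions: `α ≺ β` implies
`a(α) ≥ a(β)`, and each family is an interval. -/
structure AdmissibleOrder {e n : ℕ} (m : Fin e → ℕ)
    (r : EPartition e n → EPartition e n → Prop) : Prop where
  total : IsStrictTotalOrder (EPartition e n) r
  a_le : ∀ α β, r α β → aFun m β ≤ aFun m α
  interval : ∀ α β γ, SimilarSymbols m α γ → r α β → r β γ → SimilarSymbols m α β

/-! ### Macdonald functions

Signs `±` are Booleans: `true` is `+` and `false` is `-`. -/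

open scoped Classical in
/-- `P` is the system of Macdonald functions `P^±_{Λ(α)}`, `α` of size `n`, constructed with the
total order `r` (written `≺`): (i) `P^±_{Λ(α)}` is `s_α` plus a linear combination of the `s_β`
with `β ≺ α`, `β ≁ α`; (ii) `⟨P^+_{Λ(α)}, P^-_{Λ(β)}⟩ = 0` unless `α ∼ β`. -/
structure IsMacdonald {e n : ℕ} (ζ : ℂ) (m : Fin e → ℕ)
    (r : EPartition e n → EPartition e n → Prop)
    (P : Bool → EPartition e n → PolySeq m) : Prop where
  mem : ∀ ε α, P ε α ∈ Xi m n
  expansion : ∀ ε, ∃ u : EPartition e n → EPartition e n → Fqt, ∀ α,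
    P ε α = schurSym m α + ∑ β with r β α ∧ ¬ SimilarSymbols m β α, u α β • schurSym m β
  orthogonal : ∀ α β, ¬ SimilarSymbols m α β → scalarProd ζ m n (P true α) (P false β) = 0

/-! ### Macdonald operators -/

/-- The row `k ∓ 1` (modulo `e`) for the sign `±`. -/
def prevRow {e : ℕ} [NeZero e] (ε : Bool) (k : Fin e) : Fin e := if ε then k - 1 else k + 1

/-- The row `k ± 1` (modulo `e`) for the sign `±`. -/
def nextRow {e : ℕ} [NeZero e] (ε : Bool) (k : Fin e) : Fin e := if ε then k + 1 else k - 1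

/-- The set of `i = (i_0, …, i_{e-1})` with `1 ≤ i_k ≤ m_k` (counted from `0` here). -/
abbrev ColIdx {e : ℕ} (m : Fin e → ℕ) : Type := ∀ k : Fin e, Fin (m k)

/-- `⟨β, i⟩ = ∑_k β^{(k)}_{i_k}`. -/
def pairing {e : ℕ} {m : Fin e → ℕ} (β : Box m → ℕ) (i : ColIdx m) : ℕ := ∑ k, β ⟨k, i k⟩

/-- The operator `T^±_{u, i}`: replace `x^{(k)}_{i_k}` by `u x^{(k ∓ 1)}_{i_{k ∓ 1}}` for all `k`. -/
noncomputable def opT {e : ℕ} [NeZero e] {m : Fin e → ℕ} (ε : Bool) (u : Fqt) (i : ColIdx m) :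
    PolyF m →ₐ[Fqt] PolyF m :=
  aeval fun b => if b.2 = i b.1 then C u * X ⟨prevRow ε b.1, i (prevRow ε b.1)⟩ else X b

/-- The matrix `β_{i±}`, for which `T^±_{q, i} x^β = q^{⟨β, i⟩} x^{β_{i±}}`: its entry at
`(k, i_k)` is the entry of `β` at `(k ± 1, i_{k ± 1})`, the other entries are those of `β`. -/
def cycMat {e : ℕ} [NeZero e] {m : Fin e → ℕ} (ε : Bool) (i : ColIdx m) (β : Box m → ℕ) :
    Box m → ℕ :=
  fun b => if b.2 = i b.1 then β ⟨nextRow ε b.1, i (nextRow ε b.1)⟩ else β b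

/-- The Macdonald operator
`D^1_± = a_δ(x)⁻¹ ∑_w ε(w) ∑_i x^{w(δ)_{i±}} t^{⟨w(δ), i⟩} T^±_{q, i}` on symmetric polynomials. -/
noncomputable def opD {e : ℕ} [NeZero e] (m : Fin e → ℕ) (ε : Bool) (f : PolyF m) : PolyF m :=
  exactQuot
    (∑ w : RowPerm m, w.sgn • ∑ i : ColIdx m,
      C (tF ^ pairing (w.act (delta m)) i) * xpow (cycMat ε i (w.act (delta m))) * opT ε qF i f)
    (alternant (delta m))

open scoped Classical in
/-- The normalizing constant `∑_i t^{⟨δ, i⟩ - M}`, `M = ∑_k m_k`, over the `i` such that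
`δ_{i±} = δ`. -/
noncomputable def normConst {e : ℕ} [NeZero e] (m : Fin e → ℕ) (ε : Bool) : Fqt :=
  ∑ i : ColIdx m with cycMat ε i (delta m) = delta m,
    tF ^ ((pairing (delta m) i : ℤ) - (∑ k, m k : ℕ))

/-- The modified operator `E^±_m = t^{-M} D^1_± - ∑_i t^{⟨δ, i⟩ - M}`, `M = ∑_k m_k`, over the `i`
such that `δ_{i±} = δ`. -/
noncomputable def opEm {e : ℕ} [NeZero e] (m : Fin e → ℕ) (ε : Bool) (f : PolyF m) : PolyF m :=
  tF ^ (-((∑ k, m k : ℕ) : ℤ)) • opD m ε f - normConst m ε • f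

/-- The operator `E^±` on symmetric functions, which is `E^±_{m + (l, …, l)}` at each stage `l` of
the inverse limit. -/
noncomputable def opE {e : ℕ} [NeZero e] (m : Fin e → ℕ) (ε : Bool) (f : PolySeq m) : PolySeq m :=
  fun l => opEm (shiftBy m l) ε (f l)

/-- The entries `h^±_{α β}` of the matrix of `E^±`, defined by `E^± m_α = ∑_β h^±_{α β} m_β`:
the coefficient of `x^β` in `E^± m_α`, read off in the variables `x_{m + (n, …, n)}`. -/
noncomputable def hCoeff {e n : ℕ} [NeZero e] (m : Fin e → ℕ) (ε : Bool)
    (α β : EPartition e n) : Fqt :=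
  coeff (Finsupp.equivFunOnFinite.symm (partsMatrix (shiftBy m n) β))
    (opE m ε (monoSym m α) n)

/-- The diagonal block `H^±_{𝓕, 𝓕}` for the family `𝓕` of `α`. -/
noncomputable def hBlock {e n : ℕ} [NeZero e] (m : Fin e → ℕ) (ε : Bool) (α : EPartition e n) :
    Matrix {γ : EPartition e n // SimilarSymbols m γ α} {γ : EPartition e n // SimilarSymbols m γ α} Fqt :=
  Matrix.of fun γ γ' => hCoeff m ε γ.1 γ'.1

open scoped Classical in
/-- Conjecture A for the sign `ε`: the diagonal blocks of the matrix of `E^ε` that belong to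
distinct families have no common eigenvalues, in an algebraic closure of `F`. -/
def ConjectureA {e : ℕ} [NeZero e] (m : Fin e → ℕ) (n : ℕ) (ε : Bool) : Prop :=
  ∀ α β : EPartition e n, ¬ SimilarSymbols m α β → ∀ x : AlgebraicClosure Fqt,
    ¬ (Module.End.HasEigenvalue
          (Matrix.toLin' ((hBlock m ε α).map (algebraMap Fqt (AlgebraicClosure Fqt)))) x ∧
        Module.End.HasEigenvalue
          (Matrix.toLin' ((hBlock m ε β).map (algebraMap Fqt (AlgebraicClosure Fqt)))) x)

open scoped Classical in
/-- `R_α = m_α + ∑_{β < α} w_{α β} m_β` for some coefficients `w_{α β} ∈ F`. -/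
def IsUnitriangular {e n : ℕ} (m : Fin e → ℕ) (R : EPartition e n → PolySeq m) : Prop :=
  ∃ w : EPartition e n → EPartition e n → Fqt, ∀ α,
    R α = monoSym m α + ∑ β with FamilyLT m β α, w α β • monoSym m β

open scoped Classical in
/-- `E^± R_α = ∑_{β ∼ α} h^±_{α β} R_β`. -/
def IsBlockEigen {e n : ℕ} [NeZero e] (m : Fin e → ℕ) (ε : Bool)
    (R : EPartition e n → PolySeq m) : Prop :=
  ∀ α, opE m ε (R α) = ∑ β with SimilarSymbols m β α, hCoeff m ε α β • R β

/-! ### Alternants, exact division and the operators at the level of points -/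

/-! The space `Xi m n` is finite-dimensional with the monomial functions as a basis, and its
elements are determined by their components in the variables of `m + n`. The theorem rests on three
facts about this space and one about matrices.

Triangularity. Multiplication by `a_δ` turns `m_α` into the sum of the alternants `a_{γ+δ}` over the
rearrangements `γ` of `α`, and each alternant is either zero or `± a_δ s_β`. The entries of `γ + δ`
are dominated by those of `α + δ`, and the rearrangement inequality shows that the multisets agree
only for `γ = α`. Hence the `s_α` and the `m_α` differ by unitriangular changes for `<`
(`monoPoly_sub_schurPoly_mem`). The Macdonald operator yields alternants whose exponents are those
of `γ + δ` moved between the rows. The multiset of all entries survives, so the matrix `h` is block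
triangular with respect to families (`familyLE_of_hCoeff_ne_zero`).

Anisotropy. The form is diagonal in the basis `p_α`, and its diagonal values at `q = t = 0` are
positive integers. Evaluation at small real `q, t` gives `⟨f, f⟩ ≠ 0` for `f ≠ 0`
(`formXi_self_ne_zero`). So orthogonal projection to any subspace works in either variable. With
`W_α` the span of the `s_β` from strictly preceding families, `P_α` is the unique element of `s_α +
W_α` orthogonal to `W_α`; this is existence and uniqueness (`existsUnique_isOrthSystem`).

Adjointness. `⟨E⁺ f, g⟩ = ⟨f, E⁻ g⟩` (`formXi_opXi`). This amounts to `E⁺` in `x` and `E⁻` in `y`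
having the same effect on the kernel `∑ z_α(q,t)⁻¹ p_α(x) p̄_α(y)`. A comparison of logarithmic
derivatives shows that `T_{q,i}` multiplies the kernel by a quotient of products of factors `1 - x
y` and `1 - t x y` (`kerSeries_cycPt`). After this, Cauchy determinants make the sum over `i`
symmetric in the two sets of variables (`rowAlt_mul_sum_cycPt`).

Now `E P_α - ∑_{β ∼ α} h_{αβ} P_β` lies in `W_α` by triangularity and is orthogonal to `W_α` by
adjointness, so it vanishes; Conjecture A plays no role here (`IsOrthSystem.block_eigen`). The
conjecture enters through Sylvester's theorem: a matrix intertwining two matrices without common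
eigenvalue is zero. Applied block by block, from the largest families downward, it shows that a
solution of the block eigenvalue equation with identity diagonal blocks is unique, and that the
coefficients of `P_α` outside the dominance order vanish. The resulting characterization does not
mention `≺`, whence independence of it. -/

section Points

variable {e : ℕ} {m : Fin e → ℕ}

theorem alternant_comm_aux {A : Type*} [CommRing A] (w : RowPerm m) :
    ((w.sgn : ℤ) : A) = ∏ k, (((Equiv.Perm.sign (w k) : ℤˣ) : ℤ) : A) := by
  simp [RowPerm.sgn]

/-- The product of the row alternants `∏_k det (x_i^{β_j})` at a point `x`. -/
def rowAlt {A : Type*} [CommRing A] (β : Box m → ℕ) (x : Box m → A) : A :=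
  ∏ k, (Matrix.of fun i j : Fin (m k) => x ⟨k, i⟩ ^ β ⟨k, j⟩).det

theorem aeval_xpow {A : Type*} [CommRing A] [Algebra Fqt A] (β : Box m → ℕ) (x : Box m → A) :
    aeval x (xpow β) = ∏ b, x b ^ β b := by
  simp [xpow]

theorem aeval_alternant {A : Type*} [CommRing A] [Algebra Fqt A] (β : Box m → ℕ)
    (x : Box m → A) : aeval x (alternant β) = rowAlt β x := by
  unfold alternant rowAlt
  simp only [Matrix.det_apply', Finset.prod_univ_sum, Fintype.piFinset_univ, map_sum]
  refine Finset.sum_congr rfl fun w _ => ?_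
  rw [map_zsmul, aeval_xpow, zsmul_eq_mul, alternant_comm_aux, Finset.prod_mul_distrib]
  congr 1
  rw [Fintype.prod_sigma]
  refine Finset.prod_congr rfl fun k _ => ?_
  rw [← Equiv.prod_comp (w k)]
  simp [RowPerm.act]

theorem alternant_eq_rowAlt (β : Box m → ℕ) : alternant β = rowAlt β (X : Box m → PolyF m) := by
  rw [← aeval_alternant, aeval_X_left_apply]

theorem rowAlt_perm {A : Type*} [CommRing A] (β : Box m → ℕ) (x : Box m → A) (w : RowPerm m) :
    rowAlt β (fun b => x ⟨b.1, w b.1 b.2⟩) = w.sgn * rowAlt β x := by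
  unfold rowAlt
  rw [alternant_comm_aux, ← Finset.prod_mul_distrib]
  refine Finset.prod_congr rfl fun k _ => ?_
  rw [← Matrix.det_permute]
  rfl

theorem rowAlt_act {A : Type*} [CommRing A] (β : Box m → ℕ) (x : Box m → A) (w : RowPerm m) :
    rowAlt (w.act β) x = w.sgn * rowAlt β x := by
  unfold rowAlt
  rw [alternant_comm_aux, ← Finset.prod_mul_distrib]
  refine Finset.prod_congr rfl fun k _ => ?_
  rw [← Equiv.Perm.sign_inv, ← Matrix.det_permute']
  rfl

theorem alternant_act (β : Box m → ℕ) (w : RowPerm m) :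
    alternant (w.act β) = w.sgn * alternant β := by
  rw [alternant_eq_rowAlt, alternant_eq_rowAlt, rowAlt_act]

theorem alternant_eq_zero (β : Box m → ℕ) {k : Fin e} {i j : Fin (m k)} (hij : i ≠ j)
    (h : β ⟨k, i⟩ = β ⟨k, j⟩) : alternant β = 0 := by
  rw [alternant_eq_rowAlt, rowAlt]
  refine Finset.prod_eq_zero (Finset.mem_univ k) (Matrix.det_zero_of_column_eq hij fun a => ?_)
  simp [h]

theorem rowAlt_eq_zero {A : Type*} [CommRing A] (β : Box m → ℕ) (x : Box m → A) {k : Fin e}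
    {i j : Fin (m k)} (hij : i ≠ j) (h : x ⟨k, i⟩ = x ⟨k, j⟩) : rowAlt β x = 0 := by
  refine Finset.prod_eq_zero (Finset.mem_univ k) (Matrix.det_zero_of_row_eq hij ?_)
  funext a
  simp [h]

theorem aeval_rename_perm {A : Type*} [CommRing A] [Algebra Fqt A] (w : RowPerm m)
    (x : Box m → A) (f : PolyF m) :
    aeval x (rename (Equiv.sigmaCongrRight w) f) = aeval (fun b => x ⟨b.1, w b.1 b.2⟩) f := by
  rw [aeval_rename]
  rfl

theorem rename_eq_aeval (w : RowPerm m) (f : PolyF m) :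
    rename (Equiv.sigmaCongrRight w) f
      = aeval (fun b => (X ⟨b.1, w b.1 b.2⟩ : PolyF m)) f := by
  rw [← aeval_rename_perm, aeval_X_left_apply]

theorem rename_alternant (w : RowPerm m) (β : Box m → ℕ) :
    rename (Equiv.sigmaCongrRight w) (alternant β) = w.sgn * alternant β := by
  rw [rename_eq_aeval, aeval_alternant, rowAlt_perm, alternant_eq_rowAlt]

/-- The Vandermonde product for all rows. -/
theorem rowAlt_delta {A : Type*} [CommRing A] (x : Box m → A) :
    rowAlt (delta m) x = (∏ k, (((Equiv.Perm.sign (Fin.revPerm (n := m k)) : ℤˣ) : ℤ) : A)) *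
      ∏ k, ∏ i : Fin (m k), ∏ j ∈ Finset.Ioi i, (x ⟨k, j⟩ - x ⟨k, i⟩) := by
  unfold rowAlt
  rw [← Finset.prod_mul_distrib]
  refine Finset.prod_congr rfl fun k _ => ?_
  -- The exponents in `δ` decrease while those of the Vandermonde matrix increase, so the columns
  -- are reversed; this is the origin of the signs.
  rw [← Matrix.det_vandermonde (fun i => x ⟨k, i⟩), ← Matrix.det_permute']
  congr 1
  ext i j
  simp only [Matrix.of_apply, delta, Matrix.submatrix_apply, Matrix.vandermonde_apply, id,
    Fin.revPerm_apply, Fin.val_rev]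
  congr 1
  omega

theorem rowAlt_delta_ne_zero {A : Type*} [CommRing A] [IsDomain A] (x : Box m → A)
    (hx : Function.Injective x) : rowAlt (delta m) x ≠ 0 := by
  rw [rowAlt_delta]
  refine mul_ne_zero ?_ ?_
  · refine Finset.prod_ne_zero_iff.2 fun k _ => ?_
    rcases Int.units_eq_one_or (Equiv.Perm.sign (Fin.revPerm (n := m k))) with h | h <;> simp [h]
  · refine Finset.prod_ne_zero_iff.2 fun k _ => Finset.prod_ne_zero_iff.2 fun i _ =>
      Finset.prod_ne_zero_iff.2 fun j hj => sub_ne_zero.2 fun h => ?_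
    have h1 := hx h
    simp only [Sigma.mk.injEq, heq_eq_eq, true_and] at h1
    exact (Finset.mem_Ioi.1 hj).ne' h1

theorem alternant_delta_ne_zero : alternant (delta m) ≠ 0 := by
  rw [alternant_eq_rowAlt]
  exact rowAlt_delta_ne_zero _ (X_injective)

end Points

/-! ### Divisibility by differences of variables -/

section Divisibility

variable {σ R : Type*} [CommRing R]

/-- Modulo `X a - X b` the substitution `X a ↦ X b` acts as the identity on variables, hence on all
polynomials. -/
theorem MvPolynomial.X_sub_X_dvd_sub_aeval [DecidableEq σ] (a b : σ) (f : MvPolynomial σ R) :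
    (X a - X b : MvPolynomial σ R) ∣ f - aeval (Function.update X a (X b)) f := by
  rw [← Ideal.mem_span_singleton, ← Ideal.Quotient.eq]
  have : ((Ideal.Quotient.mkₐ R (Ideal.span {(X a - X b : MvPolynomial σ R)})).comp
      (aeval (Function.update X a (X b)))) = Ideal.Quotient.mkₐ R _ := by
    refine MvPolynomial.algHom_ext fun c => ?_
    by_cases h : c = a
    · subst h
      simp only [AlgHom.comp_apply, aeval_X, Function.update_self, Ideal.Quotient.mkₐ_eq_mk]
      rw [Ideal.Quotient.eq, Ideal.mem_span_singleton, ← dvd_neg, neg_sub]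
    · simp [h]
  exact (DFunLike.congr_fun this f).symm

/-- After setting `X a = X b` the swap has no effect, so the restricted polynomial equals its own
negative and is zero in characteristic zero. -/
theorem MvPolynomial.X_sub_X_dvd_of_antisymm [IsDomain R] [CharZero R] [DecidableEq σ] (a b : σ)
    (f : MvPolynomial σ R) (h : rename (Equiv.swap a b) f = -f) :
    (X a - X b : MvPolynomial σ R) ∣ f := by
  have h1 := MvPolynomial.X_sub_X_dvd_sub_aeval a b f
  have h2 : aeval (Function.update X a (X b)) f = (0 : MvPolynomial σ R) := by
    have h3 : aeval (Function.update X a (X b)) (rename (Equiv.swap a b) f)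
        = aeval (Function.update X a (X b) : σ → MvPolynomial σ R) f := by
      rw [aeval_rename]
      congr 2
      funext c
      rcases eq_or_ne c a with rfl | hca
      · by_cases h2 : b = c <;> simp [h2]
      · rcases eq_or_ne c b with rfl | h2
        · simp [hca]
        · simp [hca, h2, Equiv.swap_apply_of_ne_of_ne]
    rw [h, map_neg] at h3
    exact self_eq_neg.1 h3.symm
  rwa [h2, sub_zero] at h1

theorem MvPolynomial.irreducible_X_sub_X {K : Type*} [Field K] {a b : σ} (hab : a ≠ b) :
    Irreducible (X a - X b : MvPolynomial σ K) := by
  classical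
  have hhom : (X a - X b : MvPolynomial σ K).IsHomogeneous 1 :=
    (isHomogeneous_X K a).sub (isHomogeneous_X K b)
  have hca : coeff (Finsupp.single a 1) (X a - X b : MvPolynomial σ K) = 1 := by
    rw [coeff_sub, coeff_X, coeff_X, if_pos rfl, if_neg, sub_zero]
    intro h
    exact hab (Finsupp.single_left_injective one_ne_zero h).symm
  have hne : (X a - X b : MvPolynomial σ K) ≠ 0 := by
    intro h
    rw [h] at hca
    simp at hca
  refine irreducible_of_totalDegree_eq_one (hhom.totalDegree hne) fun r hr => ?_
  have := hr (Finsupp.single a 1)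
  rw [hca] at this
  exact isUnit_of_dvd_one this

/-- The first difference is irreducible, and the substitution `X a ↦ X b`, which kills it, does not
kill the second. -/
theorem MvPolynomial.isRelPrime_X_sub_X {K : Type*} [Field K] {a b c d : σ} (hab : a ≠ b)
    (hcd : c ≠ d) (h1 : ¬ (a = c ∧ b = d)) (h2 : ¬ (a = d ∧ b = c)) :
    IsRelPrime (X a - X b : MvPolynomial σ K) (X c - X d) := by
  classical
  rw [(MvPolynomial.irreducible_X_sub_X hab).isRelPrime_iff_not_dvd]
  rintro ⟨g, hg⟩
  have := congrArg (aeval (Function.update X a (X b) : σ → MvPolynomial σ K)) hg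
  simp only [map_sub, map_mul, aeval_X, Function.update_self, Function.update_of_ne hab.symm,
    sub_self, zero_mul, sub_eq_zero] at this
  simp only [Function.update_apply] at this
  split_ifs at this with h3 h4 h4
  · exact hcd (h3.trans h4.symm)
  · exact h1 ⟨h3.symm, X_injective this⟩
  · exact h2 ⟨h4.symm, (X_injective this).symm⟩
  · exact hcd (X_injective this)

theorem exactQuot_spec {f g : R} (h : f ∣ g) : f * exactQuot g f = g := by
  unfold exactQuot
  rw [dif_pos h]
  exact h.choose_spec.symm

/-- Since `f` is homogeneous of degree `d`, the component of `f * g` of degree `d + j` is `f` times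
the component of `g` of degree `j`, and `f` cancels. -/
theorem MvPolynomial.IsHomogeneous.of_mul_left [IsDomain R] {f g : MvPolynomial σ R} {d n : ℕ}
    (hf : f.IsHomogeneous d) (h0 : f ≠ 0) (h : (f * g).IsHomogeneous (d + n)) :
    g.IsHomogeneous n := by
  have key : ∀ j, homogeneousComponent (d + j) (f * g) = f * homogeneousComponent j g := by
    intro j
    conv_lhs => rw [← sum_homogeneousComponent g, Finset.mul_sum, map_sum]
    have : ∀ i, homogeneousComponent (d + j) (f * homogeneousComponent i g)
        = if i = j then f * homogeneousComponent j g else 0 := by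
      intro i
      rw [homogeneousComponent_of_mem (hf.mul (homogeneousComponent_isHomogeneous i g))]
      by_cases hij : i = j
      · subst hij; simp
      · rw [if_neg hij, if_neg (by omega)]
    simp only [this, Finset.sum_ite_eq', Finset.mem_range]
    split_ifs with hj
    · rfl
    · rw [homogeneousComponent_eq_zero _ _ (by omega), mul_zero]
  have : ∀ j, j ≠ n → homogeneousComponent j g = 0 := by
    intro j hj
    have h1 := key j
    rw [homogeneousComponent_of_mem h, if_neg (by omega)] at h1
    exact (mul_eq_zero.1 h1.symm).resolve_left h0
  rw [← sum_homogeneousComponent g]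
  refine IsHomogeneous.sum _ _ _ fun i _ => ?_
  by_cases hi : i = n
  · exact hi ▸ homogeneousComponent_isHomogeneous i g
  · rw [this i hi]; exact isHomogeneous_zero _ _ _

end Divisibility

/-! ### Antisymmetric polynomials are multiples of `a_δ` -/

section Antisymmetric

variable {e : ℕ} {m : Fin e → ℕ}

instance : CharZero Fqt := algebraRat.charZero Fqt

/-- Up to a unit `a_δ` is the product of the differences of variables in the same row.
Transpositions within a row show that each difference divides `f`, and the differences are pairwise
relatively prime. -/
theorem alternant_delta_dvd {f : PolyF m}
    (hf : ∀ w : RowPerm m, rename (Equiv.sigmaCongrRight w) f = w.sgn * f) :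
    alternant (delta m) ∣ f := by
  classical
  rw [alternant_eq_rowAlt, rowAlt_delta]
  have hu : IsUnit (∏ k, (((Equiv.Perm.sign (Fin.revPerm (n := m k)) : ℤˣ) : ℤ) : PolyF m)) := by
    refine IsUnit.prod_univ_iff.2 fun k => ?_
    exact ((Equiv.Perm.sign (Fin.revPerm (n := m k))).isUnit.map (Int.castRingHom (PolyF m)))
  rw [hu.mul_left_dvd]
  have hprod : (∏ k, ∏ i : Fin (m k), ∏ j ∈ Finset.Ioi i,
      (X ⟨k, j⟩ - X ⟨k, i⟩ : PolyF m)) =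
      ∏ z ∈ (Finset.univ.sigma fun k : Fin e => Finset.univ.sigma
        fun i : Fin (m k) => Finset.Ioi i), (X ⟨z.1, z.2.2⟩ - X ⟨z.1, z.2.1⟩ : PolyF m) := by
    rw [Finset.prod_sigma]
    refine Finset.prod_congr rfl fun k _ => ?_
    rw [Finset.prod_sigma]
  rw [hprod]
  refine Finset.prod_dvd_of_isRelPrime ?_ ?_
  · rintro ⟨k, i, j⟩ h ⟨k', i', j'⟩ h' hne
    simp only [Finset.coe_sigma, Set.mem_sigma_iff, Finset.mem_coe, Finset.mem_univ,
      Finset.mem_Ioi, true_and] at h h'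
    refine MvPolynomial.isRelPrime_X_sub_X ?_ ?_ ?_ ?_
    · simpa using h.ne'
    · simpa using h'.ne'
    · rintro ⟨h1, h2⟩
      obtain ⟨rfl, h3⟩ := Sigma.mk.inj_iff.1 h1
      obtain ⟨-, h4⟩ := Sigma.mk.inj_iff.1 h2
      rw [heq_eq_eq] at h3 h4
      subst h3 h4
      exact hne rfl
    · rintro ⟨h1, h2⟩
      obtain ⟨rfl, h3⟩ := Sigma.mk.inj_iff.1 h1
      obtain ⟨-, h4⟩ := Sigma.mk.inj_iff.1 h2
      rw [heq_eq_eq] at h3 h4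
      subst h3 h4
      exact lt_asymm h h'
  · rintro ⟨k, i, j⟩ h
    simp only [Finset.mem_sigma, Finset.mem_univ, Finset.mem_Ioi, true_and] at h
    refine MvPolynomial.X_sub_X_dvd_of_antisymm _ _ _ ?_
    have hw := hf (Function.update 1 k (Equiv.swap j i))
    have hs : RowPerm.sgn (m := m) (Function.update 1 k (Equiv.swap j i)) = -1 := by
      unfold RowPerm.sgn
      rw [Finset.prod_eq_single k]
      · simp [Equiv.Perm.sign_swap h.ne']
      · intro b _ hb
        simp [hb]
      · simp
    have hσ : Equiv.sigmaCongrRight (Function.update 1 k (Equiv.swap j i) : RowPerm m)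
        = Equiv.swap (⟨k, j⟩ : Box m) ⟨k, i⟩ := by
      ext1 ⟨k', a⟩
      by_cases hk : k' = k
      · subst hk
        simp only [Equiv.sigmaCongrRight_apply, Function.update_self,
          Equiv.swap_apply_def, Sigma.mk.injEq, heq_eq_eq, true_and]
        split_ifs <;> rfl
      · rw [Equiv.swap_apply_of_ne_of_ne]
        · simp [hk]
        · intro h; exact hk (congrArg Sigma.fst h)
        · intro h; exact hk (congrArg Sigma.fst h)
    rw [hs, hσ] at hw
    rw [hw]; push_cast; exact neg_one_mul f

theorem alternant_isHomogeneous (β : Box m → ℕ) : (alternant β).IsHomogeneous (∑ b, β b) := by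
  unfold alternant
  refine IsHomogeneous.sum _ _ _ fun w _ => ?_
  have h : (xpow (w.act β) : PolyF m).IsHomogeneous (∑ b, β b) := by
    have h1 : ∑ b, β b = ∑ b, 1 * (w.act β) b := by
      simp only [one_mul, RowPerm.act]
      exact (Equiv.sum_comp (Equiv.sigmaCongrRight fun k => (w k)⁻¹) β).symm
    rw [h1]
    exact IsHomogeneous.prod _ _ _ fun b _ => (isHomogeneous_X _ b).pow _
  rw [zsmul_eq_mul, ← map_intCast (C : Fqt →+* PolyF m)]
  exact h.C_mul _

end Antisymmetric

/-! ### The Macdonald operators: symmetry, degree, linearity -/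

section Operators

variable {e : ℕ} {m : Fin e → ℕ}

/-- The cyclic shift `k ↦ k ∓ 1` of the rows as a permutation. -/
def rowShift [NeZero e] (ε : Bool) : Equiv.Perm (Fin e) where
  toFun := prevRow ε
  invFun := nextRow ε
  left_inv k := by cases ε <;> simp [prevRow, nextRow]
  right_inv k := by cases ε <;> simp [prevRow, nextRow]

theorem nextRow_prevRow [NeZero e] (ε : Bool) (k : Fin e) : nextRow ε (prevRow ε k) = k :=
  (rowShift ε).left_inv k

theorem prevRow_nextRow [NeZero e] (ε : Bool) (k : Fin e) : prevRow ε (nextRow ε k) = k :=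
  (rowShift ε).right_inv k

theorem prod_prevRow [NeZero e] {A : Type*} [CommMonoid A] (ε : Bool) (f : Fin e → A) :
    ∏ k, f (prevRow ε k) = ∏ k, f k :=
  Equiv.prod_comp (rowShift ε) f

theorem prod_nextRow [NeZero e] {A : Type*} [CommMonoid A] (ε : Bool) (f : Fin e → A) :
    ∏ k, f (nextRow ε k) = ∏ k, f k :=
  Equiv.prod_comp (rowShift ε).symm f

/-- The point obtained from `x` by putting `u x^{(k∓1)}_{i_{k∓1}}` at `(k, i_k)` for all `k`. -/
def cycPt [NeZero e] {A : Type*} [Mul A] (ε : Bool) (u : A) (i : ColIdx m) (x : Box m → A) : Box m → A :=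
  fun b => if b.2 = i b.1 then u * x ⟨prevRow ε b.1, i (prevRow ε b.1)⟩ else x b

theorem aeval_opT [NeZero e] {A : Type*} [CommRing A] [Algebra Fqt A] (ε : Bool) (u : Fqt) (i : ColIdx m)
    (x : Box m → A) (f : PolyF m) :
    aeval x (opT ε u i f) = aeval (cycPt ε (algebraMap Fqt A u) i x) f := by
  have : (aeval x).comp (opT ε u i) = aeval (cycPt ε (algebraMap Fqt A u) i x) := by
    refine MvPolynomial.algHom_ext fun b => ?_
    simp only [AlgHom.comp_apply, opT, aeval_X, cycPt]
    split_ifs <;> simp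
  exact DFunLike.congr_fun this f

theorem opT_eq_aeval [NeZero e] (ε : Bool) (u : Fqt) (i : ColIdx m) (f : PolyF m) :
    opT ε u i f = aeval (cycPt ε (C u : PolyF m) i X) f := by
  conv_lhs => rw [← aeval_X_left_apply (opT ε u i f), aeval_opT]
  rfl

theorem prod_box_eq_split {A : Type*} [CommMonoid A] (i : ColIdx m) (f : Box m → A) :
    ∏ b, f b = (∏ k, f ⟨k, i k⟩) * ∏ b with b.2 ≠ i b.1, f b := by
  rw [← Finset.prod_filter_mul_prod_filter_not Finset.univ (fun b : Box m => b.2 = i b.1)]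
  congr 1
  symm
  refine Finset.prod_bij (fun k _ => ⟨k, i k⟩) (by simp) (fun a _ b _ h => ?_) ?_ (by simp)
  · exact congrArg Sigma.fst h
  · rintro ⟨k, j⟩ h
    simp only [Finset.mem_filter, Finset.mem_univ, true_and] at h
    exact ⟨k, by simp [h]⟩

theorem prod_cycPt_pow [NeZero e] {A : Type*} [CommRing A] (ε : Bool) (u : A) (i : ColIdx m) (x : Box m → A)
    (β : Box m → ℕ) :
    ∏ b, cycPt ε u i x b ^ β b = u ^ pairing β i * ∏ b, x b ^ cycMat ε i β b := by
  rw [prod_box_eq_split i, prod_box_eq_split i]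
  rw [← mul_assoc]
  congr 1
  · simp only [cycPt, if_true, cycMat, mul_pow, Finset.prod_mul_distrib, pairing]
    rw [Finset.prod_pow_eq_pow_sum]
    congr 1
    rw [← prod_prevRow ε (fun k => x ⟨k, i k⟩ ^ β ⟨nextRow ε k, i (nextRow ε k)⟩)]
    refine Finset.prod_congr rfl fun k _ => ?_
    rw [nextRow_prevRow]
  · refine Finset.prod_congr rfl fun b hb => ?_
    simp only [Finset.mem_filter, Finset.mem_univ, true_and] at hb
    simp [cycPt, cycMat, hb]

theorem opT_xpow [NeZero e] (ε : Bool) (u : Fqt) (i : ColIdx m) (β : Box m → ℕ) :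
    opT ε u i (xpow β) = C (u ^ pairing β i) * xpow (cycMat ε i β) := by
  rw [opT_eq_aeval, aeval_xpow, prod_cycPt_pow, C_pow]
  rfl

/-- The monomials and powers of `t` in the numerator are exactly `T_{t,i}` applied to the monomials
of `a_δ`. In this form the numerator can be evaluated at points. -/
theorem opD_numerator [NeZero e] (ε : Bool) (f : PolyF m) :
    (∑ w : RowPerm m, w.sgn • ∑ i : ColIdx m,
      C (tF ^ pairing (w.act (delta m)) i) * xpow (cycMat ε i (w.act (delta m))) * opT ε qF i f)
    = ∑ i : ColIdx m, opT ε tF i (alternant (delta m)) * opT ε qF i f := by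
  simp only [Finset.smul_sum]
  rw [Finset.sum_comm]
  refine Finset.sum_congr rfl fun i _ => ?_
  rw [alternant, map_sum, Finset.sum_mul]
  refine Finset.sum_congr rfl fun w _ => ?_
  rw [map_zsmul, opT_xpow, smul_mul_assoc]

/-- The action of `S_m` on column indices. -/
def RowPerm.actIdx {e : ℕ} {m : Fin e → ℕ} (w : RowPerm m) : ColIdx m ≃ ColIdx m :=
  Equiv.piCongrRight w

/-- A row permutation conjugates `T_{u,i}` into `T_{u,w(i)}`, so sums over all `i` are compatible
with the group. -/
theorem rename_opT [NeZero e] (ε : Bool) (u : Fqt) (i : ColIdx m) (w : RowPerm m) (f : PolyF m) :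
    rename (Equiv.sigmaCongrRight w) (opT ε u i f)
      = opT ε u (w.actIdx i) (rename (Equiv.sigmaCongrRight w) f) := by
  rw [rename_eq_aeval, aeval_opT, opT_eq_aeval, aeval_rename_perm]
  congr 2
  funext b
  simp only [cycPt, RowPerm.actIdx, Equiv.piCongrRight_apply, Pi.map_apply,
    EmbeddingLike.apply_eq_iff_eq]
  rfl

/-- Invariance under `S_m`. -/
def IsRowSymm {e : ℕ} {m : Fin e → ℕ} (f : PolyF m) : Prop :=
  ∀ w : RowPerm m, rename (Equiv.sigmaCongrRight w) f = f

/-- The numerator of the Macdonald operator. -/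
noncomputable def opNum [NeZero e] (ε : Bool) (f : PolyF m) : PolyF m :=
  ∑ i : ColIdx m, opT ε tF i (alternant (delta m)) * opT ε qF i f

theorem rename_opNum [NeZero e] (ε : Bool) {f : PolyF m} (hf : IsRowSymm f) (w : RowPerm m) :
    rename (Equiv.sigmaCongrRight w) (opNum ε f) = w.sgn * opNum ε f := by
  unfold opNum
  rw [map_sum, Finset.mul_sum]
  conv_rhs => rw [← Equiv.sum_comp w.actIdx]
  refine Finset.sum_congr rfl fun i _ => ?_
  rw [map_mul, rename_opT, rename_opT, hf w, rename_alternant, map_mul, map_intCast, mul_assoc]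

theorem alternant_mul_opD [NeZero e] (ε : Bool) {f : PolyF m} (hf : IsRowSymm f) :
    alternant (delta m) * opD m ε f = opNum ε f := by
  unfold opD
  rw [opD_numerator]
  exact exactQuot_spec (alternant_delta_dvd (rename_opNum ε hf))

theorem opD_unique [NeZero e] (ε : Bool) {f g : PolyF m} (hf : IsRowSymm f)
    (h : alternant (delta m) * g = opNum ε f) : opD m ε f = g :=
  mul_left_cancel₀ alternant_delta_ne_zero ((alternant_mul_opD ε hf).trans h.symm)

theorem RowPerm.sgn_mul_self (w : RowPerm m) : w.sgn * w.sgn = 1 := by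
  unfold RowPerm.sgn
  rw [← Finset.prod_mul_distrib]
  refine Finset.prod_eq_one fun k _ => ?_
  rw [← Units.val_mul, Int.units_mul_self, Units.val_one]

/-- The signs of the antisymmetric `f` and of `a_δ` cancel in the quotient. -/
theorem isRowSymm_of_alternant_mul {f g : PolyF m} (h : alternant (delta m) * g = f)
    (hf : ∀ w : RowPerm m, rename (Equiv.sigmaCongrRight w) f = w.sgn * f) : IsRowSymm g := by
  intro w
  have h1 := hf w
  rw [← h, map_mul, rename_alternant, mul_assoc] at h1
  have h2 := congrArg (fun z => (w.sgn : PolyF m) * z) h1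
  simp only [← mul_assoc, ← Int.cast_mul, RowPerm.sgn_mul_self, Int.cast_one, one_mul] at h2
  exact mul_left_cancel₀ alternant_delta_ne_zero h2

theorem IsRowSymm.opD [NeZero e] (ε : Bool) {f : PolyF m} (hf : IsRowSymm f) : IsRowSymm (opD m ε f) :=
  isRowSymm_of_alternant_mul (alternant_mul_opD ε hf) (rename_opNum ε hf)

theorem opT_isHomogeneous [NeZero e] (ε : Bool) (u : Fqt) (i : ColIdx m) {f : PolyF m} {n : ℕ}
    (hf : f.IsHomogeneous n) : (opT ε u i f).IsHomogeneous n := by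
  have h : ∀ b : Box m, (if b.2 = i b.1 then C u * X ⟨prevRow ε b.1, i (prevRow ε b.1)⟩
      else X b : PolyF m).IsHomogeneous 1 := by
    intro b
    split_ifs
    · exact isHomogeneous_C_mul_X _ _
    · exact isHomogeneous_X _ _
  have := hf.aeval _ h
  rwa [one_mul] at this

theorem opD_isHomogeneous [NeZero e] (ε : Bool) {f : PolyF m} (hf : IsRowSymm f) {n : ℕ}
    (hn : f.IsHomogeneous n) : (opD m ε f).IsHomogeneous n := by
  refine MvPolynomial.IsHomogeneous.of_mul_left (alternant_isHomogeneous (delta m))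
    alternant_delta_ne_zero ?_
  rw [alternant_mul_opD ε hf]
  exact IsHomogeneous.sum _ _ _ fun i _ =>
    (opT_isHomogeneous ε _ i (alternant_isHomogeneous _)).mul (opT_isHomogeneous ε _ i hn)

theorem IsRowSymm.add {f g : PolyF m} (hf : IsRowSymm f) (hg : IsRowSymm g) :
    IsRowSymm (f + g) := fun w => by rw [map_add, hf w, hg w]

theorem IsRowSymm.sub {f g : PolyF m} (hf : IsRowSymm f) (hg : IsRowSymm g) :
    IsRowSymm (f - g) := fun w => by rw [map_sub, hf w, hg w]

theorem IsRowSymm.smul {f : PolyF m} (hf : IsRowSymm f) (c : Fqt) : IsRowSymm (c • f) :=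
  fun w => by rw [map_smul, hf w]

theorem opNum_add [NeZero e] (ε : Bool) (f g : PolyF m) : opNum ε (f + g) = opNum ε f + opNum ε g := by
  simp only [opNum, map_add, mul_add, Finset.sum_add_distrib]

theorem opNum_smul [NeZero e] (ε : Bool) (c : Fqt) (f : PolyF m) : opNum ε (c • f) = c • opNum ε f := by
  simp only [opNum, map_smul, mul_smul_comm, Finset.smul_sum]

theorem opD_add [NeZero e] (ε : Bool) {f g : PolyF m} (hf : IsRowSymm f) (hg : IsRowSymm g) :
    opD m ε (f + g) = opD m ε f + opD m ε g := by
  refine opD_unique ε (hf.add hg) ?_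
  rw [mul_add, alternant_mul_opD ε hf, alternant_mul_opD ε hg, opNum_add]

theorem opD_smul [NeZero e] (ε : Bool) (c : Fqt) {f : PolyF m} (hf : IsRowSymm f) :
    opD m ε (c • f) = c • opD m ε f := by
  refine opD_unique ε (hf.smul c) ?_
  rw [mul_smul_comm, alternant_mul_opD ε hf, opNum_smul]

theorem opEm_add [NeZero e] (ε : Bool) {f g : PolyF m} (hf : IsRowSymm f) (hg : IsRowSymm g) :
    opEm m ε (f + g) = opEm m ε f + opEm m ε g := by
  simp only [opEm, opD_add ε hf hg, smul_add]
  abel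

theorem opEm_smul [NeZero e] (ε : Bool) (c : Fqt) {f : PolyF m} (hf : IsRowSymm f) :
    opEm m ε (c • f) = c • opEm m ε f := by
  simp only [opEm, opD_smul ε c hf, smul_sub, smul_comm c]

end Operators

/-! ### Stability of the operators when the last variables vanish -/

section Restriction

variable {e : ℕ} {m : Fin e → ℕ}

/-- Extension of a point by `0` in the last variable of each row. -/
def extPt {A : Type*} [Zero A] (x : Box m → A) : Box (fun k => m k + 1) → A :=
  fun b => if h : (b.2 : ℕ) < m b.1 then x ⟨b.1, ⟨b.2, h⟩⟩ else 0

/-- The restriction that sends the last variable of each row to `0`. -/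
noncomputable def dropLast (m : Fin e → ℕ) : PolyF (fun k => m k + 1) →ₐ[Fqt] PolyF m :=
  aeval (extPt X)

@[simp]
theorem extPt_castSucc {A : Type*} [Zero A] (x : Box m → A) (k : Fin e) (j : Fin (m k)) :
    extPt x ⟨k, j.castSucc⟩ = x ⟨k, j⟩ := by
  simp [extPt]

@[simp]
theorem extPt_last {A : Type*} [Zero A] (x : Box m → A) (k : Fin e) :
    extPt x ⟨k, Fin.last (m k)⟩ = 0 := by
  simp [extPt]

/-- In each row the determinant is expanded along its last row, which becomes `(0, …, 0, 1)`. The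
remaining exponents drop by one, leaving the product of all variables as a factor. -/
theorem rowAlt_extPt {A : Type*} [CommRing A] (x : Box m → A) (β : Box (fun k => m k + 1) → ℕ)
    (β' : Box m → ℕ) (h : ∀ k (j : Fin (m k)), β ⟨k, j.castSucc⟩ = β' ⟨k, j⟩ + 1)
    (h0 : ∀ k, β ⟨k, Fin.last (m k)⟩ = 0) :
    rowAlt β (extPt x) = (∏ b, x b) * rowAlt β' x := by
  unfold rowAlt
  rw [Fintype.prod_sigma, ← Finset.prod_mul_distrib]
  refine Finset.prod_congr rfl fun k _ => ?_
  rw [Matrix.det_succ_row _ (Fin.last (m k)), Fin.sum_univ_castSucc, Finset.sum_eq_zero, zero_add]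
  · simp only [Matrix.of_apply, extPt_last, h0, pow_zero, mul_one, Fin.val_last]
    rw [← two_mul, pow_mul, neg_one_sq, one_pow, one_mul, ← Matrix.det_mul_column]
    congr 1
    ext i j
    simp [h, pow_succ, mul_comm]
  · intro j _
    simp [h]

theorem rowAlt_extPt_eq_zero {A : Type*} [CommRing A] (x : Box m → A)
    (β : Box (fun k => m k + 1) → ℕ) (k : Fin e) (h : ∀ j, β ⟨k, j⟩ ≠ 0) :
    rowAlt β (extPt x) = 0 := by
  refine Finset.prod_eq_zero (Finset.mem_univ k) ?_
  refine Matrix.det_eq_zero_of_row_eq_zero (Fin.last (m k)) fun j => ?_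
  simp [h]

theorem delta_castSucc (k : Fin e) (j : Fin (m k)) :
    delta (fun k => m k + 1) ⟨k, j.castSucc⟩ = delta m ⟨k, j⟩ + 1 := by
  simp only [delta, Fin.val_castSucc]
  omega

theorem delta_last (k : Fin e) : delta (fun k => m k + 1) ⟨k, Fin.last (m k)⟩ = 0 := by
  simp [delta]

theorem dropLast_alternant (β : Box (fun k => m k + 1) → ℕ) :
    dropLast m (alternant β) = rowAlt β (extPt X) := aeval_alternant _ _

theorem dropLast_alternant_delta :
    dropLast m (alternant (delta (fun k => m k + 1))) = (∏ b, X b) * alternant (delta m) := by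
  rw [dropLast_alternant, rowAlt_extPt _ _ (delta m) delta_castSucc delta_last,
    alternant_eq_rowAlt]

theorem prod_X_ne_zero : (∏ b, X b : PolyF m) ≠ 0 :=
  Finset.prod_ne_zero_iff.2 fun b _ => X_ne_zero b

open scoped Fin.CommRing in
-- The rows form a single cycle, so a property that passes from each row to the adjacent one and
-- holds once holds everywhere.
theorem forall_of_prevRow [NeZero e] (ε : Bool) (p : Fin e → Prop) (h : ∀ k, p (prevRow ε k) → p k)
    {j : Fin e} (hj : p j) (k : Fin e) : p k := by
  have key : ∀ s : ℕ, p (if ε then j + (s : Fin e) else j - (s : Fin e)) := by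
    intro s
    induction s with
    | zero => cases ε <;> simpa using hj
    | succ s ih =>
      refine h _ ?_
      cases ε
      · simp only [Bool.false_eq_true, if_false, prevRow] at ih ⊢
        convert ih using 1
        push_cast
        ring
      · simp only [if_true, prevRow] at ih ⊢
        convert ih using 1
        push_cast
        ring
  cases ε
  · simpa using key (j - k).val
  · simpa using key (k - j).val

/-- The column indices of the larger box none of which is last. -/
def castIdx (i : ColIdx m) : ColIdx (fun k => m k + 1) := fun k => (i k).castSucc

/-- The column index of the larger box all of whose entries are last. -/
def lastIdx (m : Fin e → ℕ) : ColIdx (fun k => m k + 1) := fun k => Fin.last (m k)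

theorem eq_castIdx {i : ColIdx (fun k => m k + 1)} (h : ∀ k, i k ≠ Fin.last (m k)) :
    ∃ j : ColIdx m, castIdx j = i :=
  ⟨fun k => (i k).castPred (h k), funext fun k => by simp [castIdx]⟩

/-- A column index selecting the last column in some rows but not in all must switch somewhere along
the cycle of rows, and there its term vanishes. Only the all-last index and those avoiding the last
column remain. -/
theorem sum_colIdx_succ [NeZero e] {A : Type*} [AddCommMonoid A] (ε : Bool)
    (F : ColIdx (fun k => m k + 1) → A)
    (h : ∀ i k, i k ≠ Fin.last (m k) → i (prevRow ε k) = Fin.last (m (prevRow ε k)) → F i = 0) :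
    ∑ i, F i = F (lastIdx m) + ∑ i : ColIdx m, F (castIdx i) := by
  classical
  have h1 : F (lastIdx m) + ∑ i : ColIdx m, F (castIdx i)
      = ∑ i : Option (ColIdx m), F (i.elim (lastIdx m) castIdx) := by
    rw [Fintype.sum_option]
    rfl
  rw [h1]
  symm
  refine Finset.sum_of_injOn (fun i : Option (ColIdx m) => i.elim (lastIdx m) castIdx) ?_ (by simp)
    ?_ (fun _ _ => rfl)
  · rintro (_ | i) _ (_ | j) _ hij
    · rfl
    · have := congrFun hij 0
      simp only [Option.elim, lastIdx, castIdx] at this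
      exact absurd this.symm (Fin.castSucc_lt_last _).ne
    · have := congrFun hij 0
      simp only [Option.elim, lastIdx, castIdx] at this
      exact absurd this (Fin.castSucc_lt_last _).ne
    · congr 1
      funext k
      have := congrFun hij k
      simpa [castIdx] using this
  · intro i _ hi
    by_cases hall : ∃ j, i j = Fin.last (m j)
    · obtain ⟨j, hj⟩ := hall
      by_contra hF
      have : ∀ k, i k = Fin.last (m k) := by
        refine forall_of_prevRow ε (fun k => i k = Fin.last (m k)) (fun k hk => ?_) hj
        by_contra hk'
        exact hF (h i k hk' hk)
      exact hi ⟨none, by simp, (funext this).symm⟩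
    · push Not at hall
      obtain ⟨j, rfl⟩ := eq_castIdx hall
      exact absurd ⟨some j, by simp, rfl⟩ hi

theorem cycPt_castIdx [NeZero e] {A : Type*} [CommRing A] (ε : Bool) (u : A) (i : ColIdx m) (x : Box m → A) :
    cycPt ε u (castIdx i) (extPt x) = extPt (cycPt ε u i x) := by
  funext ⟨k, j⟩
  refine Fin.lastCases ?_ (fun j => ?_) j
  · simp only [cycPt, castIdx, extPt_last]
    rw [if_neg (Fin.castSucc_lt_last _).ne']
  · simp [cycPt, castIdx]

theorem cycPt_lastIdx [NeZero e] {A : Type*} [CommRing A] (ε : Bool) (u : A) (x : Box m → A) :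
    cycPt ε u (lastIdx m) (extPt x) = extPt x := by
  funext ⟨k, j⟩
  simp only [cycPt, lastIdx, extPt_last, mul_zero]
  split_ifs with h
  · rw [h, extPt_last]
  · rfl

theorem prod_cycPt [NeZero e] {A : Type*} [CommRing A] (ε : Bool) (u : A) (i : ColIdx m) (x : Box m → A) :
    ∏ b, cycPt ε u i x b = u ^ e * ∏ b, x b := by
  have h := prod_cycPt_pow ε u i x (fun _ => 1)
  simpa [pairing, cycMat] using h

/-- The all-last index acts as the identity, since it only moves zeros. Indices avoiding the last
column reproduce the smaller operator; the factor `t ^ e` arises because `T_{t,i}` also acts on the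
product of all variables split off from the alternant. -/
theorem dropLast_opNum [NeZero e] (ε : Bool) (f : PolyF (fun k => m k + 1)) :
    dropLast m (opNum ε f) = (∏ b, X b) *
      (alternant (delta m) * dropLast m f + C (tF ^ e) * opNum ε (dropLast m f)) := by
  have h : ∀ i (u : Fqt) (g : PolyF (fun k => m k + 1)), dropLast m (opT ε u i g)
      = aeval (cycPt ε (C u : PolyF m) i (extPt X)) g := fun i u g => aeval_opT ε u i _ g
  have h' : ∀ i (u : Fqt) (g : PolyF (fun k => m k + 1)), dropLast m (opT ε u (castIdx i) g)
      = opT ε u i (dropLast m g) := by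
    intro i u g
    rw [h, cycPt_castIdx, opT_eq_aeval, dropLast]
    have : aeval (extPt (cycPt ε (C u : PolyF m) i X))
        = (aeval (cycPt ε (C u : PolyF m) i X)).comp (aeval (extPt (X : Box m → PolyF m))) := by
      refine MvPolynomial.algHom_ext fun b => ?_
      simp only [AlgHom.comp_apply, aeval_X, extPt]
      split_ifs <;> simp
    rw [this]
    rfl
  simp only [opNum, map_sum, map_mul]
  rw [sum_colIdx_succ ε]
  · rw [h, h, cycPt_lastIdx, cycPt_lastIdx, ← dropLast, dropLast_alternant_delta, mul_add]
    congr 1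
    · ring
    · rw [Finset.mul_sum, Finset.mul_sum]
      refine Finset.sum_congr rfl fun i _ => ?_
      rw [h', h', dropLast_alternant_delta, map_mul, map_prod, opT_eq_aeval]
      have := prod_cycPt ε (C tF : PolyF m) i X
      simp only [opT_eq_aeval, aeval_X]
      rw [this, C_pow]
      ring
  · intro i k hk hk'
    -- For a mixed index, row `k` has two zeros: its untouched last entry, and the entry at `i k`,
    -- which receives the vanishing last variable of the preceding row.
    rw [h, aeval_alternant, rowAlt_eq_zero _ _ hk, zero_mul]
    simp only [cycPt, if_true, hk']
    rw [if_neg hk.symm, extPt_last, extPt_last, mul_zero]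

theorem dropLast_opD [NeZero e] (ε : Bool) {f : PolyF (fun k => m k + 1)} (hf : IsRowSymm f)
    (hf' : IsRowSymm (dropLast m f)) :
    dropLast m (opD _ ε f) = dropLast m f + tF ^ e • opD m ε (dropLast m f) := by
  have h := congrArg (dropLast m) (alternant_mul_opD ε hf)
  rw [map_mul, dropLast_alternant_delta, dropLast_opNum, ← alternant_mul_opD ε hf'] at h
  refine mul_left_cancel₀ (mul_ne_zero prod_X_ne_zero alternant_delta_ne_zero) (h.trans ?_)
  rw [smul_eq_C_mul]
  ring

theorem tF_ne_zero : tF ≠ 0 := by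
  unfold tF
  rw [Ne, FaithfulSMul.algebraMap_eq_zero_iff]
  exact X_ne_zero _

/-- The condition in the normalizing constant says that the selected entries of `δ` agree along the
cycle of rows. -/
theorem cycMat_delta_iff [NeZero e] (ε : Bool) (i : ColIdx m) : cycMat ε i (delta m) = delta m ↔
    ∀ k, delta m ⟨k, i k⟩ = delta m ⟨prevRow ε k, i (prevRow ε k)⟩ := by
  constructor
  · intro h k
    have := congrFun h ⟨prevRow ε k, i (prevRow ε k)⟩
    have h2 : (⟨nextRow ε (prevRow ε k), i (nextRow ε (prevRow ε k))⟩ : Box m) = ⟨k, i k⟩ := by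
      rw [nextRow_prevRow]
    simpa [cycMat, h2] using this
  · intro h
    funext b
    simp only [cycMat]
    split_ifs with hb
    · rw [h, prevRow_nextRow, ← hb]
    · rfl

open scoped Classical in
-- Passing to the larger box raises each of the `e` selected entries of `δ` by one and `M` by `e`,
-- so old terms are unchanged. The all-last index adds one term, with pairing zero.
theorem normConst_succ [NeZero e] (ε : Bool) :
    normConst (fun k => m k + 1) ε
      = normConst m ε + tF ^ (-((∑ k, (m k + 1) : ℕ) : ℤ)) := by
  unfold normConst
  rw [Finset.sum_filter, sum_colIdx_succ ε, add_comm]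
  · congr 1
    · rw [Finset.sum_filter]
      refine Finset.sum_congr rfl fun i _ => ?_
      have hiff : cycMat ε (castIdx i) (delta fun k => m k + 1) = delta (fun k => m k + 1) ↔
          cycMat ε i (delta m) = delta m := by
        simp only [cycMat_delta_iff, castIdx, delta_castSucc, Nat.add_right_cancel_iff]
      simp only [hiff]
      congr 2
      simp only [pairing, castIdx, delta_castSucc, Finset.sum_add_distrib]
      push_cast
      ring
    · rw [if_pos]
      · congr 1
        simp [pairing, lastIdx, delta_last]
      · simp [cycMat_delta_iff, lastIdx, delta_last]
  · intro i k hk hk'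
    rw [if_neg]
    intro h
    have h1 := (cycMat_delta_iff ε i).1 h k
    rw [hk', delta_last] at h1
    obtain ⟨j, hj⟩ : ∃ j : Fin (m k), j.castSucc = i k := ⟨(i k).castPred hk, by simp⟩
    rw [← hj, delta_castSucc] at h1
    omega

/-- The operators `D` restrict to `1 + t ^ e D`. The power `t^{-M}` absorbs `t ^ e`, and the extra
identity is cancelled by the new term of the normalizing constant; this explains the form of `E`. -/
theorem dropLast_opEm [NeZero e] (ε : Bool) {f : PolyF (fun k => m k + 1)} (hf : IsRowSymm f)
    (hf' : IsRowSymm (dropLast m f)) :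
    dropLast m (opEm _ ε f) = opEm m ε (dropLast m f) := by
  unfold opEm
  rw [map_sub, map_smul, map_smul, dropLast_opD ε hf hf', normConst_succ, smul_add, add_smul,
    smul_smul]
  have : tF ^ (-((∑ k, (m k + 1) : ℕ) : ℤ)) * tF ^ e = tF ^ (-((∑ k, m k : ℕ) : ℤ)) := by
    rw [← zpow_natCast, ← zpow_add₀ tF_ne_zero]
    congr 1
    simp [Finset.sum_add_distrib]
  rw [this]
  abel

theorem opEm_isHomogeneous [NeZero e] (ε : Bool) {f : PolyF m} (hf : IsRowSymm f) {n : ℕ}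
    (hn : f.IsHomogeneous n) : (opEm m ε f).IsHomogeneous n := by
  unfold opEm
  rw [smul_eq_C_mul, smul_eq_C_mul]
  exact ((opD_isHomogeneous ε hf hn).C_mul _).sub (hn.C_mul _)

theorem IsRowSymm.opEm [NeZero e] (ε : Bool) {f : PolyF m} (hf : IsRowSymm f) : IsRowSymm (opEm m ε f) :=
  ((hf.opD ε).smul _).sub (hf.smul _)

/-- The operator `E^±` preserves the space of symmetric functions. -/
theorem opE_mem_Xi [NeZero e] (ε : Bool) {n : ℕ} {f : PolySeq m} (hf : f ∈ Xi m n) : opE m ε f ∈ Xi m n := by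
  intro l
  refine ⟨opEm_isHomogeneous ε (hf l).2.1 (hf l).1, IsRowSymm.opEm ε (hf l).2.1, ?_⟩
  have h1 : IsRowSymm (f (l + 1)) := (hf (l + 1)).2.1
  have h2 : dropLast (shiftBy m l) (f (l + 1)) = f l := (hf l).2.2
  have h3 : IsRowSymm (dropLast (shiftBy m l) (f (l + 1))) := h2 ▸ (hf l).2.1
  have := dropLast_opEm (m := shiftBy m l) ε h1 h3
  rw [h2] at this
  exact this

end Restriction

/-! ### Stability of the Schur polynomials -/

section SchurRestriction

variable {e n : ℕ} {m : Fin e → ℕ}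

theorem YoungDiagram.rowLen_eq_zero_iff {μ : YoungDiagram} {i : ℕ} :
    μ.rowLen i = 0 ↔ μ.colLen 0 ≤ i := by
  rw [← not_lt, ← YoungDiagram.mem_iff_lt_colLen, YoungDiagram.mem_iff_lt_rowLen]
  omega

theorem alternant_mul_schurPoly {α : EPartition e n} (h : Fits m α) :
    alternant (delta m) * schurPoly m α = alternant (partsMatrix m α + delta m) := by
  unfold schurPoly
  rw [if_pos h]
  exact exactQuot_spec (alternant_delta_dvd fun w => rename_alternant w _)

theorem partsMatrix_castSucc (α : EPartition e n) (k : Fin e) (j : Fin (m k)) :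
    partsMatrix (fun k => m k + 1) α ⟨k, j.castSucc⟩ = partsMatrix m α ⟨k, j⟩ := rfl

theorem dropLast_schurPoly (α : EPartition e n) :
    dropLast m (schurPoly (fun k => m k + 1) α) = schurPoly m α := by
  by_cases h1 : Fits (fun k => m k + 1) α
  · have h := congrArg (dropLast m) (alternant_mul_schurPoly h1)
    rw [map_mul, dropLast_alternant_delta, dropLast_alternant] at h
    refine mul_left_cancel₀ (mul_ne_zero prod_X_ne_zero alternant_delta_ne_zero) (h.trans ?_)
    by_cases h2 : Fits m α
    · rw [mul_assoc, alternant_mul_schurPoly h2, alternant_eq_rowAlt]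
      refine rowAlt_extPt _ _ _ (fun k j => ?_) fun k => ?_
      · simp only [Pi.add_apply, delta_castSucc, partsMatrix_castSucc, add_assoc]
      · simp only [Pi.add_apply, delta_last, add_zero, partsMatrix, Fin.val_last]
        exact YoungDiagram.rowLen_eq_zero_iff.2 (h2 k)
    · rw [schurPoly, if_neg h2, mul_zero]
      simp only [Fits, not_forall, not_le] at h2
      obtain ⟨k, hk⟩ := h2
      -- With too many parts in row `k`, all exponents of `α + δ` in that row are positive, so
      -- setting the last variable to zero kills the alternant.
      refine rowAlt_extPt_eq_zero _ _ k fun j => ?_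
      refine Fin.lastCases ?_ (fun j => ?_) j
      · simp only [Pi.add_apply, delta_last, add_zero, partsMatrix, Fin.val_last, Ne]
        rw [YoungDiagram.rowLen_eq_zero_iff]
        omega
      · simp only [Pi.add_apply, delta_castSucc]
        omega
  · have h2 : ¬ Fits m α := fun h => h1 fun k => (h k).trans (Nat.le_succ _)
    rw [schurPoly, if_neg h1, schurPoly, if_neg h2, map_zero]

theorem isRowSymm_schurPoly (α : EPartition e n) : IsRowSymm (schurPoly m α) := by
  by_cases h : Fits m α
  · exact isRowSymm_of_alternant_mul (alternant_mul_schurPoly h) fun w => rename_alternant w _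
  · rw [schurPoly, if_neg h]
    exact fun w => map_zero _

end SchurRestriction

/-! ### Orbits of exponent matrices and `e`-partitions -/

section Types

variable {e n : ℕ} {m : Fin e → ℕ}

/-- The multisets of non-zero entries of the rows of a matrix. -/
def rowType (γ : Box m → ℕ) (k : Fin e) : Multiset ℕ :=
  ((Finset.univ : Finset (Fin (m k))).val.map fun j => γ ⟨k, j⟩).filter (· ≠ 0)

/-- The multisets of non-zero parts of an `e`-partition. -/
def EPartition.parts (α : EPartition e n) (k : Fin e) : Multiset ℕ := ((α.1 k).rowLens : Multiset ℕ)

theorem YoungDiagram.sum_rowLens (μ : YoungDiagram) : μ.rowLens.sum = μ.card := by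
  have h : ∀ c ∈ μ.cells, c.1 ∈ Finset.range (μ.colLen 0) := by
    rintro ⟨i, j⟩ hc
    rw [Finset.mem_range, ← YoungDiagram.mem_iff_lt_colLen]
    exact μ.up_left_mem le_rfl (Nat.zero_le j) hc
  rw [YoungDiagram.card, Finset.card_eq_sum_card_fiberwise h, YoungDiagram.rowLens,
    ← List.sum_toFinset _ List.nodup_range, List.toFinset_range]
  exact Finset.sum_congr rfl fun i _ => YoungDiagram.rowLen_eq_card μ

/-- Both functions have the same sorted rearrangement; composing one sorting permutation with the
inverse of the other gives the witness. -/
theorem Fin.exists_perm_of_map_univ_eq {N : ℕ} {f g : Fin N → ℕ}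
    (h : (Finset.univ : Finset (Fin N)).val.map f = Finset.univ.val.map g) :
    ∃ w : Equiv.Perm (Fin N), f ∘ w = g := by
  have h1 : f ∘ Tuple.sort f = g ∘ Tuple.sort g := by
    apply List.ofFn_injective
    refine List.Perm.eq_of_sortedLE (Tuple.monotone_sort f).sortedLE_ofFn
      (Tuple.monotone_sort g).sortedLE_ofFn ?_
    refine ((Tuple.sort f).ofFn_comp_perm f).trans
      (List.Perm.trans ?_ ((Tuple.sort g).ofFn_comp_perm g).symm)
    rw [Fin.univ_val_map, Fin.univ_val_map] at h
    exact Multiset.coe_eq_coe.1 h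
  refine ⟨(Tuple.sort g).symm.trans (Tuple.sort f), ?_⟩
  funext j
  have := congrFun h1 ((Tuple.sort g).symm j)
  simpa using this

theorem Multiset.filter_add_replicate_zero (s : Multiset ℕ) :
    s.filter (· ≠ 0) + Multiset.replicate (s.card - (s.filter (· ≠ 0)).card) 0 = s := by
  have h1 := Multiset.filter_add_not (· ≠ 0) s
  have h2 : s.filter (fun a => ¬ a ≠ 0)
      = Multiset.replicate (s.filter (fun a => ¬ a ≠ 0)).card 0 :=
    Multiset.eq_replicate_card.2 fun b hb => by simpa using (Multiset.mem_filter.1 hb).2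
  have h3 := congrArg Multiset.card h1
  rw [Multiset.card_add] at h3
  have h4 : s.card - (s.filter (· ≠ 0)).card = (s.filter (fun a => ¬ a ≠ 0)).card := by omega
  rw [h4, ← h2, h1]

theorem rowType_act (γ : Box m → ℕ) (w : RowPerm m) : rowType (w.act γ) = rowType γ := by
  funext k
  unfold rowType
  congr 1
  have : (fun j => w.act γ ⟨k, j⟩) = (fun j => γ ⟨k, j⟩) ∘ ((w k)⁻¹ : Equiv.Perm _) := rfl
  rw [this, ← Multiset.map_map]
  congr 1
  exact Multiset.map_univ_val_equiv _

/-- Row lengths are fixed, so the nonzero entries determine the number of zeros and therefore the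
orbit. Zeros are left out to make the invariant independent of the number of variables. -/
theorem rowType_eq_iff {γ γ' : Box m → ℕ} :
    rowType γ = rowType γ' ↔ ∃ w : RowPerm m, w.act γ' = γ := by
  refine ⟨fun h => ?_, fun ⟨w, hw⟩ => by rw [← hw, rowType_act]⟩
  have h1 : ∀ k, ∃ w : Equiv.Perm (Fin (m k)), (fun j => γ' ⟨k, j⟩) ∘ w = fun j => γ ⟨k, j⟩ := by
    intro k
    refine Fin.exists_perm_of_map_univ_eq ?_
    rw [← Multiset.filter_add_replicate_zero (Multiset.map (fun j => γ' ⟨k, j⟩) _),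
      ← Multiset.filter_add_replicate_zero (Multiset.map (fun j => γ ⟨k, j⟩) _)]
    have hk : rowType γ k = rowType γ' k := congrFun h k
    unfold rowType at hk
    rw [hk]
    simp
  choose w hw using h1
  refine ⟨fun k => (w k)⁻¹, ?_⟩
  funext ⟨k, j⟩
  simpa [RowPerm.act] using congrFun (hw k) j

theorem Fits.rowType_partsMatrix {α : EPartition e n} (h : Fits m α) :
    rowType (partsMatrix m α) = α.parts := by
  funext k
  change Multiset.filter (· ≠ 0) ((Finset.univ : Finset (Fin (m k))).val.map
    fun j : Fin (m k) => (α.1 k).rowLen j) = ((α.1 k).rowLens : Multiset ℕ)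
  have hk := h k
  revert hk
  generalize α.1 k = μ
  intro hk
  obtain ⟨d, hd⟩ := Nat.exists_eq_add_of_le hk
  have h1 : (Finset.univ : Finset (Fin (m k))).val.map (fun j : Fin (m k) => μ.rowLen j)
      = (Multiset.range (m k)).map μ.rowLen := by
    rw [Fin.univ_val_map, ← Multiset.coe_range, Multiset.map_coe]
    congr 1
    apply List.ext_getElem <;> simp
  have h2 : ∀ j, μ.rowLen j = 0 ↔ μ.colLen 0 ≤ j :=
    fun j => YoungDiagram.rowLen_eq_zero_iff
  rw [h1, hd, Multiset.range_add, Multiset.map_add, Multiset.filter_add, Multiset.map_map,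
    Multiset.filter_eq_self.2, Multiset.filter_eq_nil.2, add_zero]
  · rfl
  · intro a ha
    obtain ⟨j, -, rfl⟩ := Multiset.mem_map.1 ha
    simp [h2]
  · intro a ha
    obtain ⟨j, hj, rfl⟩ := Multiset.mem_map.1 ha
    rw [Ne, h2]
    simpa using hj

theorem fits_of_rowType_eq {α : EPartition e n} {γ : Box m → ℕ} (h : rowType γ = α.parts) :
    Fits m α := by
  intro k
  have h1 := congrArg Multiset.card (congrFun h k)
  have h2 : (rowType γ k).card ≤ m k := by
    refine (Multiset.card_le_card (Multiset.filter_le _ _)).trans ?_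
    simp
  rwa [h1, EPartition.parts, Multiset.coe_card, YoungDiagram.length_rowLens] at h2

theorem EPartition.parts_injective :
    Function.Injective (EPartition.parts : EPartition e n → Fin e → Multiset ℕ) := by
  intro α β h
  refine Subtype.ext (funext fun k => YoungDiagram.equivListRowLens.injective (Subtype.ext ?_))
  exact List.Perm.eq_of_sortedGE (α.1 k).rowLens_sorted (β.1 k).rowLens_sorted
    (Multiset.coe_eq_coe.1 (congrFun h k))

theorem EPartition.sum_parts (α : EPartition e n) : ∑ k, (α.parts k).sum = n := by
  simp only [EPartition.parts, Multiset.sum_coe, YoungDiagram.sum_rowLens]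
  exact α.2

theorem EPartition.pos_of_mem_parts {α : EPartition e n} {k : Fin e} {a : ℕ}
    (h : a ∈ α.parts k) : 0 < a :=
  YoungDiagram.pos_of_mem_rowLens _ _ h

theorem EPartition.exists_parts_eq {μ : Fin e → Multiset ℕ} (h0 : ∀ k, ∀ a ∈ μ k, 0 < a)
    (hn : ∑ k, (μ k).sum = n) : ∃ α : EPartition e n, α.parts = μ := by
  have h1 : ∀ k, ∃ d : YoungDiagram, (d.rowLens : Multiset ℕ) = μ k := by
    intro k
    have hs : ((μ k).sort (· ≥ ·)).SortedGE := (Multiset.pairwise_sort _ _).sortedGE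
    refine ⟨YoungDiagram.ofRowLens _ hs, ?_⟩
    rw [YoungDiagram.rowLens_ofRowLens_eq_self, Multiset.sort_eq]
    intro a ha
    exact h0 k a ((Multiset.mem_sort _).1 ha)
  choose d hd using h1
  refine ⟨⟨d, ?_⟩, funext hd⟩
  rw [← hn]
  refine Finset.sum_congr rfl fun k _ => ?_
  rw [← hd k, Multiset.sum_coe, YoungDiagram.sum_rowLens]

theorem sum_rowType (γ : Box m → ℕ) : ∑ k, (rowType γ k).sum = ∑ b, γ b := by
  rw [Fintype.sum_sigma]
  refine Finset.sum_congr rfl fun k _ => ?_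
  have h := congrArg Multiset.sum
    (Multiset.filter_add_replicate_zero ((Finset.univ : Finset (Fin (m k))).val.map
      fun j => γ ⟨k, j⟩))
  rw [Multiset.sum_add, Multiset.sum_replicate, smul_zero, add_zero] at h
  exact h

theorem exists_parts_eq_rowType {γ : Box m → ℕ} (hγ : ∑ b, γ b = n) :
    ∃ α : EPartition e n, α.parts = rowType γ :=
  EPartition.exists_parts_eq (fun _ _ ha => Nat.pos_of_ne_zero (Multiset.mem_filter.1 ha).2)
    ((sum_rowType γ).trans hγ)

theorem EPartition.colLen_le (α : EPartition e n) (k : Fin e) : (α.1 k).colLen 0 ≤ n := by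
  have h1 : (α.1 k).card ≤ n :=
    (Finset.single_le_sum (f := fun k => (α.1 k).card) (fun _ _ => Nat.zero_le _)
      (Finset.mem_univ k)).trans_eq α.2
  rw [YoungDiagram.colLen_eq_card]
  exact (Finset.card_le_card (Finset.filter_subset _ _)).trans h1

theorem fits_of_le (hm : ∀ k, n ≤ m k) (α : EPartition e n) : Fits m α :=
  fun k => (α.colLen_le k).trans (hm k)

end Types

/-! ### Monomial polynomials as a basis of the symmetric ones -/

section Monomial

variable {e n : ℕ} {m : Fin e → ℕ}

/-- A matrix of exponents as a finitely supported function. -/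
noncomputable abbrev mexp (γ : Box m → ℕ) : Box m →₀ ℕ := Finsupp.equivFunOnFinite.symm γ

theorem exists_mexp (d : Box m →₀ ℕ) : ∃ γ : Box m → ℕ, mexp γ = d :=
  ⟨d, Finsupp.equivFunOnFinite.symm_apply_apply d⟩

theorem mexp_injective : Function.Injective (mexp : (Box m → ℕ) → _) :=
  Finsupp.equivFunOnFinite.symm.injective

theorem PolyF.ext {f g : PolyF m} (h : ∀ γ, coeff (mexp γ) f = coeff (mexp γ) g) : f = g := by
  refine MvPolynomial.ext _ _ fun d => ?_
  obtain ⟨γ, rfl⟩ := exists_mexp d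
  exact h γ

theorem xpow_eq_monomial (γ : Box m → ℕ) : (xpow γ : PolyF m) = monomial (mexp γ) 1 := by
  rw [monomial_eq, C_1, one_mul, Finsupp.prod_fintype _ _ fun _ => pow_zero _]
  rfl

theorem degree_mexp (γ : Box m → ℕ) : (mexp γ).degree = ∑ b, γ b := by
  rw [Finsupp.degree_eq_sum]
  rfl

open scoped Classical in
theorem coeff_monoPoly (α : EPartition e n) (γ : Box m → ℕ) :
    coeff (mexp γ) (monoPoly m α) = if rowType γ = α.parts then 1 else 0 := by
  unfold monoPoly
  split_ifs with h1 h2 h2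
  · obtain ⟨w, hw⟩ := rowType_eq_iff.1 (h2.trans h1.rowType_partsMatrix.symm)
    rw [coeff_sum, Finset.sum_eq_single γ]
    · rw [xpow_eq_monomial, coeff_monomial, if_pos rfl]
    · intro b _ hb
      rw [xpow_eq_monomial, coeff_monomial, if_neg fun h => hb (mexp_injective h)]
    · intro h
      exact absurd (Finset.mem_image.2 ⟨w, Finset.mem_univ _, hw⟩) h
  · rw [coeff_sum]
    refine Finset.sum_eq_zero fun b hb => ?_
    obtain ⟨w, -, rfl⟩ := Finset.mem_image.1 hb
    rw [xpow_eq_monomial, coeff_monomial, if_neg]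
    intro h
    apply h2
    rw [← mexp_injective h, rowType_act, h1.rowType_partsMatrix]
  · exact absurd (fits_of_rowType_eq h2) h1
  · rfl

theorem mexp_mapDomain_perm (w : RowPerm m) (γ : Box m → ℕ) :
    Finsupp.mapDomain (Equiv.sigmaCongrRight w) (mexp γ) = mexp (w.act γ) := by
  rw [← Finsupp.equivMapDomain_eq_mapDomain]
  ext b
  simp [Finsupp.equivMapDomain_apply, RowPerm.act]

theorem coeff_rename_act (w : RowPerm m) (γ : Box m → ℕ) (f : PolyF m) :
    coeff (mexp (w.act γ)) (rename (Equiv.sigmaCongrRight w) f) = coeff (mexp γ) f := by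
  rw [← mexp_mapDomain_perm]
  exact coeff_rename_mapDomain _ (Equiv.injective _) _ _

theorem IsRowSymm.coeff_act {f : PolyF m} (hf : IsRowSymm f) (w : RowPerm m) (γ : Box m → ℕ) :
    coeff (mexp (w.act γ)) f = coeff (mexp γ) f := by
  conv_lhs => rw [← hf w]
  exact coeff_rename_act w γ f

theorem isRowSymm_of_coeff {f : PolyF m}
    (h : ∀ (w : RowPerm m) γ, coeff (mexp (w.act γ)) f = coeff (mexp γ) f) : IsRowSymm f := by
  intro w
  refine PolyF.ext fun γ => ?_
  have : γ = w.act (RowPerm.act w⁻¹ γ) := by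
    funext b
    simp [RowPerm.act]
  rw [this, coeff_rename_act, ← h w]

theorem IsRowSymm.coeff_eq {f : PolyF m} (hf : IsRowSymm f) {γ γ' : Box m → ℕ}
    (h : rowType γ = rowType γ') : coeff (mexp γ) f = coeff (mexp γ') f := by
  obtain ⟨w, rfl⟩ := rowType_eq_iff.1 h
  exact hf.coeff_act w γ'

theorem isRowSymm_monoPoly (α : EPartition e n) : IsRowSymm (monoPoly m α) :=
  isRowSymm_of_coeff fun w γ => by rw [coeff_monoPoly, coeff_monoPoly, rowType_act]

theorem monoPoly_isHomogeneous (α : EPartition e n) : (monoPoly m α).IsHomogeneous n := by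
  intro d hd
  obtain ⟨γ, rfl⟩ := exists_mexp d
  rw [coeff_monoPoly] at hd
  have h : rowType γ = α.parts := by
    by_contra h
    exact hd (if_neg h)
  have := sum_rowType γ
  rw [h, α.sum_parts, ← degree_mexp] at this
  rw [this, Finsupp.degree_eq_weight_one]
  rfl

theorem coeff_monoPoly_partsMatrix (hm : ∀ k, n ≤ m k) [DecidableEq (EPartition e n)]
    (α β : EPartition e n) :
    coeff (mexp (partsMatrix m β)) (monoPoly m α) = if α = β then 1 else 0 := by
  classical
  rw [coeff_monoPoly, (fits_of_le hm β).rowType_partsMatrix]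
  by_cases h : α = β
  · rw [if_pos h, if_pos (h ▸ rfl)]
  · rw [if_neg h, if_neg fun h' => h (EPartition.parts_injective h').symm]

/-- With at least `n` variables in each row, every exponent matrix of total degree `n` lies in the
orbit of some `e`-partition. -/
theorem ext_of_coeff_partsMatrix (hm : ∀ k, n ≤ m k) {f g : PolyF m} (hf : IsRowSymm f)
    (hg : IsRowSymm g) (hf' : f.IsHomogeneous n) (hg' : g.IsHomogeneous n)
    (h : ∀ α : EPartition e n, coeff (mexp (partsMatrix m α)) f
      = coeff (mexp (partsMatrix m α)) g) : f = g := by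
  refine PolyF.ext fun γ => ?_
  by_cases hn : ∑ b, γ b = n
  · obtain ⟨α, hα⟩ := exists_parts_eq_rowType hn
    have := (fits_of_le hm α).rowType_partsMatrix.trans hα
    rw [hf.coeff_eq this.symm, hg.coeff_eq this.symm, h]
  · rw [hf'.coeff_eq_zero (by rwa [degree_mexp]), hg'.coeff_eq_zero (by rwa [degree_mexp])]

theorem IsRowSymm.sum {ι : Type*} (s : Finset ι) (f : ι → PolyF m) (h : ∀ i ∈ s, IsRowSymm (f i)) :
    IsRowSymm (∑ i ∈ s, f i) := by
  intro w
  rw [map_sum]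
  exact Finset.sum_congr rfl fun i hi => h i hi w

theorem IsHomogeneous.smul' {σ R : Type*} [CommSemiring R] {f : MvPolynomial σ R} {n : ℕ}
    (h : f.IsHomogeneous n) (c : R) : (c • f).IsHomogeneous n := by
  rw [smul_eq_C_mul]
  exact h.C_mul c

theorem eq_sum_monoPoly (hm : ∀ k, n ≤ m k) {f : PolyF m} (hf : IsRowSymm f)
    (hf' : f.IsHomogeneous n) :
    f = ∑ α : EPartition e n, coeff (mexp (partsMatrix m α)) f • monoPoly m α := by
  classical
  refine ext_of_coeff_partsMatrix hm hf
    (IsRowSymm.sum _ _ fun α _ => (isRowSymm_monoPoly α).smul _) hf'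
    (IsHomogeneous.sum _ _ _ fun α _ => IsHomogeneous.smul' (monoPoly_isHomogeneous α) _)
    fun α => ?_
  rw [coeff_sum]
  simp [coeff_smul, coeff_monoPoly_partsMatrix hm]

end Monomial

/-! ### The inverse limit is determined at a finite stage -/

section Limit

variable {e n : ℕ} {m : Fin e → ℕ}

/-- The inclusion of the box into the box with one more column. -/
def boxCast (m : Fin e → ℕ) (b : Box m) : Box (fun k => m k + 1) := ⟨b.1, b.2.castSucc⟩

theorem boxCast_injective : Function.Injective (boxCast m) := by
  rintro ⟨k, i⟩ ⟨k', i'⟩ h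
  obtain ⟨h1, h2⟩ := Sigma.mk.inj_iff.1 h
  dsimp only at h1 h2
  subst h1
  rw [heq_eq_eq, Fin.castSucc_inj] at h2
  rw [h2]

theorem dropLast_eq_killCompl : dropLast m = killCompl boxCast_injective := by
  refine MvPolynomial.algHom_ext fun b => ?_
  rw [dropLast, aeval_X]
  obtain ⟨k, j⟩ := b
  refine Fin.lastCases ?_ (fun j => ?_) j
  · rw [extPt_last, killCompl, aeval_X, dif_neg]
    rintro ⟨⟨k', j'⟩, h⟩
    obtain ⟨rfl, h2⟩ := Sigma.mk.inj_iff.1 h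
    exact (Fin.castSucc_lt_last j').ne (eq_of_heq h2)
  · rw [extPt_castSucc]
    have := killCompl_rename_app (R := Fqt) (boxCast_injective (m := m)) (X ⟨k, j⟩)
    rw [rename_X] at this
    exact this.symm

theorem mapDomain_boxCast (γ : Box m → ℕ) :
    Finsupp.mapDomain (boxCast m) (mexp γ) = mexp (extPt γ) := by
  ext ⟨k, j⟩
  refine Fin.lastCases ?_ (fun j => ?_) j
  · rw [Finsupp.mapDomain_of_notMem_range]
    · simp
    · rintro ⟨⟨k', j'⟩, h⟩
      obtain ⟨rfl, h2⟩ := Sigma.mk.inj_iff.1 h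
      exact (Fin.castSucc_lt_last j').ne (eq_of_heq h2)
  · have := Finsupp.mapDomain_apply (boxCast_injective (m := m)) (mexp γ) ⟨k, j⟩
    rw [boxCast] at this
    rw [this]
    simp

theorem coeff_dropLast (γ : Box m → ℕ) (f : PolyF (fun k => m k + 1)) :
    coeff (mexp γ) (dropLast m f) = coeff (mexp (extPt γ)) f := by
  classical
  rw [← mapDomain_boxCast, dropLast_eq_killCompl]
  induction f using MvPolynomial.monomial_add_induction_on with
  | C a =>
    rw [killCompl_C, coeff_C, coeff_C]
    congr 1
    rw [eq_iff_iff, eq_comm, @eq_comm _ 0]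
    constructor
    · intro h
      rw [h, Finsupp.mapDomain_zero]
    · intro h
      exact Finsupp.mapDomain_injective boxCast_injective (h.trans Finsupp.mapDomain_zero.symm)
  | monomial_add d a f _ _ hf =>
    rw [map_add, coeff_add, coeff_add, hf]
    congr 1
    clear hf
    by_cases h : ↑d.support ⊆ Set.range (boxCast m)
    · rw [killCompl_monomial_eq_monomial_comapDomain_of_subset _ _ h, coeff_monomial,
        coeff_monomial]
      congr 1
      rw [eq_iff_iff]
      constructor
      · intro h'; rw [← h', Finsupp.mapDomain_comapDomain _ boxCast_injective _ h]
      · intro h'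
        rw [h', Finsupp.comapDomain_mapDomain _ boxCast_injective]
    · rw [killCompl_monomial_eq_zero_of_not_subset _ _ h, coeff_zero, coeff_monomial, if_neg]
      rintro rfl
      refine h fun b hb => ?_
      obtain ⟨c, -, hc⟩ := Finset.mem_image.1 (Finsupp.mapDomain_support hb)
      exact ⟨c, hc⟩

theorem rowType_extPt (γ : Box m → ℕ) : rowType (extPt γ) = rowType γ := by
  funext k
  unfold rowType
  rw [Fin.univ_castSuccEmb]
  simp only [Finset.cons_val, Multiset.map_cons, extPt_last, Finset.map_val, Multiset.map_map,
    Function.comp_apply, Fin.coe_castSuccEmb, extPt_castSucc]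
  rw [Multiset.filter_cons_of_neg _ (by simp)]

theorem dropLast_monoPoly (α : EPartition e n) :
    dropLast m (monoPoly (fun k => m k + 1) α) = monoPoly m α := by
  classical
  refine PolyF.ext fun γ => ?_
  rw [coeff_dropLast, coeff_monoPoly, coeff_monoPoly, rowType_extPt]

theorem monoSym_mem (α : EPartition e n) : monoSym m α ∈ Xi m n := fun l =>
  ⟨monoPoly_isHomogeneous α, isRowSymm_monoPoly α, dropLast_monoPoly (m := shiftBy m l) α⟩

theorem eq_zero_of_dropLast_eq_zero (hm : ∀ k, n ≤ m k) {f : PolyF (fun k => m k + 1)}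
    (hf : IsRowSymm f) (hf' : f.IsHomogeneous n) (h : dropLast m f = 0) : f = 0 := by
  refine ext_of_coeff_partsMatrix (n := n) (fun k => (hm k).trans (Nat.le_succ _)) hf
    (fun w => map_zero _) hf' (isHomogeneous_zero _ _ _) fun α => ?_
  have h1 : rowType (partsMatrix (fun k => m k + 1) α) = rowType (extPt (partsMatrix m α)) := by
    rw [rowType_extPt, (fits_of_le hm α).rowType_partsMatrix, Fits.rowType_partsMatrix]
    exact fits_of_le (fun k => (hm k).trans (Nat.le_succ _)) α
  rw [hf.coeff_eq h1, ← coeff_dropLast, h]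
  simp

/-- A symmetric function of degree `n` is determined by its component in the variables
`x_{m + (n, …, n)}`. -/
theorem Xi_eq_zero {f : PolySeq m} (hf : f ∈ Xi m n) (h : f n = 0) : f = 0 := by
  -- From stage `n` on each row has at least `n` variables and restriction is injective in degree
  -- `n`; the earlier stages are restrictions of stage `n`.
  have hup : ∀ d, f (n + d) = 0 := by
    intro d
    induction d with
    | zero => exact h
    | succ d ih =>
      refine eq_zero_of_dropLast_eq_zero (m := shiftBy m (n + d)) (n := n)
        (fun k => by simp only [shiftBy]; omega)
        (hf (n + d + 1)).2.1 (hf (n + d + 1)).1 ?_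
      exact ((hf (n + d)).2.2).trans ih
  have hdown : ∀ d l, l + d = n → f l = 0 := by
    intro d
    induction d with
    | zero => rintro l rfl; exact h
    | succ d ih =>
      intro l hl
      rw [← (hf l).2.2, ih (l + 1) (by omega), map_zero]
  funext l
  rcases le_total l n with hl | hl
  · exact hdown (n - l) l (by omega)
  · obtain ⟨d, rfl⟩ := Nat.exists_eq_add_of_le hl
    exact hup d

theorem Xi_ext {f g : PolySeq m} (hf : f ∈ Xi m n) (hg : g ∈ Xi m n) (h : f n = g n) : f = g :=
  sub_eq_zero.1 (Xi_eq_zero ((Xi m n).sub_mem hf hg) (by simp [h]))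

theorem Xi_eq_sum {f : PolySeq m} (hf : f ∈ Xi m n) :
    f = ∑ α : EPartition e n, coeff (mexp (partsMatrix (shiftBy m n) α)) (f n) • monoSym m α := by
  refine Xi_ext hf (Submodule.sum_mem _ fun α _ => Submodule.smul_mem _ _ (monoSym_mem α)) ?_
  rw [Finset.sum_apply]
  exact eq_sum_monoPoly (fun k => Nat.le_add_left _ _) (hf n).2.1 (hf n).1

theorem schurPoly_isHomogeneous (α : EPartition e n) : (schurPoly m α).IsHomogeneous n := by
  by_cases h : Fits m α
  · refine MvPolynomial.IsHomogeneous.of_mul_left (alternant_isHomogeneous (delta m))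
      alternant_delta_ne_zero ?_
    rw [alternant_mul_schurPoly h]
    have h1 := alternant_isHomogeneous (partsMatrix m α + delta m)
    simp only [Pi.add_apply, Finset.sum_add_distrib] at h1
    rwa [← sum_rowType (partsMatrix m α), h.rowType_partsMatrix, α.sum_parts, add_comm n] at h1
  · rw [schurPoly, if_neg h]
    exact isHomogeneous_zero _ _ _

theorem schurSym_mem (α : EPartition e n) : schurSym m α ∈ Xi m n := fun l =>
  ⟨schurPoly_isHomogeneous α, isRowSymm_schurPoly α, dropLast_schurPoly (m := shiftBy m l) α⟩

end Limit

/-! ### Sums of largest entries and the dominance order -/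

section TopSums

variable {ι : Type*} [Fintype ι]

theorem exists_antitone_equiv (S : ι → ℕ) :
    ∃ σ : Fin (Fintype.card ι) ≃ ι, Antitone (S ∘ σ) := by
  let f : Fin (Fintype.card ι) → ℕᵒᵈ := fun j => OrderDual.toDual (S ((Fintype.equivFin ι).symm j))
  refine ⟨(Tuple.sort f).trans (Fintype.equivFin ι).symm, fun i j hij => ?_⟩
  have := Tuple.monotone_sort f hij
  exact this

theorem topSum_eq_sum {S : ι → ℕ} {σ : Fin (Fintype.card ι) ≃ ι} (hσ : Antitone (S ∘ σ)) (k : ℕ) :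
    topSum (Finset.univ.val.map S) k = ∑ j with (j : Fin (Fintype.card ι)).val < k, S (σ j) := by
  have h : (Finset.univ.val.map S).sort (· ≥ ·) = List.ofFn (S ∘ σ) := by
    refine List.Perm.eq_of_sortedGE (Multiset.pairwise_sort _ _).sortedGE hσ.sortedGE_ofFn ?_
    rw [← Multiset.coe_eq_coe, Multiset.sort_eq, ← Fin.univ_val_map, ← Multiset.map_map]
    congr 1
    exact (Multiset.map_univ_val_equiv σ).symm
  rw [topSum, h, List.sum_take_ofFn]
  rfl

theorem Antitone.sum_le_sum_filter_lt {N : ℕ} {f : Fin N → ℕ} (hf : Antitone f)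
    (A : Finset (Fin N)) : ∑ j ∈ A, f j ≤ ∑ j with j.val < A.card, f j := by
  induction A using Finset.induction_on_max with
  | empty => simp
  | insert a s hs ih =>
    have ha : a ∉ s := fun h => lt_irrefl _ (hs a h)
    have hcard : s.card ≤ a.val := by
      have : s ⊆ Finset.Iio a := fun x hx => Finset.mem_Iio.2 (hs x hx)
      simpa using Finset.card_le_card this
    have hc : s.card < N := hcard.trans_lt a.2
    have hfil : (Finset.univ.filter fun j : Fin N => j.val < s.card + 1)
        = insert ⟨s.card, hc⟩ (Finset.univ.filter fun j : Fin N => j.val < s.card) := by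
      ext j
      simp only [Finset.mem_filter, Finset.mem_univ, true_and, Finset.mem_insert, Fin.ext_iff]
      omega
    rw [Finset.sum_insert ha, Finset.card_insert_of_notMem ha, hfil, Finset.sum_insert (by simp)]
    exact add_le_add (hf (Fin.mk_le_of_le_val hcard)) ih

/-- Together with `exists_topSum_eq` this describes `topSum` as a maximum over subsets, which makes
dominance checkable without sorting. -/
theorem sum_le_topSum (S : ι → ℕ) (A : Finset ι) {k : ℕ} (hk : A.card ≤ k) :
    ∑ b ∈ A, S b ≤ topSum (Finset.univ.val.map S) k := by
  obtain ⟨σ, hσ⟩ := exists_antitone_equiv S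
  rw [topSum_eq_sum hσ]
  have h := hσ.sum_le_sum_filter_lt (A.map σ.symm.toEmbedding)
  rw [Finset.sum_map, Finset.card_map] at h
  simp only [Function.comp_apply, Equiv.coe_toEmbedding, Equiv.apply_symm_apply] at h
  refine h.trans (Finset.sum_le_sum_of_subset fun j => ?_)
  simp only [Finset.mem_filter, Finset.mem_univ, true_and]
  omega

theorem exists_topSum_eq (S : ι → ℕ) (k : ℕ) :
    ∃ A : Finset ι, A.card ≤ k ∧ topSum (Finset.univ.val.map S) k = ∑ b ∈ A, S b := by
  obtain ⟨σ, hσ⟩ := exists_antitone_equiv S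
  refine ⟨(Finset.univ.filter fun j : Fin (Fintype.card ι) => j.val < k).map σ.toEmbedding, ?_, ?_⟩
  · rw [Finset.card_map, Fin.card_filter_val_lt]
    exact min_le_right _ _
  · rw [topSum_eq_sum hσ, Finset.sum_map]
    rfl

theorem eq_of_topSum_eq {s t : Multiset ℕ} (hc : s.card = t.card)
    (h : ∀ k, topSum s k = topSum t k) : s = t := by
  have : s.sort (· ≥ ·) = t.sort (· ≥ ·) := by
    refine List.ext_getElem (by simp [hc]) fun i h1 h2 => ?_
    have e1 := h (i + 1)
    unfold topSum at e1
    rw [List.sum_take_succ _ _ h1, List.sum_take_succ _ _ h2] at e1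
    have e2 := h i
    unfold topSum at e2
    omega
  rw [← Multiset.sort_eq s (· ≥ ·), this, Multiset.sort_eq]

/-- The sum over pairs of minima, in terms of the sums of the largest entries. -/
theorem sum_min_add_sum_topSum (S : ι → ℕ) [DecidablePred (Sym2.IsDiag : Sym2 ι → Prop)] :
    (∑ z : Sym2 ι with ¬ z.IsDiag, (z.map S).inf) +
      ∑ k : Fin (Fintype.card ι), topSum (Finset.univ.val.map S) (k + 1)
      = Fintype.card ι * ∑ b, S b := by
  classical
  obtain ⟨σ, hσ⟩ := exists_antitone_equiv S
  have h1 : (∑ z : Sym2 ι with ¬ z.IsDiag, (z.map S).inf)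
      = ∑ z : Sym2 (Fin (Fintype.card ι)) with ¬ z.IsDiag, (z.map (S ∘ σ)).inf := by
    symm
    refine Finset.sum_bij' (fun z _ => z.map σ) (fun z _ => z.map σ.symm) ?_ ?_ ?_ ?_ ?_
    · intro z hz
      simpa [Sym2.isDiag_map σ.injective] using hz
    · intro z hz
      simpa [Sym2.isDiag_map σ.symm.injective] using hz
    · intro z _
      simp [Sym2.map_map]
    · intro z _
      simp [Sym2.map_map]
    · intro z _
      rw [Sym2.map_map]
  have h2 : (∑ z : Sym2 (Fin (Fintype.card ι)) with ¬ z.IsDiag, (z.map (S ∘ σ)).inf)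
      = ∑ k, ∑ j with k < j, S (σ j) := by
    have := Finset.sum_sym2_filter_not_isDiag (Finset.univ : Finset (Fin (Fintype.card ι)))
      (fun z => (z.map (S ∘ σ)).inf)
    rw [Finset.sym2_univ] at this
    rw [this, ← Finset.sum_finset_product' (Finset.univ.offDiag.filter fun i => i.1 < i.2)]
    · refine Finset.sum_congr rfl fun p hp => ?_
      have hp' := (Finset.mem_filter.1 hp).2
      simp only [Sym2.map_mk, Sym2.inf_mk]
      exact inf_eq_right.2 (hσ hp'.le)
    · rintro ⟨i, j⟩
      simp only [Finset.mem_filter, Finset.mem_offDiag, Finset.mem_univ, true_and, and_iff_right_iff_imp]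
      exact fun h => h.ne
  rw [h1, h2, ← Finset.sum_add_distrib]
  -- In decreasing order the minimum over a pair is its later entry. For each position `k`, the
  -- entries after `k` and the `k + 1` largest entries make up the whole sum.
  have h3 : ∀ k : Fin (Fintype.card ι), (∑ j with k < j, S (σ j))
      + topSum (Finset.univ.val.map S) (k + 1) = ∑ b, S b := by
    intro k
    rw [topSum_eq_sum hσ, ← Equiv.sum_comp σ S,
      ← Finset.sum_filter_add_sum_filter_not Finset.univ (fun j => k < j)]
    congr 2
    ext j
    simp only [Finset.mem_filter, Finset.mem_univ, true_and, Fin.lt_def]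
    omega
  rw [Finset.sum_congr rfl fun k _ => h3 k]
  simp

end TopSums

/-! ### Dominance of symbols and the `a`-function -/

section Symbols

variable {e n : ℕ} {m : Fin e → ℕ}

/-- Weak dominance of the entries of the symbols. -/
def FamilyLE (m : Fin e → ℕ) (α β : EPartition e n) : Prop :=
  ∀ k, topSum (symbolEntries m α) k ≤ topSum (symbolEntries m β) k

theorem SimilarSymbols.symm' {α β : EPartition e n} (h : SimilarSymbols m α β) :
    SimilarSymbols m β α := Eq.symm h

theorem SimilarSymbols.trans' {α β γ : EPartition e n} (h : SimilarSymbols m α β)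
    (h' : SimilarSymbols m β γ) : SimilarSymbols m α γ := Eq.trans h h'

theorem similarSymbols_refl (α : EPartition e n) : SimilarSymbols m α α := Eq.refl _

theorem SimilarSymbols.le {α β : EPartition e n} (h : SimilarSymbols m α β) : FamilyLE m α β :=
  fun k => by rw [show symbolEntries m α = symbolEntries m β from h]

theorem FamilyLT.le {α β : EPartition e n} (h : FamilyLT m α β) : FamilyLE m α β := h.2

theorem FamilyLE.trans {α β γ : EPartition e n} (h : FamilyLE m α β) (h' : FamilyLE m β γ) :
    FamilyLE m α γ := fun k => (h k).trans (h' k)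

theorem FamilyLE.antisymm {α β : EPartition e n} (h : FamilyLE m α β) (h' : FamilyLE m β α) :
    SimilarSymbols m α β :=
  eq_of_topSum_eq (by simp [symbolEntries]) fun k => le_antisymm (h k) (h' k)

theorem FamilyLT.trans_le {α β γ : EPartition e n} (h : FamilyLT m α β) (h' : FamilyLE m β γ) :
    FamilyLT m α γ :=
  ⟨fun hs => h.1 (h.le.antisymm (h'.trans hs.symm'.le)), h.le.trans h'⟩

theorem FamilyLE.sim_or_lt {α β : EPartition e n} (h : FamilyLE m α β) :
    SimilarSymbols m α β ∨ FamilyLT m α β :=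
  or_iff_not_imp_left.2 fun h' => ⟨h', h⟩

theorem sum_partsMatrix (hm : Fits m (α : EPartition e n)) : ∑ b, partsMatrix m α b = n := by
  rw [← sum_rowType, hm.rowType_partsMatrix, α.sum_parts]

theorem fits_shift (m : Fin e → ℕ) (α : EPartition e n) : Fits (shiftBy m n) α :=
  fits_of_le (fun _ => Nat.le_add_left _ _) α

theorem sum_symbol (α : EPartition e n) :
    ∑ b, symbol m α b = n + ∑ b, delta (shiftBy m n) b := by
  simp only [symbol, Pi.add_apply, Finset.sum_add_distrib]
  rw [sum_partsMatrix (fits_shift m α)]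

/-- By `sum_min_add_sum_topSum`, `a` is a constant minus the sum of all `topSum`s, because all
symbols have the same size and total. Strict dominance makes at least one of these larger. -/
theorem FamilyLT.aFun_lt {α β : EPartition e n} (h : FamilyLT m β α) : aFun m α < aFun m β := by
  classical
  have h1 := sum_min_add_sum_topSum (symbol m α)
  have h2 := sum_min_add_sum_topSum (symbol m β)
  rw [sum_symbol] at h1 h2
  have hlt : ∃ k : Fin (Fintype.card (Box (shiftBy m n))),
      topSum (symbolEntries m β) (k + 1) < topSum (symbolEntries m α) (k + 1) := by
    by_contra! hcon
    have hcon' : FamilyLE m α β := by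
      intro k
      rcases k with _ | k
      · simp [topSum]
      · by_cases hk : k < Fintype.card (Box (shiftBy m n))
        · exact hcon ⟨k, hk⟩
        -- Beyond the number of entries `topSum` is the total, which is the same for all
        -- `e`-partitions of `n`.
        · have : ∀ γ : EPartition e n, topSum (symbolEntries m γ) (k + 1)
              = n + ∑ b, delta (shiftBy m n) b := by
            intro γ
            rw [← sum_symbol (m := m) γ, topSum, List.take_of_length_le]
            · rw [← Multiset.sum_coe, Multiset.sort_eq]
              rfl
            · rw [Multiset.length_sort, symbolEntries, Multiset.card_map, Finset.card_val,
                Finset.card_univ]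
              omega
          rw [this, this]
    exact h.1 (h.le.antisymm hcon')
  have h3 : ∑ k : Fin (Fintype.card (Box (shiftBy m n))), topSum (symbolEntries m β) (k + 1)
      < ∑ k : Fin (Fintype.card (Box (shiftBy m n))), topSum (symbolEntries m α) (k + 1) :=
    Finset.sum_lt_sum (fun k _ => h.le _) (by simpa using hlt)
  unfold symbolEntries at h3
  unfold aFun pairMinSum
  have h4 : (∑ z : Sym2 (Box (shiftBy m n)) with ¬ z.IsDiag, (z.map (symbol m α)).inf)
      < ∑ z : Sym2 (Box (shiftBy m n)) with ¬ z.IsDiag, (z.map (symbol m β)).inf := by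
    omega
  have h5 : ((∑ z : Sym2 (Box (shiftBy m n)) with ¬ z.IsDiag, (z.map (symbol m α)).inf : ℕ) : ℤ)
      < (∑ z : Sym2 (Box (shiftBy m n)) with ¬ z.IsDiag, (z.map (symbol m β)).inf : ℕ) := by
    exact_mod_cast h4
  convert sub_lt_sub_right h5 _

/-- Strict dominance forces strictly different `a`-values, so every admissible order refines `<`. -/
theorem AdmissibleOrder.of_lt {r : EPartition e n → EPartition e n → Prop}
    (hr : AdmissibleOrder m r) {α β : EPartition e n} (h : FamilyLT m β α) : r β α := by
  have := hr.total
  rcases trichotomous_of r β α with h1 | h1 | h1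
  · exact h1
  · subst h1
    exact absurd (similarSymbols_refl _) h.1
  · exact absurd (hr.a_le _ _ h1) (not_le.2 h.aFun_lt)

theorem delta_antitone (k : Fin e) : Antitone fun j : Fin (m k) => delta m ⟨k, j⟩ := by
  intro i j hij
  simp only [delta]
  have : (i : ℕ) ≤ j := hij
  omega

theorem delta_strictAnti (k : Fin e) : StrictAnti fun j : Fin (m k) => delta m ⟨k, j⟩ := by
  intro i j hij
  simp only [delta]
  have : (i : ℕ) < j := hij
  omega

theorem partsMatrix_antitone (α : EPartition e n) (k : Fin e) :
    Antitone fun j : Fin (m k) => partsMatrix m α ⟨k, j⟩ :=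
  fun i j hij => (α.1 k).rowLen_anti i j hij

/-- The entries of `w(α) + δ` are dominated by those of `α + δ`. -/
theorem topSum_act_add_delta_le (α : EPartition e n) (w : RowPerm m) (k : ℕ) :
    topSum (Finset.univ.val.map (w.act (partsMatrix m α) + delta m)) k
      ≤ topSum (Finset.univ.val.map (partsMatrix m α + delta m)) k := by
  classical
  obtain ⟨A, hA, hA'⟩ := exists_topSum_eq (w.act (partsMatrix m α) + delta m) k
  rw [hA']
  let R : ∀ r : Fin e, Finset (Fin (m r)) := fun r => Finset.univ.filter fun j => (⟨r, j⟩ : Box m) ∈ A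
  have hAR : A = Finset.univ.sigma R := by
    ext ⟨r, j⟩
    simp [R]
  -- In each row `B` takes as many positions as `A`, but the first ones. Both `α` and `δ` decrease
  -- along rows, so neither summand gets smaller.
  let B : Finset (Box m) := Finset.univ.sigma fun r => Finset.univ.filter fun j => j.val < (R r).card
  have hB : B.card ≤ k := by
    refine le_trans ?_ hA
    rw [hAR, Finset.card_sigma, Finset.card_sigma]
    refine Finset.sum_le_sum fun r _ => ?_
    rw [Fin.card_filter_val_lt]
    exact min_le_right _ _
  refine le_trans ?_ (sum_le_topSum _ B hB)
  rw [hAR, Finset.sum_sigma, Finset.sum_sigma]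
  refine Finset.sum_le_sum fun r _ => ?_
  simp only [Pi.add_apply, Finset.sum_add_distrib]
  refine add_le_add ?_ ((delta_antitone r).sum_le_sum_filter_lt (R r))
  have := (partsMatrix_antitone α r).sum_le_sum_filter_lt ((R r).map (w r)⁻¹.toEmbedding)
  rw [Finset.sum_map, Finset.card_map] at this
  exact this

theorem monovary_partsMatrix_delta (α : EPartition e n) (k : Fin e) :
    Monovary (fun j : Fin (m k) => delta m ⟨k, j⟩) (fun j => partsMatrix m α ⟨k, j⟩) := by
  intro i j hij
  refine (delta_antitone k) ?_
  by_contra h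
  exact absurd (partsMatrix_antitone α k (not_le.1 h).le) (not_le.2 hij)

/-- If `w(α) + δ` and `α + δ` have the same entries with multiplicities then `w(α) = α`. -/
theorem act_partsMatrix_eq_of_entries_eq (α : EPartition e n) (w : RowPerm m)
    (h : Finset.univ.val.map (w.act (partsMatrix m α) + delta m)
      = Finset.univ.val.map (partsMatrix m α + delta m)) :
    w.act (partsMatrix m α) = partsMatrix m α := by
  -- Equal multisets have equal sums of squares. The pure squares cancel and leave equality of the
  -- scalar products with `δ`, the equality case of the rearrangement inequality in every row.
  have h1 := congrArg (fun s : Multiset ℕ => (s.map fun a => a ^ 2).sum) h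
  simp only [Multiset.map_map] at h1
  change ∑ b, (w.act (partsMatrix m α) b + delta m b) ^ 2
    = ∑ b, (partsMatrix m α b + delta m b) ^ 2 at h1
  have hsq : ∀ f : ℕ → ℕ, ∑ b, f (w.act (partsMatrix m α) b) = ∑ b, f (partsMatrix m α b) :=
    fun f => Equiv.sum_comp (Equiv.sigmaCongrRight fun k => (w k)⁻¹)
      (fun b => f (partsMatrix m α b))
  have h2 := hsq fun x => x ^ 2
  simp only [add_sq, Finset.sum_add_distrib, h2] at h1
  have h3 : ∑ b, delta m b * w.act (partsMatrix m α) b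
      = ∑ b, delta m b * partsMatrix m α b := by
    have : ∀ γ : Box m → ℕ, ∑ b, 2 * γ b * delta m b = 2 * ∑ b, delta m b * γ b := by
      intro γ
      rw [Finset.mul_sum]
      exact Finset.sum_congr rfl fun b _ => by ring
    rw [this, this] at h1
    omega
  rw [Fintype.sum_sigma, Fintype.sum_sigma] at h3
  have hle : ∀ k ∈ (Finset.univ : Finset (Fin e)),
      ∑ j, delta m ⟨k, j⟩ * w.act (partsMatrix m α) ⟨k, j⟩
      ≤ ∑ j, delta m ⟨k, j⟩ * partsMatrix m α ⟨k, j⟩ := fun k _ =>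
    (monovary_partsMatrix_delta α k).sum_mul_comp_perm_le_sum_mul (σ := (w k)⁻¹)
  have heq := (Finset.sum_eq_sum_iff_of_le hle).1 h3
  have hanti : ∀ k, Antitone fun j : Fin (m k) => w.act (partsMatrix m α) ⟨k, j⟩ := by
    intro k
    have h4 := ((monovary_partsMatrix_delta α k).sum_mul_comp_perm_eq_sum_mul_iff
      (σ := (w k)⁻¹)).1 (heq k (Finset.mem_univ k))
    intro i j hij
    by_contra h5
    -- Since `δ` is strictly decreasing, equality in the rearrangement inequality forces `w(α)` to
    -- be decreasing along each row.
    have h6 := h4 (not_le.1 h5)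
    have h7 := (delta_strictAnti (m := m) k).le_iff_ge.1 h6
    have : i = j := le_antisymm hij h7
    subst this
    exact h5 le_rfl
  funext ⟨k, j⟩
  have h8 : (List.ofFn fun j : Fin (m k) => w.act (partsMatrix m α) ⟨k, j⟩)
      = List.ofFn fun j : Fin (m k) => partsMatrix m α ⟨k, j⟩ := by
    refine List.Perm.eq_of_sortedGE (hanti k).sortedGE_ofFn
      (partsMatrix_antitone α k).sortedGE_ofFn ?_
    exact Equiv.Perm.ofFn_comp_perm (w k)⁻¹ (fun j : Fin (m k) => partsMatrix m α ⟨k, j⟩)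
  exact congrFun (List.ofFn_injective h8) j

end Symbols

/-! ### Expansion of the numerators into alternants -/

section Straightening

variable {e n : ℕ} {m : Fin e → ℕ}

theorem eq_of_antitone_of_rowType_eq {γ γ' : Box m → ℕ}
    (h : ∀ k, Antitone fun j : Fin (m k) => γ ⟨k, j⟩)
    (h' : ∀ k, Antitone fun j : Fin (m k) => γ' ⟨k, j⟩) (ht : rowType γ = rowType γ') : γ = γ' := by
  obtain ⟨w, rfl⟩ := rowType_eq_iff.1 ht
  funext ⟨k, j⟩
  have h8 : (List.ofFn fun j : Fin (m k) => w.act γ' ⟨k, j⟩)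
      = List.ofFn fun j : Fin (m k) => γ' ⟨k, j⟩ :=
    List.Perm.eq_of_sortedGE (h k).sortedGE_ofFn (h' k).sortedGE_ofFn
      (Equiv.Perm.ofFn_comp_perm (w k)⁻¹ (fun j : Fin (m k) => γ' ⟨k, j⟩))
  exact congrFun (List.ofFn_injective h8) j

theorem exists_partsMatrix_eq {γ : Box m → ℕ} (h : ∀ k, Antitone fun j : Fin (m k) => γ ⟨k, j⟩)
    (hn : ∑ b, γ b = n) : ∃ α : EPartition e n, Fits m α ∧ partsMatrix m α = γ := by
  obtain ⟨α, hα⟩ := exists_parts_eq_rowType hn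
  have hf := fits_of_rowType_eq hα.symm
  exact ⟨α, hf, eq_of_antitone_of_rowType_eq (partsMatrix_antitone α) h
    (hf.rowType_partsMatrix.trans hα)⟩

/-- An alternant of the appropriate degree either vanishes or belongs to an `e`-partition. -/
theorem alternant_eq_zero_or (β : Box m → ℕ) (hβ : ∑ b, β b = n + ∑ b, delta m b) :
    alternant β = 0 ∨ ∃ (α : EPartition e n) (w : RowPerm m), Fits m α ∧
      β = w.act (partsMatrix m α + delta m) := by
  by_cases hinj : ∀ k, Function.Injective fun j : Fin (m k) => β ⟨k, j⟩
  swap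
  · simp only [Function.Injective, not_forall] at hinj
    obtain ⟨k, i, j, hij, hne⟩ := hinj
    exact Or.inl (alternant_eq_zero β hne hij)
  right
  have hs : ∀ k, ∃ σ : Equiv.Perm (Fin (m k)), Antitone ((fun j : Fin (m k) => β ⟨k, j⟩) ∘ σ) := by
    intro k
    exact ⟨Tuple.sort (fun j => OrderDual.toDual (β ⟨k, j⟩)), fun i j hij =>
      Tuple.monotone_sort (fun j => OrderDual.toDual (β ⟨k, j⟩)) hij⟩
  choose σ hσ using hs
  have hstrict : ∀ k, StrictAnti ((fun j : Fin (m k) => β ⟨k, j⟩) ∘ σ k) := fun k =>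
    (hσ k).strictAnti_of_injective ((hinj k).comp (σ k).injective)
  -- A strictly decreasing sequence of natural numbers lies above `δ`; its difference to `δ` is
  -- weakly decreasing and hence comes from a partition.
  have hge : ∀ k (j : Fin (m k)), delta m ⟨k, j⟩ ≤ β ⟨k, σ k j⟩ := by
    intro k j
    have h1 := (hstrict k).strictAntiOn (Set.univ)
    have : ∀ d (j : Fin (m k)), j.val + d = m k - 1 → d ≤ β ⟨k, σ k j⟩ := by
      intro d
      induction d with
      | zero => exact fun _ _ => Nat.zero_le _
      | succ d ih =>
        intro j hj
        have hj' : j.val + 1 < m k := by omega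
        have h2 := ih ⟨j.val + 1, hj'⟩ (by simp only; omega)
        have h3 : β ⟨k, σ k ⟨j.val + 1, hj'⟩⟩ < β ⟨k, σ k j⟩ :=
          hstrict k (Fin.lt_def.2 (Nat.lt_succ_self _))
        omega
    exact this _ j (by simp only [delta]; omega)
  have hanti : ∀ k, Antitone fun j : Fin (m k) => β ⟨k, σ k j⟩ - delta m ⟨k, j⟩ := by
    intro k
    have hstep : ∀ d (i j : Fin (m k)), i.val + d = j.val →
        β ⟨k, σ k j⟩ + d ≤ β ⟨k, σ k i⟩ := by
      intro d
      induction d with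
      | zero =>
        intro i j hij
        have : i = j := Fin.ext (by omega)
        rw [this, add_zero]
      | succ d ih =>
        intro i j hij
        have hi' : i.val + 1 < m k := by omega
        have h2 := ih ⟨i.val + 1, hi'⟩ j (by simp only; omega)
        have h3 : β ⟨k, σ k ⟨i.val + 1, hi'⟩⟩ < β ⟨k, σ k i⟩ :=
          hstrict k (Fin.lt_def.2 (Nat.lt_succ_self _))
        omega
    intro i j hij
    have h4 := hstep (j.val - i.val) i j (by have : i.val ≤ j.val := hij; omega)
    have h5 : i.val ≤ j.val := hij
    simp only [delta]
    omega
  have hsum : ∑ b : Box m, (β ⟨b.1, σ b.1 b.2⟩ - delta m b) = n := by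
    have h1 : ∑ b : Box m, (β ⟨b.1, σ b.1 b.2⟩ - delta m b) + ∑ b, delta m b = ∑ b, β b := by
      rw [← Finset.sum_add_distrib, ← Equiv.sum_comp (Equiv.sigmaCongrRight σ) β]
      exact Finset.sum_congr rfl fun b _ => Nat.sub_add_cancel (hge b.1 b.2)
    omega
  obtain ⟨α, hf, hα⟩ := exists_partsMatrix_eq hanti hsum
  refine ⟨α, σ, hf, ?_⟩
  rw [hα]
  funext ⟨k, j⟩
  have := hge k ((σ k)⁻¹ j)
  have hj : σ k ((σ k)⁻¹ j) = j := (σ k).apply_symm_apply j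
  rw [hj] at this
  simp only [RowPerm.act, Pi.add_apply]
  rw [hj]
  omega

theorem map_univ_act (w : RowPerm m) (β : Box m → ℕ) :
    Finset.univ.val.map (w.act β) = Finset.univ.val.map β := by
  have : w.act β = β ∘ (Equiv.sigmaCongrRight fun k => (w k)⁻¹ : Box m ≃ Box m) := rfl
  rw [this, ← Multiset.map_map]
  congr 1
  exact Multiset.map_univ_val_equiv _

theorem rename_xpow (w : RowPerm m) (β : Box m → ℕ) :
    rename (Equiv.sigmaCongrRight w) (xpow β : PolyF m) = xpow (w.act β) := by
  rw [xpow_eq_monomial, rename_monomial, mexp_mapDomain_perm, xpow_eq_monomial]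

theorem alternant_eq_sum_rename (β : Box m → ℕ) :
    alternant β = ∑ w : RowPerm m, (w.sgn : PolyF m) * rename (Equiv.sigmaCongrRight w) (xpow β) := by
  unfold alternant
  refine Finset.sum_congr rfl fun w _ => ?_
  rw [zsmul_eq_mul, rename_xpow]

theorem xpow_add (β γ : Box m → ℕ) : (xpow (β + γ) : PolyF m) = xpow β * xpow γ := by
  simp [xpow, pow_add, Finset.prod_mul_distrib]

/-- The `S_m`-orbit of the matrix of an `e`-partition. -/
def orbit (m : Fin e → ℕ) (α : EPartition e n) : Finset (Box m → ℕ) :=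
  Finset.univ.image fun w : RowPerm m => w.act (partsMatrix m α)

theorem monoPoly_eq_sum_orbit {α : EPartition e n} (h : Fits m α) :
    monoPoly m α = ∑ γ ∈ orbit m α, xpow γ := by
  unfold monoPoly orbit
  rw [if_pos h]

/-- As `m_α` is symmetric, the product is the antisymmetrization of `x^δ m_α`, to be expanded term
by term. -/
theorem alternant_mul_monoPoly {α : EPartition e n} (h : Fits m α) :
    alternant (delta m) * monoPoly m α = ∑ γ ∈ orbit m α, alternant (γ + delta m) := by
  simp only [alternant_eq_sum_rename]
  rw [Finset.sum_comm, Finset.sum_mul]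
  refine Finset.sum_congr rfl fun w _ => ?_
  rw [← Finset.mul_sum, mul_assoc]
  congr 1
  rw [← map_sum]
  conv_lhs => rw [← isRowSymm_monoPoly α w]
  rw [← map_mul, monoPoly_eq_sum_orbit h, Finset.mul_sum]
  congr 1
  refine Finset.sum_congr rfl fun γ _ => ?_
  rw [add_comm, xpow_add]

/-- Moving the selected entry of each row along `g`. -/
def cycFun {e : ℕ} {m : Fin e → ℕ} (g : Fin e → Fin e) (i : ColIdx m) (b : Box m) : Box m :=
  if b.2 = i b.1 then ⟨g b.1, i (g b.1)⟩ else b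

theorem cycFun_cycFun {g g' : Fin e → Fin e} (h : ∀ k, g' (g k) = k) (i : ColIdx m) (b : Box m) :
    cycFun g' i (cycFun g i b) = b := by
  obtain ⟨k, j⟩ := b
  by_cases hj : j = i k
  · have : cycFun g i ⟨k, j⟩ = ⟨g k, i (g k)⟩ := if_pos hj
    rw [this, cycFun, if_pos rfl]
    simp only
    rw [h, hj]
  · have : ∀ g, cycFun g i ⟨k, j⟩ = ⟨k, j⟩ := fun g => if_neg hj
    rw [this, this]

/-- The permutation of the box underlying `cycMat`. -/
def cycPerm [NeZero e] (ε : Bool) (i : ColIdx m) : Equiv.Perm (Box m) where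
  toFun := cycFun (nextRow ε) i
  invFun := cycFun (prevRow ε) i
  left_inv := cycFun_cycFun (prevRow_nextRow ε) i
  right_inv := cycFun_cycFun (nextRow_prevRow ε) i

theorem cycMat_eq_comp [NeZero e] (ε : Bool) (i : ColIdx m) (β : Box m → ℕ) :
    cycMat ε i β = β ∘ cycPerm ε i := by
  funext b
  simp only [cycMat, cycPerm, cycFun, Function.comp_apply, Equiv.coe_fn_mk]
  split_ifs <;> rfl

/-- Entries move between rows but not out of the matrix. The multiset of all entries is preserved,
the contents of single rows are not; this is why blocks belong to families. -/
theorem map_univ_cycMat [NeZero e] (ε : Bool) (i : ColIdx m) (β : Box m → ℕ) :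
    Finset.univ.val.map (cycMat ε i β) = Finset.univ.val.map β := by
  rw [cycMat_eq_comp, ← Multiset.map_map]
  congr 1
  exact Multiset.map_univ_val_equiv _

/-- For symmetric `f`, the conjugation rule for `T_{u,i}` and reindexing of `i` reduce the alternant
in the numerator to its leading monomial `x^δ`, antisymmetrized at the end. -/
theorem opNum_eq_sum_rename [NeZero e] (ε : Bool) {f : PolyF m} (hf : IsRowSymm f) :
    opNum ε f = ∑ w : RowPerm m, (w.sgn : PolyF m) * rename (Equiv.sigmaCongrRight w)
      (∑ i : ColIdx m, opT ε tF i (xpow (delta m)) * opT ε qF i f) := by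
  unfold opNum
  simp only [map_sum, map_mul, rename_opT, rename_xpow, hf _]
  have h : ∀ w : RowPerm m, ∑ i : ColIdx m, opT ε tF (w.actIdx i) (xpow (w.act (delta m))) *
      opT ε qF (w.actIdx i) f = ∑ i : ColIdx m, opT ε tF i (xpow (w.act (delta m))) *
      opT ε qF i f := fun w => Equiv.sum_comp w.actIdx
        (fun i => opT ε tF i (xpow (w.act (delta m))) * opT ε qF i f)
  simp only [h, alternant_eq_sum_rename, map_sum, map_mul, map_intCast, rename_xpow,
    Finset.sum_mul, Finset.mul_sum]
  rw [Finset.sum_comm]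
  simp only [mul_assoc]

theorem opNum_monoPoly [NeZero e] (ε : Bool) {α : EPartition e n} (h : Fits m α) :
    opNum ε (monoPoly m α) = ∑ i : ColIdx m, ∑ γ ∈ orbit m α,
      (tF ^ pairing (delta m) i * qF ^ pairing γ i) • alternant (cycMat ε i (γ + delta m)) := by
  rw [opNum_eq_sum_rename ε (isRowSymm_monoPoly α)]
  have h1 : (∑ i : ColIdx m, opT ε tF i (xpow (delta m)) * opT ε qF i (monoPoly m α))
      = ∑ i : ColIdx m, ∑ γ ∈ orbit m α, C (tF ^ pairing (delta m) i * qF ^ pairing γ i) *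
        xpow (cycMat ε i (γ + delta m)) := by
    refine Finset.sum_congr rfl fun i _ => ?_
    rw [monoPoly_eq_sum_orbit h, map_sum, Finset.mul_sum]
    refine Finset.sum_congr rfl fun γ _ => ?_
    have h2 : cycMat ε i (γ + delta m) = cycMat ε i γ + cycMat ε i (delta m) := by
      simp only [cycMat_eq_comp]
      rfl
    rw [opT_xpow, opT_xpow, h2, xpow_add, C_mul]
    ring
  rw [h1]
  simp only [alternant_eq_sum_rename, map_sum, Finset.mul_sum, smul_eq_C_mul]
  rw [Finset.sum_comm]
  refine Finset.sum_congr rfl fun i _ => ?_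
  rw [Finset.sum_comm]
  refine Finset.sum_congr rfl fun γ _ => Finset.sum_congr rfl fun w _ => ?_
  rw [map_mul, rename_C]
  ring

end Straightening

/-! ### Triangularity in terms of Schur polynomials -/

section Triangular

variable {e n : ℕ} {m : Fin e → ℕ}

theorem sgn_mul_mem {V : Submodule Fqt (PolyF m)} (w : RowPerm m) {f : PolyF m} (h : f ∈ V) :
    (w.sgn : PolyF m) * f ∈ V := by
  have : (w.sgn : PolyF m) * f = (w.sgn : Fqt) • f := by
    rw [smul_eq_C_mul, map_intCast]
  rw [this]
  exact V.smul_mem _ h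

/-- The space of multiples of `a_δ` by combinations of Schur polynomials. -/
theorem alternant_mem_span (s : Set (EPartition e n)) (β : Box (shiftBy m n) → ℕ)
    (hβ : ∑ b, β b = n + ∑ b, delta (shiftBy m n) b)
    (h : ∀ α : EPartition e n, symbolEntries m α = Finset.univ.val.map β → α ∈ s) :
    alternant β ∈ Submodule.span Fqt
      ((fun α => alternant (delta (shiftBy m n)) * schurPoly (shiftBy m n) α) '' s) := by
  rcases alternant_eq_zero_or β hβ with h0 | ⟨α, w, hf, rfl⟩
  · rw [h0]; exact Submodule.zero_mem _
  · rw [alternant_act, ← alternant_mul_schurPoly hf]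
    refine sgn_mul_mem w (Submodule.subset_span ⟨α, h α ?_, rfl⟩)
    rw [map_univ_act]
    rfl

/-- Multiplication by `a_δ` is injective and linear, so memberships may be tested on numerators. -/
theorem mem_span_of_alternant_mul_mem (s : Set (EPartition e n)) {f : PolyF m}
    (h : alternant (delta m) * f ∈ Submodule.span Fqt
      ((fun α => alternant (delta m) * schurPoly m α) '' s)) :
    f ∈ Submodule.span Fqt (schurPoly m '' s) := by
  have h1 : (fun α => alternant (delta m) * schurPoly m α) '' s
      = (LinearMap.mulLeft Fqt (alternant (delta m))) '' (schurPoly m '' s) := by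
    rw [Set.image_image]
    rfl
  rw [h1, Submodule.span_image] at h
  obtain ⟨g, hg, hg'⟩ := h
  rw [LinearMap.mulLeft_apply] at hg'
  rwa [← mul_left_cancel₀ alternant_delta_ne_zero hg']

theorem sum_act (w : RowPerm m) (β : Box m → ℕ) : ∑ b, w.act β b = ∑ b, β b :=
  Equiv.sum_comp (Equiv.sigmaCongrRight fun k => (w k)⁻¹) β

theorem sum_add_delta {α : EPartition e n} (h : Fits m α) {γ : Box m → ℕ} (hγ : γ ∈ orbit m α) :
    ∑ b, (γ + delta m) b = n + ∑ b, delta m b := by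
  obtain ⟨w, -, rfl⟩ := Finset.mem_image.1 hγ
  simp only [Pi.add_apply, Finset.sum_add_distrib, sum_act, sum_partsMatrix h]

theorem monoPoly_sub_schurPoly_mem (α : EPartition e n) :
    monoPoly (shiftBy m n) α - schurPoly (shiftBy m n) α ∈ Submodule.span Fqt
      (schurPoly (shiftBy m n) '' {β | FamilyLT m β α}) := by
  classical
  have hf := fits_shift m α
  refine mem_span_of_alternant_mul_mem _ ?_
  rw [mul_sub, alternant_mul_monoPoly hf, alternant_mul_schurPoly hf]
  have hmem : partsMatrix (shiftBy m n) α ∈ orbit (shiftBy m n) α :=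
    Finset.mem_image.2 ⟨1, Finset.mem_univ _, rfl⟩
  -- The orbit element `α` itself contributes `a_{α+δ}`, the numerator of `s_α`. For all others
  -- equality of the entries with those of `α + δ` is excluded.
  rw [← Finset.add_sum_erase _ _ hmem, add_sub_cancel_left]
  refine Submodule.sum_mem _ fun γ hγ => ?_
  obtain ⟨hne, hγ⟩ := Finset.mem_erase.1 hγ
  refine alternant_mem_span _ _ (sum_add_delta hf hγ) fun β hβ => ?_
  obtain ⟨w, -, rfl⟩ := Finset.mem_image.1 hγ
  refine ⟨fun hs => hne (act_partsMatrix_eq_of_entries_eq α w ?_), fun k => ?_⟩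
  · rw [← hβ]; exact hs
  · rw [hβ]; exact topSum_act_add_delta_le α w k

theorem opD_monoPoly_mem [NeZero e] (ε : Bool) (α : EPartition e n) :
    opD (shiftBy m n) ε (monoPoly (shiftBy m n) α) ∈ Submodule.span Fqt
      (schurPoly (shiftBy m n) '' {β | FamilyLE m β α}) := by
  have hf := fits_shift m α
  refine mem_span_of_alternant_mul_mem _ ?_
  rw [alternant_mul_opD ε (isRowSymm_monoPoly α), opNum_monoPoly ε hf]
  refine Submodule.sum_mem _ fun i _ => Submodule.sum_mem _ fun γ hγ => Submodule.smul_mem _ _ ?_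
  refine alternant_mem_span _ _ ?_ fun β hβ k => ?_
  · rw [← sum_add_delta hf hγ, cycMat_eq_comp]
    exact Equiv.sum_comp (cycPerm ε i) _
  · rw [hβ, map_univ_cycMat]
    obtain ⟨w, -, rfl⟩ := Finset.mem_image.1 hγ
    exact topSum_act_add_delta_le α w k

end Triangular

/-! ### The operator `E` on the space with basis `m_α` -/

section Space

variable {e n : ℕ} {m : Fin e → ℕ}

/-- `m_α` as an element of `Ξ^n`. -/
noncomputable def monoXi (m : Fin e → ℕ) (α : EPartition e n) : Xi m n := ⟨monoSym m α, monoSym_mem α⟩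

/-- `s_α` as an element of `Ξ^n`. -/
noncomputable def schurXi (m : Fin e → ℕ) (α : EPartition e n) : Xi m n :=
  ⟨schurSym m α, schurSym_mem α⟩

/-- The component of a symmetric function in the variables `x_{m + (n, …, n)}`. -/
noncomputable def evalXi (m : Fin e → ℕ) (n : ℕ) : Xi m n →ₗ[Fqt] PolyF (shiftBy m n) :=
  (LinearMap.proj n).comp (Xi m n).subtype

theorem evalXi_injective : Function.Injective (evalXi m n) := by
  exact fun f g h => Subtype.ext (Xi_ext f.2 g.2 h)

theorem mem_span_of_evalXi {ι : Type*} (v : ι → Xi m n) (s : Set ι) {f : Xi m n}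
    (h : evalXi m n f ∈ Submodule.span Fqt ((fun i => evalXi m n (v i)) '' s)) :
    f ∈ Submodule.span Fqt (v '' s) := by
  rw [← Set.image_image (evalXi m n), Submodule.span_image] at h
  obtain ⟨g, hg, hg'⟩ := h
  rwa [← evalXi_injective hg']

theorem monoXi_sub_schurXi_mem (α : EPartition e n) :
    monoXi m α - schurXi m α ∈ Submodule.span Fqt (schurXi m '' {β | FamilyLT m β α}) := by
  refine mem_span_of_evalXi _ _ ?_
  exact monoPoly_sub_schurPoly_mem α

/-- The coefficient of `x^α`. -/
noncomputable def monoCoord (α : EPartition e n) : Xi m n →ₗ[Fqt] Fqt :=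
  (MvPolynomial.lcoeff Fqt (mexp (partsMatrix (shiftBy m n) α))).comp (evalXi m n)

theorem monoCoord_monoXi [DecidableEq (EPartition e n)] (α β : EPartition e n) :
    monoCoord α (monoXi m β) = if β = α then 1 else 0 :=
  coeff_monoPoly_partsMatrix (fun _ => Nat.le_add_left _ _) β α

theorem eq_sum_monoCoord (f : Xi m n) : f = ∑ α, monoCoord α f • monoXi m α := by
  refine Subtype.ext ?_
  conv_lhs => rw [Xi_eq_sum f.2]
  simp only [Submodule.coe_sum, Submodule.coe_smul]
  rfl

/-- The coordinates with respect to the basis `(m_α)`. -/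
noncomputable def monoEquiv (m : Fin e → ℕ) (n : ℕ) : Xi m n ≃ₗ[Fqt] (EPartition e n → Fqt) := by
  classical
  exact LinearEquiv.ofLinearMap (LinearMap.pi monoCoord)
    (∑ α, (LinearMap.toSpanSingleton Fqt _ (monoXi m α)).comp (LinearMap.proj α))
    (by
      refine LinearMap.ext fun c => funext fun α => ?_
      simp [monoCoord_monoXi])
    (by
      refine LinearMap.ext fun f => ?_
      conv_rhs => rw [LinearMap.id_apply, eq_sum_monoCoord f]
      simp)

/-- The basis `(m_α)` of `Ξ^n`. -/
noncomputable def monoBasis (m : Fin e → ℕ) (n : ℕ) : Module.Basis (EPartition e n) Fqt (Xi m n) :=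
  Module.Basis.ofEquivFun (monoEquiv m n)

@[simp]
theorem monoBasis_apply (α : EPartition e n) : monoBasis m n α = monoXi m α := by
  classical
  rw [monoBasis, Module.Basis.coe_ofEquivFun, LinearEquiv.symm_apply_eq]
  funext β
  change _ = monoCoord β (monoXi m α)
  rw [monoCoord_monoXi, Pi.single_apply]
  simp only [eq_comm]

theorem familyLT_wf : WellFounded (FamilyLT m : EPartition e n → EPartition e n → Prop) := by
  have h1 : IsTrans _ (FamilyLT m : EPartition e n → EPartition e n → Prop) :=
    ⟨fun _ _ _ h h' => h.trans_le h'.le⟩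
  have h2 : Std.Irrefl (FamilyLT m : EPartition e n → EPartition e n → Prop) :=
    ⟨fun _ h => h.1 rfl⟩
  exact Finite.wellFounded_of_trans_of_irrefl _

/-- A unitriangular change of vectors has a unitriangular inverse; well-founded induction takes the
place of inverting a matrix. -/
theorem sub_mem_span_of_wf {K V ι : Type*} [Field K] [AddCommGroup V] [Module K V]
    {lt : ι → ι → Prop} (hwf : WellFounded lt) (htr : ∀ a b c, lt a b → lt b c → lt a c)
    (u v : ι → V) (h : ∀ a, u a - v a ∈ Submodule.span K (v '' {b | lt b a})) (a : ι) :
    v a - u a ∈ Submodule.span K (u '' {b | lt b a}) := by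
  induction a using hwf.induction with
  | _ a ih =>
    rw [← neg_sub]
    refine Submodule.neg_mem _ (Submodule.span_le.2 ?_ (h a))
    rintro _ ⟨b, hb, rfl⟩
    have h2 : Submodule.span K (u '' {c | lt c b}) ≤ Submodule.span K (u '' {c | lt c a}) :=
      Submodule.span_mono (Set.image_mono fun c hc => htr _ _ _ hc hb)
    have h4 : u b ∈ Submodule.span K (u '' {c | lt c a}) := Submodule.subset_span ⟨b, hb, rfl⟩
    simpa using Submodule.add_mem _ (h2 (ih b hb)) h4

theorem span_schur_le (α : EPartition e n) :
    schurXi m α - monoXi m α ∈ Submodule.span Fqt (monoXi m '' {β | FamilyLT m β α}) :=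
  sub_mem_span_of_wf (K := Fqt) (V := Xi m n) familyLT_wf (fun _ _ _ h h' => h.trans_le h'.le) (monoXi m) (schurXi m)
    monoXi_sub_schurXi_mem α

/-- Used for `E = t^{-M} D - c`: the scalar `c` is moved across, and the bound for `D` in Schur
functions becomes one in monomial functions. -/
theorem mem_span_of_shift {K V ι : Type*} [Field K] [AddCommGroup V] [Module K V]
    {lt le : ι → ι → Prop} (hle : ∀ a, le a a) (htr : ∀ a b c, lt a b → le b c → le a c)
    (u v : ι → V) (h : ∀ a, v a - u a ∈ Submodule.span K (u '' {b | lt b a})) (a : ι) (c : K)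
    {x : V} (hx : x + c • u a ∈ Submodule.span K (v '' {b | le b a})) :
    x ∈ Submodule.span K (u '' {b | le b a}) := by
  have hs : ∀ b, le b a → v b ∈ Submodule.span K (u '' {b | le b a}) := by
    intro b hb
    have h2 : Submodule.span K (u '' {c | lt c b}) ≤ Submodule.span K (u '' {c | le c a}) :=
      Submodule.span_mono (Set.image_mono fun c hc => htr _ _ _ hc hb)
    have h4 : u b ∈ Submodule.span K (u '' {c | le c a}) := Submodule.subset_span ⟨b, hb, rfl⟩
    simpa using Submodule.add_mem _ (h2 (h b)) h4
  have h7 := Submodule.span_le.2 (by rintro _ ⟨b, hb, rfl⟩; exact hs b hb) hx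
  have h8 : u a ∈ Submodule.span K (u '' {b | le b a}) := Submodule.subset_span ⟨a, hle a, rfl⟩
  have := Submodule.sub_mem _ h7 (Submodule.smul_mem _ c h8)
  rwa [add_sub_cancel_right] at this

/-- The operator `E^±` on `Ξ^n`. -/
noncomputable def opXi [NeZero e] (m : Fin e → ℕ) (n : ℕ) (ε : Bool) : Xi m n →ₗ[Fqt] Xi m n where
  toFun f := ⟨opE m ε f.1, opE_mem_Xi ε f.2⟩
  map_add' f g := Subtype.ext (funext fun l => opEm_add ε (f.2 l).2.1 (g.2 l).2.1)
  map_smul' c f := Subtype.ext (funext fun l => opEm_smul ε c (f.2 l).2.1)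

theorem opXi_monoXi [NeZero e] (ε : Bool) (α : EPartition e n) :
    opXi m n ε (monoXi m α) = ∑ β, hCoeff m ε α β • monoXi m β :=
  eq_sum_monoCoord (opXi m n ε (monoXi m α))

theorem opXi_monoXi_mem [NeZero e] (ε : Bool) (α : EPartition e n) :
    opXi m n ε (monoXi m α) ∈ Submodule.span Fqt (monoXi m '' {β | FamilyLE m β α}) := by
  have h5 : opXi m n ε (monoXi m α)
      + normConst (shiftBy m n) ε • monoXi m α ∈
      Submodule.span Fqt (schurXi m '' {β | FamilyLE m β α}) := by
    refine mem_span_of_evalXi _ _ ?_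
    have h6 : evalXi m n (opXi m n ε (monoXi m α) + normConst (shiftBy m n) ε • monoXi m α)
        = tF ^ (-((∑ k, shiftBy m n k : ℕ) : ℤ)) •
          opD (shiftBy m n) ε (monoPoly (shiftBy m n) α) := by
      rw [map_add, map_smul]
      change opEm (shiftBy m n) ε (monoPoly (shiftBy m n) α)
        + normConst (shiftBy m n) ε • monoPoly (shiftBy m n) α = _
      rw [opEm, sub_add_cancel]
    rw [h6]
    exact Submodule.smul_mem _ _ (opD_monoPoly_mem ε α)
  exact mem_span_of_shift (K := Fqt) (V := Xi m n) (lt := FamilyLT m) (le := FamilyLE m) (fun _ _ => le_rfl)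
    (fun _ _ _ h h' => h.le.trans h') (monoXi m) (schurXi m) span_schur_le α _ h5

/-- The matrix of `E^±` is block triangular. -/
theorem familyLE_of_hCoeff_ne_zero [NeZero e] (ε : Bool) {α β : EPartition e n} (h : hCoeff m ε α β ≠ 0) :
    FamilyLE m β α := by
  classical
  by_contra hcon
  apply h
  have h1 : Submodule.span Fqt (monoXi m '' {γ | FamilyLE m γ α}) ≤ LinearMap.ker (monoCoord β) := by
    refine Submodule.span_le.2 ?_
    rintro _ ⟨γ, hγ, rfl⟩
    rw [SetLike.mem_coe, LinearMap.mem_ker, monoCoord_monoXi, if_neg]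
    rintro rfl
    exact hcon hγ
  exact h1 (opXi_monoXi_mem ε α)

end Space

/-! ### Orthogonality of the characters of the cyclic group -/

section Fourier

variable {e : ℕ}

theorem IsPrimitiveRoot.sum_pow_mul_inv {K : Type*} [Field K] {ζ : K} (hζ : IsPrimitiveRoot ζ e) (a b : Fin e) :
    ∑ i : Fin e, ζ ^ ((i : ℕ) * a) * (ζ ^ ((i : ℕ) * b))⁻¹ = if a = b then (e : K) else 0 := by
  have he : e ≠ 0 := fun h => by subst h; exact a.elim0
  have hζ0 : ζ ≠ 0 := hζ.ne_zero he
  split_ifs with h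
  · subst h
    rw [Finset.sum_congr rfl fun i _ => mul_inv_cancel₀ (pow_ne_zero _ hζ0)]
    simp
  · have hne : ζ ^ (a : ℕ) * (ζ ^ (b : ℕ))⁻¹ ≠ 1 := by
      intro h1
      rw [mul_inv_eq_one₀ (pow_ne_zero _ hζ0)] at h1
      exact h (Fin.ext (hζ.pow_inj a.2 b.2 h1))
    have h2 : ∑ i : Fin e, ζ ^ ((i : ℕ) * a) * (ζ ^ ((i : ℕ) * b))⁻¹
        = ∑ i ∈ Finset.range e, (ζ ^ (a : ℕ) * (ζ ^ (b : ℕ))⁻¹) ^ i := by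
      rw [← Fin.sum_univ_eq_sum_range (fun i => (ζ ^ (a : ℕ) * (ζ ^ (b : ℕ))⁻¹) ^ i)]
      refine Finset.sum_congr rfl fun i _ => ?_
      rw [mul_pow, inv_pow, ← pow_mul, ← pow_mul, mul_comm (a : ℕ), mul_comm (b : ℕ)]
    have h3 := mul_geom_sum (ζ ^ (a : ℕ) * (ζ ^ (b : ℕ))⁻¹) e
    rw [mul_pow, inv_pow, ← pow_mul, ← pow_mul, mul_comm (a : ℕ), mul_comm (b : ℕ), pow_mul,
      pow_mul, hζ.pow_eq_one, one_pow, one_pow, inv_one, mul_one, sub_self] at h3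
    rw [h2]
    exact (mul_eq_zero.1 h3).resolve_left (sub_ne_zero.2 hne)

/-- The inclusion of the constants. -/
noncomputable def cHom : ℂ →+* Fqt :=
  (algebraMap (MvPolynomial (Fin 2) ℂ) Fqt).comp C

theorem cF_eq (z : ℂ) : cF z = cHom z := rfl

end Fourier

/-! ### Power sums span the symmetric functions -/

section PowerSums

variable {e n : ℕ} {m : Fin e → ℕ} {ζ : ℂ}

/-- The power sum of the variables of one row. -/
noncomputable def rowPsum (m : Fin e → ℕ) (k : Fin e) (r : ℕ) : PolyF m :=
  ∑ j : Fin (m k), X (⟨k, j⟩ : Box m) ^ r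

theorem twistedPsum_eq (i r : ℕ) :
    twistedPsum ζ m i r = ∑ k : Fin e, C (cF (ζ ^ (i * (k : ℕ)))) * rowPsum m k r := rfl

/-- Fourier inversion over the `e` rows recovers the untwisted power sum of one row. -/
theorem rowPsum_eq_sum (hζ : IsPrimitiveRoot ζ e) (k : Fin e) (r : ℕ) :
    rowPsum m k r = ∑ i : Fin e,
      (cHom ((e : ℂ)⁻¹ * (ζ ^ ((i : ℕ) * k))⁻¹)) • twistedPsum ζ m i r := by
  have he : (e : ℂ) ≠ 0 := by
    have : e ≠ 0 := fun h => by subst h; exact k.elim0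
    exact_mod_cast this
  simp only [twistedPsum_eq, Finset.smul_sum, smul_eq_C_mul, cF_eq]
  rw [Finset.sum_comm]
  have h : ∀ k' : Fin e, ∑ i : Fin e, C (cHom ((e : ℂ)⁻¹ * (ζ ^ ((i : ℕ) * k))⁻¹)) *
      (C (cHom (ζ ^ ((i : ℕ) * (k' : ℕ)))) * rowPsum m k' r)
      = if k' = k then rowPsum m k' r else 0 := by
    intro k'
    have h1 := congrArg (fun z => C (cHom ((e : ℂ)⁻¹ * z)) * rowPsum m k' r)
      (hζ.sum_pow_mul_inv k' k)
    simp only [Finset.mul_sum, map_sum, Finset.sum_mul] at h1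
    refine Eq.trans (Finset.sum_congr rfl fun i _ => ?_) (h1.trans ?_)
    · simp only [map_mul]
      ring
    · split_ifs
      · rw [inv_mul_cancel₀ he, map_one, map_one, one_mul]
      · simp
  rw [Finset.sum_congr rfl fun k' _ => h k']
  simp

/-- Products of twisted power sums. -/
noncomputable def powerProd (ζ : ℂ) (m : Fin e → ℕ) (μ : Fin e → Multiset ℕ) : PolyF m :=
  ∏ k : Fin e, ((μ k).map (twistedPsum ζ m k)).prod

theorem powerPoly_eq (α : EPartition e n) : powerPoly ζ m α = powerProd ζ m α.parts := by
  unfold powerPoly powerProd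
  refine Finset.prod_congr rfl fun k _ => ?_
  rw [EPartition.parts, Multiset.map_coe, Multiset.prod_coe]

theorem powerProd_add (μ ν : Fin e → Multiset ℕ) :
    powerProd ζ m (μ + ν) = powerProd ζ m μ * powerProd ζ m ν := by
  simp [powerProd, Finset.prod_mul_distrib]

theorem powerProd_single (k : Fin e) (r : ℕ) :
    powerProd ζ m (Pi.single k {r}) = twistedPsum ζ m k r := by
  unfold powerProd
  rw [Finset.prod_eq_single k]
  · simp
  · intro b _ hb
    simp [Pi.single_eq_of_ne hb]
  · simp

theorem isRowSymm_rowPsum (k : Fin e) (r : ℕ) : IsRowSymm (rowPsum m k r) := by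
  intro w
  simp only [rowPsum, map_sum, map_pow, rename_X]
  exact Equiv.sum_comp (w k) (fun j => X (⟨k, j⟩ : Box m) ^ r)

theorem IsRowSymm.mul {f g : PolyF m} (hf : IsRowSymm f) (hg : IsRowSymm g) :
    IsRowSymm (f * g) := fun w => by rw [map_mul, hf w, hg w]

theorem isRowSymm_powerProd (μ : Fin e → Multiset ℕ) : IsRowSymm (powerProd ζ m μ) := by
  intro w
  simp only [powerProd, map_prod, map_multiset_prod, Multiset.map_map, Function.comp_def]
  refine Finset.prod_congr rfl fun k _ => ?_
  congr 2
  funext r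
  rw [twistedPsum_eq]
  simp only [map_sum, map_mul, rename_C, isRowSymm_rowPsum _ _ w]

theorem rowPsum_isHomogeneous (k : Fin e) (r : ℕ) : (rowPsum m k r).IsHomogeneous r :=
  IsHomogeneous.sum _ _ _ fun j _ => by
    have := (isHomogeneous_X Fqt (⟨k, j⟩ : Box m)).pow r
    rwa [one_mul] at this

theorem twistedPsum_isHomogeneous (i r : ℕ) : (twistedPsum ζ m i r).IsHomogeneous r :=
  IsHomogeneous.sum _ _ _ fun k _ => (rowPsum_isHomogeneous k r).C_mul _

theorem powerProd_isHomogeneous (μ : Fin e → Multiset ℕ) :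
    (powerProd ζ m μ).IsHomogeneous (∑ k, (μ k).sum) := by
  refine IsHomogeneous.prod _ _ _ fun k _ => ?_
  induction μ k using Multiset.induction with
  | empty => simpa using isHomogeneous_one _ _
  | cons r s ih =>
    rw [Multiset.map_cons, Multiset.prod_cons, Multiset.sum_cons]
    exact (twistedPsum_isHomogeneous _ _).mul ih

/-- Positivity of `r` matters: the zeroth power sum counts variables and is not stable. -/
theorem dropLast_rowPsum (k : Fin e) {r : ℕ} (hr : r ≠ 0) :
    dropLast m (rowPsum (fun k => m k + 1) k r) = rowPsum m k r := by
  unfold rowPsum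
  rw [Fin.sum_univ_castSucc, map_add, map_sum]
  simp [dropLast, hr]

theorem dropLast_powerProd {μ : Fin e → Multiset ℕ} (h : ∀ k, ∀ a ∈ μ k, 0 < a) :
    dropLast m (powerProd ζ (fun k => m k + 1) μ) = powerProd ζ m μ := by
  simp only [powerProd, map_prod, map_multiset_prod, Multiset.map_map, Function.comp_def]
  refine Finset.prod_congr rfl fun k _ => ?_
  congr 1
  refine Multiset.map_congr rfl fun r hr => ?_
  rw [twistedPsum_eq, twistedPsum_eq]
  simp only [map_sum, map_mul, dropLast_rowPsum _ (h k r hr).ne']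
  refine Finset.sum_congr rfl fun k _ => ?_
  rw [← algebraMap_eq, AlgHom.commutes]
  rfl

theorem powerSym_mem (α : EPartition e n) : powerSym ζ m α ∈ Xi m n := by
  intro l
  have h : ∀ l, powerSym ζ m α l = powerProd ζ (shiftBy m l) α.parts := fun l => powerPoly_eq α
  refine ⟨?_, ?_, ?_⟩
  · rw [h]
    have := powerProd_isHomogeneous (ζ := ζ) (m := shiftBy m l) α.parts
    rwa [α.sum_parts] at this
  · rw [h]
    exact isRowSymm_powerProd _
  · rw [h, h]
    exact dropLast_powerProd (m := shiftBy m l) fun k a ha => EPartition.pos_of_mem_parts ha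

/-- The span of the products of power sums of degree `n`. -/
noncomputable def powerSpan (ζ : ℂ) (m : Fin e → ℕ) (n : ℕ) : Submodule Fqt (PolyF m) :=
  Submodule.span Fqt (powerProd ζ m '' {μ | (∀ k, ∀ a ∈ μ k, 0 < a) ∧ ∑ k, (μ k).sum = n})

theorem mul_mem_powerSpan {a b : ℕ} {f g : PolyF m} (hf : f ∈ powerSpan ζ m a)
    (hg : g ∈ powerSpan ζ m b) : f * g ∈ powerSpan ζ m (a + b) := by
  have h := Submodule.mul_mem_mul hf hg
  unfold powerSpan at h
  rw [Submodule.span_mul_span] at h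
  refine Submodule.span_mono ?_ h
  rintro _ ⟨_, ⟨μ, hμ, rfl⟩, _, ⟨ν, hν, rfl⟩, rfl⟩
  refine ⟨μ + ν, ⟨fun k a ha => ?_, ?_⟩, powerProd_add μ ν⟩
  · rcases Multiset.mem_add.1 ha with h1 | h1
    · exact hμ.1 k a h1
    · exact hν.1 k a h1
  · simp [Finset.sum_add_distrib, hμ.2, hν.2]

theorem rowPsum_mem_powerSpan (hζ : IsPrimitiveRoot ζ e) (k : Fin e) {r : ℕ} (hr : 0 < r) :
    rowPsum m k r ∈ powerSpan ζ m r := by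
  rw [rowPsum_eq_sum hζ]
  refine Submodule.sum_mem _ fun i _ => Submodule.smul_mem _ _ (Submodule.subset_span ?_)
  refine ⟨Pi.single i {r}, ⟨fun k' a ha => ?_, ?_⟩, powerProd_single i r⟩
  · by_cases h : k' = i
    · subst h
      simp at ha
      omega
    · simp [Pi.single_eq_of_ne h] at ha
  · rw [Finset.sum_eq_single i]
    · simp
    · intro b _ hb
      simp [Pi.single_eq_of_ne hb]
    · simp

theorem rowType_eq_filter (γ : Box m → ℕ) (k : Fin e) (j : Fin (m k)) :
    rowType γ k = (γ ⟨k, j⟩ ::ₘ ((Finset.univ.erase j).val.map fun j => γ ⟨k, j⟩)).filter (· ≠ 0) := by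
  unfold rowType
  rw [← Multiset.map_cons (fun j => γ ⟨k, j⟩), ← Finset.insert_val_of_notMem (by simp),
    Finset.insert_erase (Finset.mem_univ j)]

theorem rowType_update (γ : Box m → ℕ) (b : Box m) (a : ℕ) (k : Fin e) (hk : k ≠ b.1) :
    rowType (Function.update γ b a) k = rowType γ k := by
  unfold rowType
  congr 1
  refine Multiset.map_congr rfl fun j _ => ?_
  rw [Function.update_of_ne]
  rintro rfl
  exact hk rfl

theorem rowType_update_self (γ : Box m → ℕ) (k : Fin e) (j : Fin (m k)) (a : ℕ) :
    rowType (Function.update γ ⟨k, j⟩ a) k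
      = (a ::ₘ ((Finset.univ.erase j).val.map fun j => γ ⟨k, j⟩)).filter (· ≠ 0) := by
  rw [rowType_eq_filter _ _ j, Function.update_self]
  congr 2
  refine Multiset.map_congr rfl fun j' hj' => ?_
  rw [Function.update_of_ne]
  intro h
  have := eq_of_heq (Sigma.mk.inj_iff.1 h).2
  subst this
  exact Finset.notMem_erase j' Finset.univ (Finset.mem_def.2 hj')

open scoped Classical in
theorem coeff_rowPsum_mul (k : Fin e) (r : ℕ) (f : PolyF m) (γ : Box m → ℕ) :
    coeff (mexp γ) (rowPsum m k r * f) = ∑ j : Fin (m k), if r ≤ γ ⟨k, j⟩ then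
      coeff (mexp (Function.update γ ⟨k, j⟩ (γ ⟨k, j⟩ - r))) f else 0 := by
  rw [rowPsum, Finset.sum_mul, coeff_sum]
  refine Finset.sum_congr rfl fun j _ => ?_
  rw [X_pow_eq_monomial, coeff_monomial_mul', one_mul]
  have h1 : (Finsupp.single (⟨k, j⟩ : Box m) r ≤ mexp γ) ↔ r ≤ γ ⟨k, j⟩ := by
    rw [Finsupp.single_le_iff]
    rfl
  have h2 : mexp γ - Finsupp.single (⟨k, j⟩ : Box m) r
      = mexp (Function.update γ ⟨k, j⟩ (γ ⟨k, j⟩ - r)) := by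
    ext b
    rw [Finsupp.tsub_apply]
    change γ b - _ = Function.update γ ⟨k, j⟩ (γ ⟨k, j⟩ - r) b
    by_cases hb : b = ⟨k, j⟩
    · subst hb
      simp
    · rw [Function.update_of_ne hb, Finsupp.single_eq_of_ne hb, Nat.sub_zero]
  simp only [h1, h2]

/-- The number of parts. -/
def EPartition.numParts (α : EPartition e n) : ℕ := ∑ k, (α.parts k).card

/-- A monomial in `p_r(x^{(k)}) m_β` arises by adding `r` to an entry in row `k`. A zero entry
becomes a new part, a nonzero one merely grows, and then the number of parts does not change. -/
theorem numParts_or_eq {r : ℕ} (hr : 0 < r) {β : EPartition e (n - r)} {γ : Box m → ℕ}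
    {k : Fin e} {j : Fin (m k)} (hj : r ≤ γ ⟨k, j⟩)
    (h : rowType (Function.update γ ⟨k, j⟩ (γ ⟨k, j⟩ - r)) = β.parts) :
    (rowType γ = Function.update β.parts k (r ::ₘ β.parts k)) ∨
      ∑ k, (rowType γ k).card = β.numParts := by
  have hne : ∀ k', k' ≠ k → rowType γ k' = β.parts k' := fun k' hk' => by
    rw [← h, rowType_update _ _ _ _ hk']
  have hk : _ = _ := congrFun h k
  rw [rowType_update_self] at hk
  rcases hj.eq_or_lt with h1 | h1
  · left
    funext k'
    by_cases hk' : k' = k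
    · subst hk'
      rw [Function.update_self, ← hk, rowType_eq_filter γ k' j, ← h1,
        Multiset.filter_cons_of_pos (p := fun x => x ≠ 0) _ hr.ne', Nat.sub_self, Multiset.filter_cons_of_neg _ (by simp)]
    · rw [Function.update_of_ne hk', hne k' hk']
  · right
    refine Finset.sum_congr rfl fun k' _ => ?_
    by_cases hk' : k' = k
    · subst hk'
      rw [← hk, rowType_eq_filter γ k' j, Multiset.filter_cons_of_pos _ (by omega),
        Multiset.filter_cons_of_pos _ (by omega), Multiset.card_cons, Multiset.card_cons]
    · rw [hne k' hk']

/-- Induction on the number of parts. Remove a part `r` from row `k` of `α` to get `β`; then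
`p_r(x^{(k)}) m_β` is a nonzero multiple of `m_α` plus terms with fewer parts than `α`. -/
theorem monoPoly_mem_powerSpan (hζ : IsPrimitiveRoot ζ e) (L : ℕ) : ∀ (n : ℕ),
    (∀ k, n ≤ m k) → ∀ α : EPartition e n, α.numParts = L → monoPoly m α ∈ powerSpan ζ m n := by
  classical
  induction L using Nat.strong_induction_on with
  | _ L ih =>
  intro n hm α hα
  by_cases h0 : ∀ k, α.parts k = 0
  · have hn : n = 0 := by
      rw [← α.sum_parts]
      simp [h0]
    subst hn
    have h1 : monoPoly m α = 1 := by
      refine PolyF.ext fun γ => ?_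
      rw [coeff_monoPoly, coeff_one]
      congr 1
      rw [eq_iff_iff]
      constructor
      · intro h
        have h2 : ∑ b, γ b = 0 := by rw [← sum_rowType, h, α.sum_parts]
        ext b
        exact ((Finset.sum_eq_zero_iff.1 h2 b (Finset.mem_univ b))).symm
      · intro h
        funext k
        have h2 : γ = 0 := by
          funext b
          exact (DFunLike.congr_fun h b).symm
        rw [h0, rowType, h2, Multiset.filter_eq_nil]
        intro a ha
        obtain ⟨j, -, rfl⟩ := Multiset.mem_map.1 ha
        simp
    rw [h1]
    refine Submodule.subset_span ⟨0, ⟨by simp, by simp⟩, by simp [powerProd]⟩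
  · push Not at h0
    obtain ⟨k, hk⟩ := h0
    obtain ⟨r, hr⟩ := Multiset.exists_mem_of_ne_zero hk
    have hr0 : 0 < r := EPartition.pos_of_mem_parts hr
    obtain ⟨s, hs⟩ := Multiset.exists_cons_of_mem hr
    have hsum : ∑ k', (Function.update α.parts k s k').sum + r = n := by
      conv_rhs => rw [← α.sum_parts]
      rw [← Finset.add_sum_erase _ _ (Finset.mem_univ k),
        ← Finset.add_sum_erase _ (fun k => (α.parts k).sum) (Finset.mem_univ k), hs,
        Function.update_self, Multiset.sum_cons]
      rw [Finset.sum_congr rfl fun k' hk' => by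
        rw [Function.update_of_ne (Finset.ne_of_mem_erase hk')]]
      ring
    obtain ⟨β, hβ⟩ := EPartition.exists_parts_eq (e := e) (n := n - r)
      (μ := Function.update α.parts k s) (by
        intro k' a ha
        by_cases hk' : k' = k
        · subst hk'
          rw [Function.update_self] at ha
          exact EPartition.pos_of_mem_parts (α := α) (k := k') (hs ▸ Multiset.mem_cons_of_mem ha)
        · rw [Function.update_of_ne hk'] at ha
          exact EPartition.pos_of_mem_parts ha) (by omega)
    have hαβ : α.parts = Function.update β.parts k (r ::ₘ β.parts k) := by
      rw [hβ, Function.update_self, Function.update_idem, ← hs, Function.update_eq_self]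
    have hnum : β.numParts + 1 = L := by
      rw [← hα, EPartition.numParts, EPartition.numParts, hβ,
        ← Finset.add_sum_erase _ _ (Finset.mem_univ k),
        ← Finset.add_sum_erase _ (fun k => (α.parts k).card) (Finset.mem_univ k), hs,
        Function.update_self, Multiset.card_cons]
      rw [Finset.sum_congr rfl fun k' hk' => by
        rw [Function.update_of_ne (Finset.ne_of_mem_erase hk')]]
      ring
    have hprod : rowPsum m k r * monoPoly m β ∈ powerSpan ζ m n := by
      have := mul_mem_powerSpan (rowPsum_mem_powerSpan (m := m) hζ k hr0)
        (ih β.numParts (by omega) (n - r) (fun k => (Nat.sub_le _ _).trans (hm k)) β rfl)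
      rwa [show r + (n - r) = n by omega] at this
    have hhom : (rowPsum m k r * monoPoly m β).IsHomogeneous n := by
      have := (rowPsum_isHomogeneous (m := m) k r).mul (monoPoly_isHomogeneous (m := m) β)
      rwa [show r + (n - r) = n by omega] at this
    have hexp := eq_sum_monoPoly hm
      ((isRowSymm_rowPsum (m := m) k r).mul (isRowSymm_monoPoly β)) hhom
    set c : EPartition e n → Fqt := fun γ =>
      coeff (mexp (partsMatrix m γ)) (rowPsum m k r * monoPoly m β) with hc
    -- The coefficient counts the columns from which `r` may be subtracted to reach type `β`. As a
    -- natural number it is nonzero in `F` as soon as one such column exists.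
    have hcγ : ∀ γ, c γ = ((Finset.univ.filter fun j : Fin (m k) =>
        r ≤ partsMatrix m γ ⟨k, j⟩ ∧ rowType (Function.update (partsMatrix m γ) ⟨k, j⟩
          (partsMatrix m γ ⟨k, j⟩ - r)) = β.parts).card : Fqt) := by
      intro γ
      rw [hc]
      simp only
      rw [coeff_rowPsum_mul, Finset.card_filter, Nat.cast_sum]
      refine Finset.sum_congr rfl fun j _ => ?_
      rw [coeff_monoPoly, ite_and]
      split_ifs <;> simp
    have hother : ∀ γ, γ ≠ α → c γ • monoPoly m γ ∈ powerSpan ζ m n := by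
      intro γ hγ
      by_cases hcz : c γ = 0
      · rw [hcz, zero_smul]
        exact Submodule.zero_mem _
      · rw [hcγ] at hcz
        obtain ⟨j, hj⟩ := Finset.card_ne_zero.1 (Nat.cast_ne_zero.1 hcz)
        obtain ⟨hj1, hj2⟩ := (Finset.mem_filter.1 hj).2
        have hγt := (fits_of_le hm γ).rowType_partsMatrix
        refine Submodule.smul_mem _ _ ?_
        rcases numParts_or_eq hr0 hj1 hj2 with h3 | h3
        · exact absurd (EPartition.parts_injective (hγt.symm.trans (h3.trans hαβ.symm))) hγ
        · refine ih γ.numParts ?_ n hm γ rfl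
          rw [hγt] at h3
          have : γ.numParts = β.numParts := h3
          omega
    have hcα : c α ≠ 0 := by
      rw [hcγ, Nat.cast_ne_zero, Finset.card_ne_zero]
      have hαt := (fits_of_le hm α).rowType_partsMatrix
      have hmem : r ∈ rowType (partsMatrix m α) k := by rw [hαt]; exact hr
      obtain ⟨j, -, hj⟩ := Multiset.mem_map.1 (Multiset.mem_filter.1 hmem).1
      refine ⟨j, Finset.mem_filter.2 ⟨Finset.mem_univ _, hj.ge, ?_⟩⟩
      funext k'
      by_cases hk' : k' = k
      · subst hk'
        rw [rowType_update_self, hj, Nat.sub_self, Multiset.filter_cons_of_neg _ (by simp)]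
        have h5 : _ = _ := congrFun (hαt.trans hαβ) k'
        rw [rowType_eq_filter _ k' j, hj, Multiset.filter_cons_of_pos (p := fun x => x ≠ 0) _ hr0.ne',
          Function.update_self] at h5
        exact (Multiset.cons_inj_right _).1 h5
      · rw [rowType_update _ _ _ _ hk', hαt, hαβ, Function.update_of_ne hk']
    rw [← Finset.add_sum_erase _ _ (Finset.mem_univ α)] at hexp
    have h6 : c α • monoPoly m α ∈ powerSpan ζ m n := by
      have h7 : c α • monoPoly m α = rowPsum m k r * monoPoly m β
          - ∑ γ ∈ Finset.univ.erase α, c γ • monoPoly m γ := eq_sub_of_add_eq hexp.symm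
      rw [h7]
      exact Submodule.sub_mem _ hprod
        (Submodule.sum_mem _ fun γ hγ => hother γ (Finset.ne_of_mem_erase hγ))
    have := Submodule.smul_mem _ (c α)⁻¹ h6
    rwa [smul_smul, inv_mul_cancel₀ hcα, one_smul] at this

end PowerSums

/-! ### Sesquilinear forms that are diagonal in a basis -/

section DiagForm

variable {K V ι : Type*} [Field K] [AddCommGroup V] [Module K V] [Fintype ι]

theorem linearIndependent_of_basis_mem_span (b : Module.Basis ι K V) {v : ι → V}
    (h : ∀ i, b i ∈ Submodule.span K (Set.range v)) :
    LinearIndependent K v ∧ ⊤ ≤ Submodule.span K (Set.range v) := by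
  have h1 : ⊤ ≤ Submodule.span K (Set.range v) := by
    rw [← b.span_eq]
    refine Submodule.span_le.2 ?_
    rintro _ ⟨i, rfl⟩
    exact h i
  exact ⟨linearIndependent_of_top_le_span_of_card_eq_finrank h1
    (Module.finrank_eq_card_basis b).symm, h1⟩

/-- A family of vectors indexed like a basis and spanning it, as a basis. -/
noncomputable def basisOfMemSpan (b : Module.Basis ι K V) {v : ι → V}
    (h : ∀ i, b i ∈ Submodule.span K (Set.range v)) : Module.Basis ι K V :=
  Module.Basis.mk (linearIndependent_of_basis_mem_span b h).1
    (linearIndependent_of_basis_mem_span b h).2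

theorem basisOfMemSpan_apply (b : Module.Basis ι K V) {v : ι → V}
    (h : ∀ i, b i ∈ Submodule.span K (Set.range v)) (i : ι) : basisOfMemSpan b h i = v i :=
  Module.Basis.mk_apply _ _ _

/-- The scalar product is defined through `Function.invFun` on the ambient sequences. Linear
independence makes this a true left inverse, so it returns the coordinates in the basis. -/
theorem invFun_sum_smul_coe {W : Submodule K V} (b : Module.Basis ι K W) (w : ι → V)
    (hw : ∀ i, (b i : V) = w i) (f : W) :
    Function.invFun (fun c : ι → K => ∑ i, c i • w i) (f : V) = b.repr f := by
  have hb : LinearIndependent K w := by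
    have := b.linearIndependent.map' W.subtype (Submodule.ker_subtype _)
    rwa [show W.subtype ∘ b = w from funext hw] at this
  have hinj : Function.Injective fun c : ι → K => ∑ i, c i • w i :=
    hb.fintypeLinearCombination_injective
  have hf : (f : V) = (fun c : ι → K => ∑ i, c i • w i) (b.repr f) := by
    have h := congrArg W.subtype (b.sum_repr f)
    rw [map_sum] at h
    simpa only [map_smul, Submodule.subtype_apply, hw] using h.symm
  rw [hf]
  exact Function.leftInverse_invFun hinj _

/-- The sesquilinear form for which a given basis is orthogonal. -/
noncomputable def diagForm (b : Module.Basis ι K V) (σ : K →+* K) (z : ι → K) :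
    V →ₗ[K] V →ₛₗ[σ] K :=
  LinearMap.mk₂'ₛₗ (RingHom.id K) σ (fun f g => ∑ i, b.repr f i * σ (b.repr g i) * z i)
    (fun f f' g => by simp [add_mul, Finset.sum_add_distrib])
    (fun c f g => by simp [Finset.mul_sum, mul_assoc])
    (fun f g g' => by simp [add_mul, mul_add, Finset.sum_add_distrib])
    (fun c f g => by
      simp only [map_smul, Finsupp.smul_apply, smul_eq_mul, map_mul, Finset.mul_sum]
      exact Finset.sum_congr rfl fun i _ => by ring)

theorem diagForm_apply (b : Module.Basis ι K V) (σ : K →+* K) (z : ι → K) (f g : V) :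
    diagForm b σ z f g = ∑ i, b.repr f i * σ (b.repr g i) * z i := rfl

theorem diagForm_self_ne_zero (b : Module.Basis ι K V) (σ : K →+* K) (z : ι → K)
    (h : ∀ c : ι → K, c ≠ 0 → ∑ i, c i * σ (c i) * z i ≠ 0) {f : V} (hf : f ≠ 0) :
    diagForm b σ z f f ≠ 0 :=
  h (fun i => b.repr f i) fun h0 => hf <|
    b.repr.map_eq_zero_iff.1 (Finsupp.ext fun i => congrFun h0 i)

theorem linearIndependent_of_basis_map {K V U ι : Type*} [Field K] [AddCommGroup V] [Module K V]
    [AddCommGroup U] [Module K U]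
    (b : Module.Basis ι K V) (g : V →ₗ[K] U) (hg : Function.Injective g) (w : ι → U)
    (hw : ∀ i, g (b i) = w i) : LinearIndependent K w := by
  have h := b.linearIndependent.map' g (LinearMap.ker_eq_bot.2 hg)
  rwa [show g ∘ b = w from funext hw] at h

end DiagForm

/-! ### Nonvanishing of `⟨f, f⟩` by real evaluation near the origin -/

section Anisotropic

theorem conjF_algebraMap (a : MvPolynomial (Fin 2) ℂ) :
    conjF (algebraMap _ Fqt a) = algebraMap _ Fqt (map (starRingEnd ℂ) a) :=
  IsFractionRing.ringEquivOfRingEquiv_algebraMap _ _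

theorem eval_map_conj (a : MvPolynomial (Fin 2) ℂ) (p : Fin 2 → ℝ) :
    eval (fun i => (p i : ℂ)) (map (starRingEnd ℂ) a)
      = starRingEnd ℂ (eval (fun i => (p i : ℂ)) a) := by
  have h := congrArg (fun f : MvPolynomial (Fin 2) ℂ →+* ℂ => f a)
    (show (eval fun i => (p i : ℂ)).comp (map (starRingEnd ℂ))
      = (starRingEnd ℂ).comp (eval fun i => (p i : ℂ)) from
      MvPolynomial.ringHom_ext (fun z => by simp) fun i => by simp)
  exact h

/-- A neighbourhood of the origin contains a product of infinite sets of real numbers, on which a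
nonzero polynomial cannot vanish identically. -/
theorem exists_eval_ne_zero {a : MvPolynomial (Fin 2) ℂ} (ha : a ≠ 0) {U : Set (Fin 2 → ℝ)}
    (hU : U ∈ nhds 0) : ∃ p ∈ U, eval (fun i => (p i : ℂ)) a ≠ 0 := by
  obtain ⟨ε, hε, hb⟩ := Metric.mem_nhds_iff.1 hU
  by_contra! h
  refine ha (MvPolynomial.funext_set (fun _ => (fun x : ℝ => (x : ℂ)) '' Set.Ioo (-ε) ε)
    (fun _ => ?_) fun x hx => ?_)
  · exact (Set.Ioo_infinite (by linarith)).image Complex.ofReal_injective.injOn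
  · choose p hp hpx using fun i => hx i (Set.mem_univ i)
    have hx' : x = fun i => (p i : ℂ) := funext fun i => (hpx i).symm
    rw [hx', map_zero]
    refine h p (hb ?_)
    rw [mem_ball_zero_iff, pi_norm_lt_iff hε]
    intro i
    exact abs_lt.2 (hp i)

theorem continuous_eval_ofReal (a : MvPolynomial (Fin 2) ℂ) :
    Continuous fun p : Fin 2 → ℝ => eval (fun i => (p i : ℂ)) a :=
  (MvPolynomial.continuous_eval a).comp
    (continuous_pi fun i => Complex.continuous_ofReal.comp (continuous_apply i))

/-- A sum `∑ c_i c̄_i N_i / D_i` does not vanish when the `N_i / D_i` are positive at the origin. -/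
theorem sum_mul_conj_ne_zero {ι : Type*} [Fintype ι] (c : ι → Fqt) (hc : c ≠ 0)
    (N D : ι → MvPolynomial (Fin 2) ℂ)
    (h0 : ∀ i, 0 < (eval (0 : Fin 2 → ℂ) (N i) / eval (0 : Fin 2 → ℂ) (D i)).re) :
    ∑ i, c i * conjF (c i) * (algebraMap _ Fqt (N i) / algebraMap _ Fqt (D i)) ≠ 0 := by
  classical
  have hD0 : ∀ i, eval (0 : Fin 2 → ℂ) (D i) ≠ 0 := by
    intro i h
    have := h0 i
    rw [h, div_zero] at this
    exact lt_irrefl _ this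
  have hD : ∀ i, algebraMap _ Fqt (D i) ≠ 0 := by
    intro i h
    rw [IsFractionRing.to_map_eq_zero_iff] at h
    exact hD0 i (by rw [h, map_zero])
  intro hsum
  -- The `c_i` are written as `a_i / b` with a common denominator. Multiplication of the sum by `b
  -- b̄ ∏ D_j` then gives a polynomial identity.
  obtain ⟨b, hb⟩ := IsLocalization.exist_integer_multiples_of_finite
    (nonZeroDivisors (MvPolynomial (Fin 2) ℂ)) c
  choose a ha using hb
  have hb0 : algebraMap (MvPolynomial (Fin 2) ℂ) Fqt b ≠ 0 :=
    IsFractionRing.to_map_ne_zero_of_mem_nonZeroDivisors b.2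
  have ha' : ∀ i, algebraMap (MvPolynomial (Fin 2) ℂ) Fqt (a i)
      = algebraMap (MvPolynomial (Fin 2) ℂ) Fqt b * c i := fun i =>
    (ha i).trans (Algebra.smul_def _ _)
  obtain ⟨i₀, hi₀⟩ : ∃ i, c i ≠ 0 := by
    by_contra! h
    exact hc (funext h)
  have hai : a i₀ ≠ 0 := by
    intro h
    have := ha' i₀
    rw [h, map_zero] at this
    exact mul_ne_zero hb0 hi₀ this.symm
  have hpoly : ∑ i, a i * map (starRingEnd ℂ) (a i) * (N i * ∏ j ∈ Finset.univ.erase i, D j)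
      = 0 := by
    rw [← IsFractionRing.to_map_eq_zero_iff (K := Fqt), map_sum]
    refine Eq.trans ?_ (mul_eq_zero_of_right (algebraMap (MvPolynomial (Fin 2) ℂ) Fqt b
      * conjF (algebraMap (MvPolynomial (Fin 2) ℂ) Fqt b) *
      ∏ j, algebraMap (MvPolynomial (Fin 2) ℂ) Fqt (D j)) hsum)
    rw [Finset.mul_sum]
    refine Finset.sum_congr rfl fun i _ => ?_
    rw [map_mul, map_mul, map_mul, ← conjF_algebraMap, ha', map_mul, map_prod,
      ← Finset.mul_prod_erase _ _ (Finset.mem_univ i)]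
    have := hD i
    field_simp
  have hcont : ∀ i, ContinuousAt (fun p : Fin 2 → ℝ =>
      (eval (fun k => (p k : ℂ)) (N i) / eval (fun k => (p k : ℂ)) (D i)).re) 0 := by
    intro i
    refine Complex.continuous_re.continuousAt.comp
      ((continuous_eval_ofReal _).continuousAt.div (continuous_eval_ofReal _).continuousAt ?_)
    have := hD0 i
    rwa [show (0 : Fin 2 → ℂ) = fun k => (((0 : Fin 2 → ℝ) k : ℝ) : ℂ) by ext; simp] at this
  have hU : {p : Fin 2 → ℝ | ∀ i, 0 <
      (eval (fun k => (p k : ℂ)) (N i) / eval (fun k => (p k : ℂ)) (D i)).re} ∈ nhds 0 := by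
    refine Filter.eventually_all.2 fun i => (hcont i).eventually (lt_mem_nhds ?_)
    have := h0 i
    rwa [show (0 : Fin 2 → ℂ) = fun k => (((0 : Fin 2 → ℝ) k : ℝ) : ℂ) by ext; simp] at this
  obtain ⟨p, hp, hpa⟩ := exists_eval_ne_zero hai hU
  have hDp : ∀ i, eval (fun k => (p k : ℂ)) (D i) ≠ 0 := by
    intro i h
    have := hp i
    rw [h, div_zero] at this
    exact lt_irrefl _ this
  have h1 := congrArg (eval fun k => (p k : ℂ)) hpoly
  rw [map_sum, map_zero] at h1
  -- At a real point conjugating the coefficients conjugates the value, so `a_i ā_i` becomes a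
  -- squared modulus. The real parts of the summands are nonnegative, and the one for `i₀` is
  -- positive.
  have h2 : ∑ i, ((Complex.normSq (eval (fun k => (p k : ℂ)) (a i)) : ℝ) : ℂ) *
      (eval (fun k => (p k : ℂ)) (N i) / eval (fun k => (p k : ℂ)) (D i)) = 0 := by
    have h3 : (∏ j, eval (fun k => (p k : ℂ)) (D j)) ≠ 0 :=
      Finset.prod_ne_zero_iff.2 fun j _ => hDp j
    refine (mul_eq_zero.1 (Eq.trans ?_ h1)).resolve_left h3
    rw [Finset.mul_sum]
    refine Finset.sum_congr rfl fun i _ => ?_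
    rw [map_mul, map_mul, map_mul, map_prod, eval_map_conj, Complex.mul_conj,
      ← Finset.mul_prod_erase _ _ (Finset.mem_univ i)]
    have := hDp i
    field_simp
  have h4 := congrArg Complex.re h2
  rw [Complex.re_sum, Complex.zero_re] at h4
  simp only [Complex.re_ofReal_mul] at h4
  rw [Finset.sum_eq_zero_iff_of_nonneg fun i _ =>
    mul_nonneg (Complex.normSq_nonneg _) (hp i).le] at h4
  rcases mul_eq_zero.1 (h4 i₀ (Finset.mem_univ _)) with h5 | h5
  · exact hpa (Complex.normSq_eq_zero.1 h5)
  · exact (hp i₀).ne' h5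

end Anisotropic

/-! ### The power sum basis and the scalar product -/

section PowerBasis

variable {e n : ℕ} {m : Fin e → ℕ} {ζ : ℂ}

/-- The power sum functions as elements of `Ξ^n`. -/
noncomputable def powerXi (ζ : ℂ) (m : Fin e → ℕ) (α : EPartition e n) : Xi m n :=
  ⟨powerSym ζ m α, powerSym_mem α⟩

theorem powerSpan_eq : powerSpan ζ m n
    = Submodule.span Fqt (Set.range fun α : EPartition e n => powerPoly ζ m α) := by
  unfold powerSpan
  congr 1
  ext f
  constructor
  · rintro ⟨μ, ⟨h1, h2⟩, rfl⟩
    obtain ⟨α, rfl⟩ := EPartition.exists_parts_eq h1 h2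
    exact ⟨α, powerPoly_eq α⟩
  · rintro ⟨α, rfl⟩
    exact ⟨α.parts, ⟨fun k a ha => EPartition.pos_of_mem_parts ha, α.sum_parts⟩,
      (powerPoly_eq α).symm⟩

theorem monoXi_mem_span_powerXi (hζ : IsPrimitiveRoot ζ e) (α : EPartition e n) :
    monoXi m α ∈ Submodule.span Fqt (Set.range (powerXi (n := n) ζ m)) := by
  rw [← Set.image_univ]
  refine mem_span_of_evalXi _ _ ?_
  rw [Set.image_univ]
  have h := monoPoly_mem_powerSpan (m := shiftBy m n) hζ α.numParts n
    (fun k => Nat.le_add_left _ _) α rfl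
  rw [powerSpan_eq] at h
  exact h

/-- The basis `(p_α)` of `Ξ^n`. -/
noncomputable def powerBasis (hζ : IsPrimitiveRoot ζ e) (m : Fin e → ℕ) (n : ℕ) :
    Module.Basis (EPartition e n) Fqt (Xi m n) :=
  basisOfMemSpan (K := Fqt) (V := Xi m n) (monoBasis m n) (v := powerXi ζ m) fun α => by
    rw [monoBasis_apply]
    exact monoXi_mem_span_powerXi hζ α

theorem powerBasis_apply (hζ : IsPrimitiveRoot ζ e) (α : EPartition e n) :
    powerBasis hζ m n α = powerXi ζ m α :=
  basisOfMemSpan_apply (K := Fqt) (V := Xi m n) _ _ α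

theorem linearIndependent_powerPoly (hζ : IsPrimitiveRoot ζ e) :
    LinearIndependent Fqt fun α : EPartition e n => powerPoly ζ (shiftBy m n) α :=
  linearIndependent_of_basis_map (K := Fqt) (V := Xi m n) (U := PolyF (shiftBy m n))
    (powerBasis hζ m n) (evalXi m n) evalXi_injective _ fun α => by rw [powerBasis_apply]; rfl

theorem powerCoord_eq (hζ : IsPrimitiveRoot ζ e) (f : Xi m n) :
    powerCoord ζ m n f = (powerBasis hζ m n).repr f :=
  invFun_sum_smul_coe (K := Fqt) (V := PolySeq m) (W := Xi m n) (powerBasis hζ m n)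
    (powerSym ζ m) (fun α => by rw [powerBasis_apply]; rfl) f

/-- The scalar product on `Ξ^n`. -/
noncomputable def formXi (hζ : IsPrimitiveRoot ζ e) (m : Fin e → ℕ) (n : ℕ) :=
  diagForm (K := Fqt) (V := Xi m n) (powerBasis hζ m n) (conjF : Fqt →+* Fqt) (zqt ζ)

theorem scalarProd_eq (hζ : IsPrimitiveRoot ζ e) (f g : Xi m n) :
    scalarProd ζ m n f g = formXi hζ m n f g := by
  simp only [scalarProd, powerCoord_eq hζ]
  rfl

theorem zE_pos (α : EPartition e n) : 0 < zE α := by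
  unfold zE
  refine Nat.mul_pos ?_ (Finset.prod_pos fun k _ => ?_)
  · rcases Nat.eq_zero_or_pos e with rfl | he
    · simp
    · exact pow_pos he _
  · unfold zPart
    refine Finset.prod_pos fun i hi => Nat.mul_pos (pow_pos ?_ _) (Nat.factorial_pos _)
    exact EPartition.pos_of_mem_parts (α := α) (k := k) (List.mem_toFinset.1 hi)

/-- Parts are positive, so at `q = t = 0` every factor `1 - ζ^k q^a` or `1 - ζ^k t^a` equals one,
and `z_α(q,t)` specializes to a positive integer. -/
theorem sum_mul_conjF_mul_zqt_ne_zero {c : EPartition e n → Fqt} (hc : c ≠ 0) :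
    ∑ α, c α * conjF (c α) * zqt ζ α ≠ 0 := by
  let A : ℕ → ℕ → Fin 2 → MvPolynomial (Fin 2) ℂ := fun k a i => 1 - C (ζ ^ k) * X i ^ a
  let N : EPartition e n → MvPolynomial (Fin 2) ℂ := fun α =>
    (zE α : MvPolynomial (Fin 2) ℂ) *
      ∏ k : Fin e, ((α.1 k).rowLens.map fun a => A k a 0).prod
  let D : EPartition e n → MvPolynomial (Fin 2) ℂ := fun α =>
      ∏ k : Fin e, ((α.1 k).rowLens.map fun a => A k a 1).prod
  have hA : ∀ k a i, algebraMap _ Fqt (A k a i)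
      = 1 - cF (ζ ^ k) * (algebraMap (MvPolynomial (Fin 2) ℂ) Fqt (X i)) ^ a := by
    intro k a i
    simp only [A, cF, map_sub, map_one, map_mul, map_pow]
  have hz : ∀ α : EPartition e n, zqt ζ α = algebraMap _ Fqt (N α) / algebraMap _ Fqt (D α) := by
    intro α
    simp only [N, D, zqt, map_mul, map_prod, map_natCast, mul_div_assoc, map_list_prod,
      List.map_map, Function.comp_def, hA, ← Finset.prod_div_distrib]
    congr 1
    refine Finset.prod_congr rfl fun k _ => ?_
    induction (α.1 k).rowLens with
    | nil => simp
    | cons a l ih =>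
      rw [List.map_cons, List.prod_cons, List.map_cons, List.prod_cons, List.map_cons,
        List.prod_cons, ih, div_mul_div_comm]
      rfl
  have hev : ∀ (α : EPartition e n) (k : Fin e) (i : Fin 2),
      eval (0 : Fin 2 → ℂ) ((α.1 k).rowLens.map fun a => A k a i).prod = 1 := by
    intro α k i
    rw [map_list_prod, List.map_map]
    refine List.prod_eq_one fun x hx => ?_
    obtain ⟨a, ha, rfl⟩ := List.mem_map.1 hx
    have ha0 : a ≠ 0 := (EPartition.pos_of_mem_parts (α := α) (k := k) ha).ne'
    simp [A, ha0]
  simp only [hz]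
  refine sum_mul_conj_ne_zero c hc N D fun α => ?_
  have hN : eval (0 : Fin 2 → ℂ) (N α) = zE α := by
    simp only [N, map_mul, map_natCast, map_prod, hev, Finset.prod_const_one, mul_one]
  have hD : eval (0 : Fin 2 → ℂ) (D α) = 1 := by
    simp only [D, map_prod, hev, Finset.prod_const_one]
  rw [hN, hD, div_one, Complex.natCast_re]
  exact_mod_cast zE_pos α

theorem formXi_self_ne_zero (hζ : IsPrimitiveRoot ζ e) {f : Xi m n} (hf : f ≠ 0) :
    formXi hζ m n f f ≠ 0 := by
  have h := diagForm_self_ne_zero (K := Fqt) (V := Xi m n) (powerBasis hζ m n)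
    (conjF : Fqt →+* Fqt) (zqt ζ) (fun _ hc => sum_mul_conjF_mul_zqt_ne_zero hc) hf
  unfold formXi
  exact h

end PowerBasis

/-! ### Cauchy determinants and a symmetry in two sets of variables -/

section Cauchy

variable {e : ℕ} {m : Fin e → ℕ} {L : Type*} [Field L]

/-- The product of the row Cauchy determinants `∏_k det (1 / (1 - x_a y_b))`. -/
noncomputable def rowCauchy (x y : Box m → L) : L :=
  ∏ k, (Matrix.of fun a b : Fin (m k) => (1 - x ⟨k, a⟩ * y ⟨k, b⟩)⁻¹).det

/-- The product `∏_k ∏_{a, b} (1 - x_a y_b)`. -/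
def boxProd (x y : Box m → L) : L :=
  ∏ b : Box m, ∏ j : Fin (m b.1), (1 - x b * y ⟨b.1, j⟩)

/-- The polynomial `∏_{c ≠ b} (1 - y_c z)` in `z`. -/
noncomputable def cofPoly {N : ℕ} (y : Fin N → L) (b : Fin N) : Polynomial L :=
  ∏ c ∈ Finset.univ.erase b, (1 - Polynomial.C (y c) * Polynomial.X)

/-- The product of the determinants of the coefficients of the `∏_{c ≠ b} (1 - y_c z)`. -/
noncomputable def rowCof (y : Box m → L) : L :=
  ∏ k, (Matrix.of fun d b : Fin (m k) =>
    (cofPoly (fun c => y ⟨k, c⟩) b).coeff (m k - 1 - d)).det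

theorem rowCauchy_comm (x y : Box m → L) : rowCauchy x y = rowCauchy y x := by
  unfold rowCauchy
  refine Finset.prod_congr rfl fun k _ => ?_
  rw [← Matrix.det_transpose]
  congr 1
  ext a b
  simp [mul_comm]

theorem boxProd_comm (x y : Box m → L) : boxProd x y = boxProd y x := by
  unfold boxProd
  rw [Fintype.prod_sigma, Fintype.prod_sigma]
  refine Finset.prod_congr rfl fun k _ => ?_
  change ∏ a : Fin (m k), ∏ b : Fin (m k), (1 - x ⟨k, a⟩ * y ⟨k, b⟩)
    = ∏ b : Fin (m k), ∏ a : Fin (m k), (1 - y ⟨k, b⟩ * x ⟨k, a⟩)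
  rw [Finset.prod_comm]
  exact Finset.prod_congr rfl fun a _ => Finset.prod_congr rfl fun b _ => by rw [mul_comm]

theorem natDegree_cofPoly_lt {N : ℕ} (y : Fin N → L) (b : Fin N) :
    (cofPoly y b).natDegree < N := by
  have h1 : (cofPoly y b).natDegree ≤ ∑ c ∈ Finset.univ.erase b, 1 := by
    refine (Polynomial.natDegree_prod_le _ _).trans (Finset.sum_le_sum fun c _ => ?_)
    refine (Polynomial.natDegree_sub_le _ _).trans ?_
    rw [Polynomial.natDegree_one, Nat.zero_max]
    exact (Polynomial.natDegree_C_mul_le _ _).trans Polynomial.natDegree_X_le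
  rw [Finset.sum_const, smul_eq_mul, mul_one, Finset.card_erase_of_mem (Finset.mem_univ _),
    Finset.card_univ, Fintype.card_fin] at h1
  have := b.pos
  omega

theorem eval_cofPoly {N : ℕ} (y : Fin N → L) (b : Fin N) (z : L) :
    (cofPoly y b).eval z = ∏ c ∈ Finset.univ.erase b, (1 - z * y c) := by
  simp only [cofPoly, Polynomial.eval_prod, Polynomial.eval_sub, Polynomial.eval_one,
    Polynomial.eval_mul, Polynomial.eval_C, Polynomial.eval_X]
  exact Finset.prod_congr rfl fun c _ => by rw [mul_comm]

/-- The polynomials have degree below the size of the matrix, so their matrix of values is a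
Vandermonde matrix times their matrix of coefficients. -/
theorem det_cofPoly (x y : Box m → L) :
    ∏ k, (Matrix.of fun a b : Fin (m k) => (cofPoly (fun c => y ⟨k, c⟩) b).eval (x ⟨k, a⟩)).det
      = rowAlt (delta m) x * rowCof y := by
  unfold rowAlt rowCof
  rw [← Finset.prod_mul_distrib]
  refine Finset.prod_congr rfl fun k _ => ?_
  rw [← Matrix.det_mul]
  congr 1
  ext a b
  rw [Matrix.mul_apply, Matrix.of_apply,
    Polynomial.eval_eq_sum_range' (natDegree_cofPoly_lt _ b),
    ← Fin.sum_univ_eq_sum_range (fun i => (cofPoly _ b).coeff i * x ⟨k, a⟩ ^ i),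
    ← Equiv.sum_comp Fin.revPerm]
  refine Finset.sum_congr rfl fun d _ => ?_
  simp only [Fin.revPerm_apply, Fin.val_rev, Matrix.of_apply, delta]
  rw [mul_comm, show m k - (↑d + 1) = m k - 1 - d by omega]

/-- Multiplying matrix row `a` by `∏_c (1 - x_a y_c)` clears denominators and leaves the values at
`x_a` of the polynomials `∏_{c ≠ b} (1 - y_c z)`. -/
theorem rowCauchy_mul_boxProd {x y : Box m → L}
    (h : ∀ k (a b : Fin (m k)), 1 - x ⟨k, a⟩ * y ⟨k, b⟩ ≠ 0) :
    rowCauchy x y * boxProd x y = rowAlt (delta m) x * rowCof y := by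
  rw [← det_cofPoly, rowCauchy, boxProd, Fintype.prod_sigma, ← Finset.prod_mul_distrib]
  refine Finset.prod_congr rfl fun k _ => ?_
  rw [mul_comm, ← Matrix.det_mul_column]
  congr 1
  ext a b
  rw [Matrix.of_apply, Matrix.of_apply, Matrix.of_apply, eval_cofPoly,
    ← Finset.mul_prod_erase _ _ (Finset.mem_univ b), mul_right_comm,
    mul_inv_cancel₀ (h k a b), one_mul]

theorem rowCof_ne_zero {y : Box m → L} (h0 : ∀ b, y b ≠ 0) (hy : Function.Injective y) :
    rowCof y ≠ 0 := by
  -- At `x = y⁻¹` the factor with `c = a` kills every off-diagonal entry, and the diagonal ones are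
  -- nonzero because the `y_c` are distinct.
  have h := det_cofPoly (fun b => (y b)⁻¹) y
  refine right_ne_zero_of_mul (a := rowAlt (delta m) fun b => (y b)⁻¹) (h ▸ ?_)
  refine Finset.prod_ne_zero_iff.2 fun k _ => ?_
  have hd : (Matrix.of fun a b : Fin (m k) =>
      (cofPoly (fun c => y ⟨k, c⟩) b).eval (y ⟨k, a⟩)⁻¹)
      = Matrix.diagonal fun b => (cofPoly (fun c => y ⟨k, c⟩) b).eval (y ⟨k, b⟩)⁻¹ := by
    ext a b
    rw [Matrix.of_apply]
    by_cases hab : a = b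
    · subst hab
      rw [Matrix.diagonal_apply_eq]
    · rw [Matrix.diagonal_apply_ne _ hab, eval_cofPoly]
      refine Finset.prod_eq_zero (Finset.mem_erase.2 ⟨hab, Finset.mem_univ a⟩) ?_
      rw [inv_mul_cancel₀ (h0 _), sub_self]
  rw [hd, Matrix.det_diagonal]
  refine Finset.prod_ne_zero_iff.2 fun b _ => ?_
  rw [eval_cofPoly]
  refine Finset.prod_ne_zero_iff.2 fun c hc => ?_
  rw [sub_ne_zero]
  intro h1
  rw [eq_comm, inv_mul_eq_one₀ (h0 _)] at h1
  have := eq_of_heq (Sigma.mk.inj_iff.1 (hy h1)).2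
  exact Finset.ne_of_mem_erase hc this.symm

/-- The Cauchy determinant and the product of the `1 - x y` are symmetric. This relation replaces
the explicit evaluation of `rowCof y`. -/
theorem rowAlt_mul_rowCof {x y : Box m → L}
    (h : ∀ k (a b : Fin (m k)), 1 - x ⟨k, a⟩ * y ⟨k, b⟩ ≠ 0) :
    rowAlt (delta m) x * rowCof y = rowAlt (delta m) y * rowCof x := by
  rw [← rowCauchy_mul_boxProd h, ← rowCauchy_mul_boxProd fun k a b => by
    rw [mul_comm]; exact h k b a, rowCauchy_comm, boxProd_comm]

theorem rowCauchy_eq_sum (x y : Box m → L) :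
    rowCauchy x y = ∑ w : RowPerm m, w.sgn * ∏ b : Box m, (1 - x ⟨b.1, w b.1 b.2⟩ * y b)⁻¹ := by
  unfold rowCauchy
  simp only [Matrix.det_apply', Finset.prod_univ_sum, Fintype.piFinset_univ]
  refine Finset.sum_congr rfl fun w _ => ?_
  rw [alternant_comm_aux, Finset.prod_mul_distrib, Fintype.prod_sigma]
  rfl

/-- After expansion of the determinants, each term pairs `x_{w(b)}` with `y_b`. Shifting the
selected `x` by one row pairs the same variables as shifting the selected `y` the opposite way, once
`i` is reindexed by `w`. -/
theorem sum_rowCauchy_cycPt [NeZero e] (ε : Bool) (t : L) (x y : Box m → L) :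
    ∑ i, rowCauchy (cycPt ε t i x) y = ∑ i, rowCauchy (cycPt (!ε) t i y) x := by
  have hcomm : ∀ i, rowCauchy (cycPt (!ε) t i y) x = rowCauchy x (cycPt (!ε) t i y) :=
    fun i => rowCauchy_comm _ _
  simp only [hcomm, rowCauchy_eq_sum]
  rw [Finset.sum_comm]
  conv_rhs => rw [Finset.sum_comm]
  refine Finset.sum_congr rfl fun w _ => ?_
  rw [← Equiv.sum_comp w.actIdx]
  refine Finset.sum_congr rfl fun i _ => ?_
  congr 1
  rw [prod_box_eq_split i, prod_box_eq_split i]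
  congr 1
  -- Both products consist of the factors joining neighbouring rows, indexed once by the row of `y`
  -- and once by the row of `x`.
  · let F : Fin e → Fin e → L := fun k' k => (1 - t * x ⟨k', w k' (i k')⟩ * y ⟨k, i k⟩)⁻¹
    have h1 : ∀ k : Fin e, prevRow (!ε) k = nextRow ε k := by cases ε <;> intro k <;> rfl
    have hR : ∀ k, (1 - x ⟨k, w k (i k)⟩ * cycPt (!ε) t i y ⟨k, i k⟩)⁻¹ = F k (nextRow ε k) := by
      intro k
      simp only [cycPt, if_true, F, ← h1]
      congr 2
      ring
    have hL : ∀ k, (1 - cycPt ε t (w.actIdx i) x ⟨k, w k (i k)⟩ * y ⟨k, i k⟩)⁻¹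
        = F (prevRow ε k) k := by
      intro k
      simp only [cycPt, RowPerm.actIdx, Equiv.piCongrRight_apply, Pi.map_apply, if_true, F]
    simp only [hL, hR]
    rw [← prod_nextRow ε]
    simp only [prevRow_nextRow]
  · refine Finset.prod_congr rfl fun b hb => ?_
    simp only [Finset.mem_filter, Finset.mem_univ, true_and] at hb
    simp [cycPt, RowPerm.actIdx, hb]

/-- The factor by which the kernel changes under the shift of `x`: numerator. -/
def cycNum {e : ℕ} {m : Fin e → ℕ} {L : Type*} [CommRing L] (i : ColIdx m) (x y : Box m → L) : L :=
  ∏ k, ∏ j : Fin (m k), (1 - x ⟨k, i k⟩ * y ⟨k, j⟩)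

/-- The factor by which the kernel changes under the shift of `x`: denominator. -/
def cycDen [NeZero e] {L : Type*} [CommRing L] (ε : Bool) (t : L) (i : ColIdx m) (x y : Box m → L) : L :=
  ∏ k, ∏ j : Fin (m k), (1 - t * x ⟨prevRow ε k, i (prevRow ε k)⟩ * y ⟨k, j⟩)

theorem boxProd_cycPt [NeZero e] (ε : Bool) (t : L) (i : ColIdx m) (x y : Box m → L) :
    boxProd (cycPt ε t i x) y * cycNum i x y = boxProd x y * cycDen ε t i x y := by
  unfold boxProd cycNum cycDen
  rw [prod_box_eq_split i, prod_box_eq_split i]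
  have h1 : ∏ b : Box m with b.2 ≠ i b.1, ∏ j, (1 - cycPt ε t i x b * y ⟨b.1, j⟩)
      = ∏ b : Box m with b.2 ≠ i b.1, ∏ j, (1 - x b * y ⟨b.1, j⟩) := by
    refine Finset.prod_congr rfl fun b hb => ?_
    simp only [Finset.mem_filter, Finset.mem_univ, true_and] at hb
    simp [cycPt, hb]
  rw [h1]
  simp only [cycPt, if_true]
  ring

/-- The factor `cycNum / cycDen` is exactly what turns the box product at `x` into the one at the
shifted point, so each summand becomes a Cauchy determinant. -/
theorem sum_rowAlt_cycPt_mul [NeZero e] {ε : Bool} {t : L} {x y : Box m → L}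
    (h1 : ∀ a b : Box m, 1 - x a * y b ≠ 0) (h2 : ∀ a b : Box m, 1 - t * x a * y b ≠ 0) :
    (∑ i, rowAlt (delta m) (cycPt ε t i x) * (cycNum i x y * (cycDen ε t i x y)⁻¹)) * rowCof y
      = boxProd x y * ∑ i, rowCauchy (cycPt ε t i x) y := by
  rw [Finset.sum_mul, Finset.mul_sum]
  refine Finset.sum_congr rfl fun i _ => ?_
  have hden : cycDen ε t i x y ≠ 0 :=
    Finset.prod_ne_zero_iff.2 fun k _ => Finset.prod_ne_zero_iff.2 fun j _ => h2 _ _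
  have h3 := boxProd_cycPt ε t i x y
  have h4 := rowCauchy_mul_boxProd (x := cycPt ε t i x) (y := y) fun k a b => by
    unfold cycPt
    split_ifs
    · exact h2 _ _
    · exact h1 _ _
  calc _ = rowAlt (delta m) (cycPt ε t i x) * rowCof y * cycNum i x y * (cycDen ε t i x y)⁻¹ := by
        ring
    _ = rowCauchy (cycPt ε t i x) y * (boxProd (cycPt ε t i x) y * cycNum i x y)
          * (cycDen ε t i x y)⁻¹ := by rw [← h4]; ring
    _ = rowCauchy (cycPt ε t i x) y * boxProd x y * (cycDen ε t i x y * (cycDen ε t i x y)⁻¹) := by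
        rw [h3]; ring
    _ = _ := by rw [mul_inv_cancel₀ hden]; ring

/-- The symmetry in `x` and `y` behind the adjointness of the two Macdonald operators. -/
theorem rowAlt_mul_sum_cycPt [NeZero e] {ε : Bool} {t : L} {x y : Box m → L}
    (h1 : ∀ a b : Box m, 1 - x a * y b ≠ 0) (h2 : ∀ a b : Box m, 1 - t * x a * y b ≠ 0)
    (hx0 : ∀ b, x b ≠ 0) (hx : Function.Injective x) (hy0 : ∀ b, y b ≠ 0)
    (hy : Function.Injective y) :
    rowAlt (delta m) y *
      ∑ i, rowAlt (delta m) (cycPt ε t i x) * (cycNum i x y * (cycDen ε t i x y)⁻¹)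
    = rowAlt (delta m) x *
      ∑ i, rowAlt (delta m) (cycPt (!ε) t i y) * (cycNum i y x * (cycDen (!ε) t i y x)⁻¹) := by
  have h3 := sum_rowAlt_cycPt_mul (ε := ε) h1 h2
  have h4 := sum_rowAlt_cycPt_mul (ε := !ε) (t := t) (x := y) (y := x)
    (fun a b => by rw [mul_comm]; exact h1 b a)
    (fun a b => by rw [mul_right_comm]; exact h2 b a)
  rw [boxProd_comm, sum_rowCauchy_cycPt, ← h4] at h3
  have h5 := rowAlt_mul_rowCof (x := x) (y := y) fun k a b => h1 _ _
  refine mul_right_cancel₀ (mul_ne_zero (rowCof_ne_zero hx0 hx) (rowCof_ne_zero hy0 hy)) ?_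
  calc _ = (rowAlt (delta m) y * rowCof x) * ((∑ i, rowAlt (delta m) (cycPt ε t i x) *
          (cycNum i x y * (cycDen ε t i x y)⁻¹)) * rowCof y) := by ring
    _ = _ := by rw [h3, ← h5]; ring

end Cauchy

/-! ### The reproducing kernel and its recurrence -/

section Kernel

variable {e n : ℕ} {m : Fin e → ℕ} {K S : Type*} [Field K] [CommRing S] [Algebra K S]

/-- The twisted power sums at a point. -/
def psumAt {e : ℕ} {m : Fin e → ℕ} {K S : Type*} [Field K] [CommRing S] [Algebra K S] (η : K)
    (x : Box m → S) (a r : ℕ) : S :=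
  ∑ k : Fin e, algebraMap K S (η ^ (a * (k : ℕ))) * ∑ j : Fin (m k), x ⟨k, j⟩ ^ r

/-- The ratio `(1 - z^a q^r) / (1 - z^a t^r)`. -/
def qtRatio {K : Type*} [Field K] (z q t : K) (a r : ℕ) : K :=
  (1 - z ^ a * q ^ r) / (1 - z ^ a * t ^ r)

/-- The product of the `c_i` over a multiset times the number of its automorphisms. -/
def multisetZ {K : Type*} [Field K] (c : ℕ → K) (s : Multiset ℕ) : K :=
  ((∏ i ∈ s.toFinset, (s.count i).factorial : ℕ) : K) * (s.map c).prod

/-- The numbers `z_α(q, t)` in terms of the parts. -/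
def tupleZ {e : ℕ} {K : Type*} [Field K] (z q t : K) (μ : Fin e → Multiset ℕ) : K :=
  ∏ k : Fin e, multisetZ (fun i => e * i * qtRatio z q t k i) (μ k)

/-- The summand `z_α(q, t)⁻¹ p_α(x) p̃_α(y)` of the reproducing kernel. -/
def kerTerm (z q t η : K) (x y : Box m → S) (μ : Fin e → Multiset ℕ) : S :=
  algebraMap K S (tupleZ z q t μ)⁻¹ * (∏ k, ((μ k).map (psumAt η x k)).prod) *
    ∏ k, ((μ k).map (psumAt η⁻¹ y k)).prod

/-- The part of degree `n` of the reproducing kernel. -/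
noncomputable def kerCoeff (z q t η : K) (x y : Box m → S) (n : ℕ) : S :=
  ∑ α : EPartition e n, kerTerm z q t η x y α.parts

/-- The coefficients of the logarithmic derivative of the reproducing kernel. -/
def kerLog (z q t η : K) (x y : Box m → S) (r : ℕ) : S :=
  ∑ k : Fin e, algebraMap K S (e * qtRatio z q t k r)⁻¹ * (psumAt η x k r * psumAt η⁻¹ y k r)

theorem multisetZ_cons (c : ℕ → K) (r : ℕ) (s : Multiset ℕ) :
    multisetZ c (r ::ₘ s) = (s.count r + 1) * c r * multisetZ c s := by
  classical
  unfold multisetZ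
  have h1 : ∀ s' ≤ r ::ₘ s, ∏ i ∈ s'.toFinset, (s'.count i).factorial
      = ∏ i ∈ (r ::ₘ s).toFinset, (s'.count i).factorial := by
    intro s' hs'
    refine Finset.prod_subset (Multiset.toFinset_subset.2 (Multiset.subset_of_le hs'))
      fun i _ hi => ?_
    rw [Multiset.count_eq_zero_of_notMem (by simpa using hi), Nat.factorial_zero]
  rw [h1 s (Multiset.le_cons_self s r), Multiset.map_cons, Multiset.prod_cons,
    ← Finset.mul_prod_erase _ _ (show r ∈ (r ::ₘ s).toFinset by simp),
    ← Finset.mul_prod_erase (r ::ₘ s).toFinset (fun i => (s.count i).factorial)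
      (show r ∈ (r ::ₘ s).toFinset by simp), Multiset.count_cons_self, Nat.factorial_succ]
  rw [Finset.prod_congr rfl fun i hi => by
    rw [Multiset.count_cons_of_ne (Finset.ne_of_mem_erase hi)]]
  push_cast
  ring

theorem prod_update_cons {A : Type*} [CommMonoid A] (g : Fin e → Multiset ℕ → A) (k : Fin e)
    (r : ℕ) (c : A) (ν : Fin e → Multiset ℕ) (h : g k (r ::ₘ ν k) = c * g k (ν k)) :
    ∏ k', g k' (Function.update ν k (r ::ₘ ν k) k') = c * ∏ k', g k' (ν k') := by
  rw [← Finset.mul_prod_erase _ _ (Finset.mem_univ k),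
    ← Finset.mul_prod_erase _ (fun k' => g k' (ν k')) (Finset.mem_univ k), Function.update_self,
    h, mul_assoc]
  congr 2
  refine Finset.prod_congr rfl fun k' hk' => ?_
  rw [Function.update_of_ne (Finset.ne_of_mem_erase hk')]

/-- A new part `r` multiplies `z_α(q,t)` by `r`, the new multiplicity of `r` and `e` times the `q,
t` ratio; the first two factors cancel against the coefficient on the left. -/
theorem kerTerm_update [CharZero K] (z q t η : K) (x y : Box m → S) (k : Fin e) {r : ℕ} (hr : 0 < r)
    (ν : Fin e → Multiset ℕ) :
    ((r * (r ::ₘ ν k).count r : ℕ) : S) *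
        kerTerm z q t η x y (Function.update ν k (r ::ₘ ν k))
      = algebraMap K S (e * qtRatio z q t k r)⁻¹ * (psumAt η x k r * psumAt η⁻¹ y k r)
        * kerTerm z q t η x y ν := by
  unfold kerTerm tupleZ
  rw [prod_update_cons (fun k' s => multisetZ (fun i => e * i * qtRatio z q t k' i) s) k r _ ν
      (multisetZ_cons _ _ _),
    prod_update_cons (fun k' s => (s.map (psumAt η x k')).prod) k r (psumAt η x k r) ν (by simp),
    prod_update_cons (fun k' s => (s.map (psumAt η⁻¹ y k')).prod) k r (psumAt η⁻¹ y k r) ν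
      (by simp)]
  have h : ((r * (r ::ₘ ν k).count r : ℕ) : S) * algebraMap K S
      (((ν k).count r + 1) * (e * r * qtRatio z q t k r) *
        ∏ k' : Fin e, multisetZ (fun i => e * i * qtRatio z q t k' i) (ν k'))⁻¹
      = algebraMap K S (e * qtRatio z q t k r)⁻¹ * algebraMap K S
        (∏ k' : Fin e, multisetZ (fun i => e * i * qtRatio z q t k' i) (ν k'))⁻¹ := by
    rw [← map_natCast (algebraMap K S), ← map_mul, ← map_mul]
    congr 1
    rw [Multiset.count_cons_self]
    have h1 : (r : K) ≠ 0 := Nat.cast_ne_zero.2 hr.ne'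
    have h2 : ((ν k).count r + 1 : K) ≠ 0 := Nat.cast_add_one_ne_zero _
    rw [mul_inv, mul_inv, mul_inv, mul_inv, mul_inv]
    push_cast
    field_simp
  linear_combination (psumAt η x k r * psumAt η⁻¹ y k r *
    (∏ k : Fin e, ((ν k).map (psumAt η x k)).prod) *
      ∏ k : Fin e, ((ν k).map (psumAt η⁻¹ y k)).prod) * h

theorem exists_addPart {r : ℕ} (hr : 0 < r) (hrn : r ≤ n) (k : Fin e) (β : EPartition e (n - r)) :
    ∃ α : EPartition e n, α.parts = Function.update β.parts k (r ::ₘ β.parts k) := by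
  refine EPartition.exists_parts_eq (fun k' a ha => ?_) ?_
  · by_cases hk : k' = k
    · subst hk
      rw [Function.update_self] at ha
      rcases Multiset.mem_cons.1 ha with rfl | ha
      · exact hr
      · exact EPartition.pos_of_mem_parts ha
    · rw [Function.update_of_ne hk] at ha
      exact EPartition.pos_of_mem_parts ha
  · have h := β.sum_parts
    rw [← Finset.add_sum_erase _ _ (Finset.mem_univ k)] at h ⊢
    rw [Function.update_self, Multiset.sum_cons,
      Finset.sum_congr rfl fun k' hk' => by
        rw [Function.update_of_ne (Finset.ne_of_mem_erase hk')]]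
    omega

theorem exists_erasePart {r : ℕ} {k : Fin e} {α : EPartition e n} (h : r ∈ α.parts k) :
    ∃ β : EPartition e (n - r), α.parts = Function.update β.parts k (r ::ₘ β.parts k) := by
  obtain ⟨s, hs⟩ := Multiset.exists_cons_of_mem h
  obtain ⟨β, hβ⟩ := EPartition.exists_parts_eq (e := e) (n := n - r)
    (μ := Function.update α.parts k s) (fun k' a ha => by
      by_cases hk' : k' = k
      · subst hk'
        rw [Function.update_self] at ha
        exact EPartition.pos_of_mem_parts (α := α) (k := k') (hs ▸ Multiset.mem_cons_of_mem ha)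
      · rw [Function.update_of_ne hk'] at ha
        exact EPartition.pos_of_mem_parts ha) (by
      have h1 := α.sum_parts
      rw [← Finset.add_sum_erase _ _ (Finset.mem_univ k)] at h1 ⊢
      rw [hs, Multiset.sum_cons] at h1
      rw [Function.update_self, Finset.sum_congr rfl fun k' hk' => by
        rw [Function.update_of_ne (Finset.ne_of_mem_erase hk')]]
      omega)
  refine ⟨β, ?_⟩
  rw [hβ, Function.update_self, Function.update_idem, ← hs, Function.update_eq_self]

theorem update_cons_injective (k : Fin e) (r : ℕ) :
    Function.Injective fun ν : Fin e → Multiset ℕ => Function.update ν k (r ::ₘ ν k) := by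
  intro ν ν' h
  funext k'
  have h1 := congrFun h k'
  simp only at h1
  by_cases hk : k' = k
  · subst hk
    rwa [Function.update_self, Function.update_self, Multiset.cons_inj_right] at h1
  · rwa [Function.update_of_ne hk, Function.update_of_ne hk] at h1

/-- Only the `α` with a part `r` in row `k` count, and adjoining such a part is a bijection onto
them from the `e`-partitions of `n - r`. -/
theorem sum_count_mul_kerTerm [CharZero K] (z q t η : K) (x y : Box m → S) (k : Fin e) {r : ℕ}
    (hr : 0 < r) (hrn : r ≤ n) :
    ∑ α : EPartition e n, ((r * (α.parts k).count r : ℕ) : S) * kerTerm z q t η x y α.parts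
      = algebraMap K S (e * qtRatio z q t k r)⁻¹ * (psumAt η x k r * psumAt η⁻¹ y k r)
        * kerCoeff z q t η x y (n - r) := by
  classical
  choose A hA using exists_addPart (e := e) hr hrn k
  have hinj : Function.Injective A := fun β β' h =>
    EPartition.parts_injective (update_cons_injective k r
      ((hA β).symm.trans ((congrArg EPartition.parts h).trans (hA β'))))
  rw [kerCoeff, Finset.mul_sum]
  symm
  refine Finset.sum_of_injOn A hinj.injOn (fun _ _ => Finset.mem_coe.2 (Finset.mem_univ _))
    (fun α _ hα => ?_) fun β _ => ?_
  · have h0 : r ∉ α.parts k := by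
      intro h
      obtain ⟨β, hβ⟩ := exists_erasePart h
      refine hα ⟨β, Finset.mem_coe.2 (Finset.mem_univ β), EPartition.parts_injective ?_⟩
      rw [hA, hβ]
    rw [Multiset.count_eq_zero_of_notMem h0, mul_zero, Nat.cast_zero, zero_mul]
  · rw [hA, ← kerTerm_update z q t η x y k hr, Function.update_self]

/-- Weighting each `α` by `n`, the sum of its parts, gives a recurrence of Newton type. It says that
the kernel is an exponential whose logarithmic derivative has the coefficients `kerLog`. -/
theorem natCast_mul_kerCoeff [CharZero K] (z q t η : K) (x y : Box m → S) (n : ℕ) :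
    (n : S) * kerCoeff z q t η x y n
      = ∑ r ∈ Finset.Icc 1 n, kerLog z q t η x y r * kerCoeff z q t η x y (n - r) := by
  classical
  have h1 : ∀ α : EPartition e n,
      n = ∑ r ∈ Finset.Icc 1 n, ∑ k, r * (α.parts k).count r := by
    intro α
    rw [Finset.sum_comm]
    conv_lhs => rw [← α.sum_parts]
    refine Finset.sum_congr rfl fun k _ => ?_
    rw [Finset.sum_multiset_count_of_subset _ (Finset.Icc 1 n) fun a ha => ?_]
    · exact Finset.sum_congr rfl fun r _ => by rw [smul_eq_mul, mul_comm]
    · rw [Multiset.mem_toFinset] at ha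
      refine Finset.mem_Icc.2 ⟨EPartition.pos_of_mem_parts ha, ?_⟩
      refine (Multiset.le_sum_of_mem ha).trans ?_
      conv_rhs => rw [← α.sum_parts]
      exact Finset.single_le_sum (f := fun k => (α.parts k).sum) (fun _ _ => Nat.zero_le _)
        (Finset.mem_univ k)
  conv_lhs => rw [kerCoeff, Finset.mul_sum]
  have h2 : ∀ α : EPartition e n, (n : S) * kerTerm z q t η x y α.parts
      = ∑ r ∈ Finset.Icc 1 n, ∑ k,
        ((r * (α.parts k).count r : ℕ) : S) * kerTerm z q t η x y α.parts := by
    intro α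
    refine (congrArg (fun c : ℕ => (c : S) * kerTerm z q t η x y α.parts) (h1 α)).trans ?_
    rw [Nat.cast_sum, Finset.sum_mul]
    exact Finset.sum_congr rfl fun r _ => by rw [Nat.cast_sum, Finset.sum_mul]
  rw [Finset.sum_congr rfl fun α _ => h2 α, Finset.sum_comm]
  refine Finset.sum_congr rfl fun r hr => ?_
  rw [Finset.sum_comm, kerLog, Finset.sum_mul]
  refine Finset.sum_congr rfl fun k _ => ?_
  exact sum_count_mul_kerTerm z q t η x y k (Finset.mem_Icc.1 hr).1 (Finset.mem_Icc.1 hr).2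

theorem kerCoeff_zero (z q t η : K) (x y : Box m → S) : kerCoeff z q t η x y 0 = 1 := by
  obtain ⟨α, hα⟩ := EPartition.exists_parts_eq (e := e) (n := 0) (μ := fun _ => 0) (by simp)
    (by simp)
  rw [kerCoeff, Finset.sum_eq_single α]
  · simp [kerTerm, tupleZ, multisetZ, hα]
  · intro β _ hβ
    refine absurd (EPartition.parts_injective ?_) hβ
    rw [hα]
    funext k
    have h := β.sum_parts
    rw [Finset.sum_eq_zero_iff] at h
    refine Multiset.eq_zero_of_forall_notMem fun a ha => ?_
    have h1 := EPartition.pos_of_mem_parts ha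
    have h2 := Multiset.le_sum_of_mem ha
    have := h k (Finset.mem_univ k)
    omega
  · simp

/-- The reproducing kernel as a power series in the degree. -/
noncomputable def kerSeries (z q t η : K) (x y : Box m → S) : PowerSeries S :=
  PowerSeries.mk (kerCoeff z q t η x y)

theorem kerSeries_swap (z q t η : K) (x y : Box m → S) :
    kerSeries z q t η⁻¹ y x = kerSeries z q t η x y := by
  unfold kerSeries kerCoeff kerTerm
  simp only [inv_inv]
  congr 1
  funext n
  exact Finset.sum_congr rfl fun α _ => by ring

end Kernel

/-! ### Power series and their logarithmic derivatives -/

section LogDeriv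

variable {S : Type*} [CommRing S]

/-- The logarithmic derivative of `A` is `a`. -/
def HasLogDeriv (A a : PowerSeries S) : Prop := PowerSeries.derivative S A = a * A

theorem HasLogDeriv.mul {A B a b : PowerSeries S} (hA : HasLogDeriv A a) (hB : HasLogDeriv B b) :
    HasLogDeriv (A * B) (a + b) := by
  unfold HasLogDeriv at *
  rw [Derivation.leibniz, hA, hB, smul_eq_mul, smul_eq_mul]
  ring

theorem HasLogDeriv.prod {ι : Type*} (s : Finset ι) (A a : ι → PowerSeries S)
    (h : ∀ i, HasLogDeriv (A i) (a i)) : HasLogDeriv (∏ i ∈ s, A i) (∑ i ∈ s, a i) := by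
  classical
  induction s using Finset.induction_on with
  | empty => simp [HasLogDeriv]
  | insert i s hi ih =>
    rw [Finset.prod_insert hi, Finset.sum_insert hi]
    exact (h i).mul ih

/-- The power series `∑ c^{r + 1} u^r`. -/
noncomputable def geomSeries (c : S) : PowerSeries S := PowerSeries.mk fun r => c ^ (r + 1)

theorem hasLogDeriv_one_sub (c : S) :
    HasLogDeriv (1 - PowerSeries.C c * PowerSeries.X) (-geomSeries c) := by
  unfold HasLogDeriv geomSeries
  have h1 : geomSeries c * (1 - PowerSeries.C c * PowerSeries.X) = PowerSeries.C c := by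
    rw [mul_sub, mul_one, mul_left_comm, ← mul_assoc, mul_comm]
    ext n
    cases n with
    | zero => simp [geomSeries]
    | succ n => simp [geomSeries, pow_succ, mul_comm]
  unfold geomSeries at h1
  rw [neg_mul, h1, map_sub, Derivation.leibniz]
  simp

/-- The equation `A' = a A` determines the coefficients recursively, division by `n + 1` being
possible in characteristic zero. -/
theorem HasLogDeriv.eq [IsDomain S] [CharZero S] {A B a : PowerSeries S} (hA : HasLogDeriv A a)
    (hB : HasLogDeriv B a) (h : PowerSeries.constantCoeff A = PowerSeries.constantCoeff B) :
    A = B := by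
  ext n
  induction n using Nat.strong_induction_on with
  | _ n ih =>
    cases n with
    | zero => simpa using h
    | succ n =>
      have h1 : ∀ {A : PowerSeries S}, HasLogDeriv A a → PowerSeries.coeff (n + 1) A * (n + 1)
          = ∑ p ∈ Finset.HasAntidiagonal.antidiagonal n, PowerSeries.coeff p.1 a * PowerSeries.coeff p.2 A := by
        intro A hA
        rw [← PowerSeries.coeff_derivative, hA, PowerSeries.coeff_mul]
      refine mul_right_cancel₀ (b := (n + 1 : S)) (by exact_mod_cast Nat.succ_ne_zero n) ?_
      rw [h1 hA, h1 hB]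
      refine Finset.sum_congr rfl fun p hp => ?_
      rw [ih p.2 (by have := Finset.HasAntidiagonal.mem_antidiagonal.1 hp; omega)]

end LogDeriv

/-! ### Effect of the shift operators on the kernel -/

section Shift

variable {e n : ℕ} {m : Fin e → ℕ} {K S : Type*} [Field K] [CommRing S] [Algebra K S]

/-- The root of unity belonging to a sign. -/
def signRoot {K : Type*} [Field K] (z : K) (ε : Bool) : K := if ε then z else z⁻¹

theorem pow_val_add_one [NeZero e] {η : K} (h : η ^ e = 1) (a : ℕ) (k : Fin e) :
    η ^ (a * ((k + 1 : Fin e) : ℕ)) = η ^ (a * (k : ℕ)) * η ^ a := by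
  have h1 : ((k + 1 : Fin e) : ℕ) ≡ k + 1 [MOD e] := by
    rw [Fin.val_add]
    refine (Nat.mod_modEq _ _).trans ?_
    exact Nat.ModEq.add_left _ (by rw [Fin.val_one']; exact Nat.mod_modEq _ _)
  have h2 := h1.mul_left a
  rw [← pow_add, ← mul_add_one]
  exact pow_eq_pow_of_modEq h2 h

theorem signRoot_pow_nextRow [NeZero e] {z : K} (hz : z ^ e = 1) (ε : Bool) (a : ℕ) (k : Fin e) :
    signRoot z ε ^ (a * (nextRow ε k : ℕ)) = signRoot z ε ^ (a * (k : ℕ)) * z ^ a := by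
  have hz0 : z ≠ 0 := by
    rintro rfl
    rw [zero_pow (NeZero.ne e)] at hz
    exact zero_ne_one hz
  cases ε with
  | true =>
    simp only [signRoot, nextRow, if_true]
    exact pow_val_add_one hz a k
  | false =>
    simp only [signRoot, nextRow, Bool.false_eq_true, if_false]
    have h := pow_val_add_one (η := z⁻¹) (by rw [inv_pow, hz, inv_one]) a (k - 1)
    rw [sub_add_cancel] at h
    rw [h, mul_assoc, ← mul_pow, inv_mul_cancel₀ hz0, one_pow, mul_one]

theorem sum_cycPt_pow [NeZero e] {A : Type*} [CommRing A] (ε : Bool) (u : A) (i : ColIdx m) (x : Box m → A)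
    (k : Fin e) (r : ℕ) :
    ∑ j, cycPt ε u i x ⟨k, j⟩ ^ r
      = ∑ j, x ⟨k, j⟩ ^ r + (u ^ r * x ⟨prevRow ε k, i (prevRow ε k)⟩ ^ r - x ⟨k, i k⟩ ^ r) := by
  rw [← Finset.add_sum_erase _ _ (Finset.mem_univ (i k)),
    ← Finset.add_sum_erase _ (fun j => x ⟨k, j⟩ ^ r) (Finset.mem_univ (i k)),
    Finset.sum_congr rfl fun j hj => show cycPt ε u i x ⟨k, j⟩ ^ r = x ⟨k, j⟩ ^ r by
      simp [cycPt, Finset.ne_of_mem_erase hj]]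
  simp only [cycPt, if_true, mul_pow]
  ring

theorem sum_prevRow [NeZero e] {A : Type*} [AddCommMonoid A] (ε : Bool) (f : Fin e → A) :
    ∑ k, f (prevRow ε k) = ∑ k, f k :=
  Equiv.sum_comp (rowShift ε) f

/-- The selected variables lose their old powers and regain them one row further with a factor `u ^
r`. The twist turns the change of row into `z ^ a`, which needs `z` or `z⁻¹` according to the sign.
-/
theorem psumAt_cycPt [NeZero e] {z : K} (hz : z ^ e = 1) (ε : Bool) (u : K) (i : ColIdx m) (x : Box m → S)
    (a r : ℕ) :
    psumAt (signRoot z ε) (cycPt ε (algebraMap K S u) i x) a r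
      = psumAt (signRoot z ε) x a r - algebraMap K S (1 - z ^ a * u ^ r) *
        ∑ k : Fin e, algebraMap K S (signRoot z ε ^ (a * (k : ℕ))) * x ⟨k, i k⟩ ^ r := by
  unfold psumAt
  simp only [sum_cycPt_pow, mul_add, mul_sub, Finset.sum_add_distrib, Finset.sum_sub_distrib]
  have h : ∑ k : Fin e, algebraMap K S (signRoot z ε ^ (a * (k : ℕ))) *
      (algebraMap K S u ^ r * x ⟨prevRow ε k, i (prevRow ε k)⟩ ^ r)
      = ∑ k : Fin e, algebraMap K S (z ^ a * u ^ r) *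
        (algebraMap K S (signRoot z ε ^ (a * (k : ℕ))) * x ⟨k, i k⟩ ^ r) := by
    refine Eq.trans ?_ (sum_prevRow ε _)
    refine Finset.sum_congr rfl fun k _ => ?_
    have h1 := signRoot_pow_nextRow hz ε a (prevRow ε k)
    rw [nextRow_prevRow] at h1
    rw [h1]
    simp only [map_mul, map_pow]
    ring
  rw [h, ← Finset.mul_sum, map_sub, map_one]
  ring

theorem sum_root_pow {z : K} (hz : IsPrimitiveRoot z e) (ε : Bool) (k k' : Fin e) :
    ∑ a : Fin e, signRoot z ε ^ ((a : ℕ) * k) * (signRoot z ε)⁻¹ ^ ((a : ℕ) * k')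
      = if k = k' then (e : K) else 0 := by
  have h : IsPrimitiveRoot (signRoot z ε) e := by
    cases ε
    · exact hz.inv
    · exact hz
  rw [← h.sum_pow_mul_inv k k']
  simp only [inv_pow]

theorem sum_shifted_root_pow [NeZero e] [CharZero K] {z : K} (hz : IsPrimitiveRoot z e) (ε : Bool) (c : K)
    (k k' : Fin e) :
    ∑ a : Fin e, (e : K)⁻¹ * (1 - z ^ (a : ℕ) * c) * (signRoot z ε ^ ((a : ℕ) * k) *
        (signRoot z ε)⁻¹ ^ ((a : ℕ) * k'))
      = (if k = k' then 1 else 0) - c * if nextRow ε k = k' then 1 else 0 := by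
  have he : (e : K) ≠ 0 := Nat.cast_ne_zero.2 (NeZero.ne e)
  have h1 := congrArg ((e : K)⁻¹ * ·) (sum_root_pow hz ε k k')
  have h2 := congrArg ((e : K)⁻¹ * c * ·) (sum_root_pow hz ε (nextRow ε k) k')
  simp only [Finset.mul_sum, mul_ite, mul_zero, inv_mul_cancel₀ he] at h1 h2
  rw [mul_right_comm, inv_mul_cancel₀ he, one_mul] at h2
  rw [mul_ite, mul_one, mul_zero, ← h1, ← h2, ← Finset.sum_sub_distrib]
  refine Finset.sum_congr rfl fun a _ => ?_
  rw [signRoot_pow_nextRow hz.pow_eq_one]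
  ring

/-- The factor `1 - z^a q^r` from the shift cancels the denominator in `kerLog`, leaving `(1 - z^a
t^r) / e`. Summation over `a` is a Fourier inversion: the `1` pairs row `k` of `x` with row `k` of
`y`, and `z^a t^r` pairs it with the next row. -/
theorem kerLog_cycPt [NeZero e] [CharZero K] {z q t : K} (hz : IsPrimitiveRoot z e)
    (hq : ∀ a r, 0 < r → 1 - z ^ a * q ^ r ≠ 0) (ε : Bool) (i : ColIdx m) (x y : Box m → S)
    {r : ℕ} (hr : 0 < r) :
    kerLog z q t (signRoot z ε) (cycPt ε (algebraMap K S q) i x) y r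
      + ∑ k, ∑ j : Fin (m k), (x ⟨k, i k⟩ * y ⟨k, j⟩) ^ r
    = kerLog z q t (signRoot z ε) x y r + ∑ k, ∑ j : Fin (m k),
        (algebraMap K S t * x ⟨prevRow ε k, i (prevRow ε k)⟩ * y ⟨k, j⟩) ^ r := by
  set η := signRoot z ε with hη
  have h1 : ∀ a : Fin e, algebraMap K S (e * qtRatio z q t a r)⁻¹ *
      (algebraMap K S (1 - z ^ (a : ℕ) * q ^ r) *
        (∑ k : Fin e, algebraMap K S (η ^ ((a : ℕ) * (k : ℕ))) * x ⟨k, i k⟩ ^ r) * psumAt η⁻¹ y a r)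
      = ∑ k : Fin e, ∑ k' : Fin e, algebraMap K S ((e : K)⁻¹ * (1 - z ^ (a : ℕ) * t ^ r) *
        (η ^ ((a : ℕ) * k) * η⁻¹ ^ ((a : ℕ) * k'))) *
          (x ⟨k, i k⟩ ^ r * ∑ j, y ⟨k', j⟩ ^ r) := by
    intro a
    have h2 : (e * qtRatio z q t a r)⁻¹ * (1 - z ^ (a : ℕ) * q ^ r)
        = (e : K)⁻¹ * (1 - z ^ (a : ℕ) * t ^ r) := by
      rw [qtRatio, mul_inv, inv_div, mul_assoc, div_mul_cancel₀ _ (hq a r hr)]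
    rw [← mul_assoc, ← mul_assoc, ← map_mul, h2, psumAt, mul_assoc, Finset.sum_mul_sum,
      Finset.mul_sum]
    refine Finset.sum_congr rfl fun k _ => ?_
    rw [Finset.mul_sum]
    refine Finset.sum_congr rfl fun k' _ => ?_
    simp only [map_mul]
    ring
  have h3 : ∑ a : Fin e, algebraMap K S (e * qtRatio z q t a r)⁻¹ *
      (algebraMap K S (1 - z ^ (a : ℕ) * q ^ r) *
        (∑ k : Fin e, algebraMap K S (η ^ ((a : ℕ) * (k : ℕ))) * x ⟨k, i k⟩ ^ r) * psumAt η⁻¹ y a r)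
      = ∑ k, x ⟨k, i k⟩ ^ r * ∑ j, y ⟨k, j⟩ ^ r
        - ∑ k, algebraMap K S (t ^ r) * (x ⟨k, i k⟩ ^ r * ∑ j, y ⟨nextRow ε k, j⟩ ^ r) := by
    rw [Finset.sum_congr rfl fun a _ => h1 a, Finset.sum_comm, ← Finset.sum_sub_distrib]
    refine Finset.sum_congr rfl fun k _ => ?_
    rw [Finset.sum_comm]
    have h4 : ∀ k' : Fin e, ∑ a : Fin e, algebraMap K S ((e : K)⁻¹ * (1 - z ^ (a : ℕ) * t ^ r) *
        (η ^ ((a : ℕ) * k) * η⁻¹ ^ ((a : ℕ) * k'))) * (x ⟨k, i k⟩ ^ r * ∑ j, y ⟨k', j⟩ ^ r)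
        = (if k = k' then x ⟨k, i k⟩ ^ r * ∑ j, y ⟨k', j⟩ ^ r else 0)
          - if nextRow ε k = k' then algebraMap K S (t ^ r) *
            (x ⟨k, i k⟩ ^ r * ∑ j, y ⟨k', j⟩ ^ r) else 0 := by
      intro k'
      rw [← Finset.sum_mul, ← map_sum, hη, sum_shifted_root_pow hz, map_sub, map_mul, sub_mul]
      split_ifs <;> simp
    rw [Finset.sum_congr rfl fun k' _ => h4 k', Finset.sum_sub_distrib, Finset.sum_ite_eq,
      Finset.sum_ite_eq, if_pos (Finset.mem_univ _), if_pos (Finset.mem_univ _)]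
  have h5 : kerLog z q t η (cycPt ε (algebraMap K S q) i x) y r
      = kerLog z q t η x y r - ∑ a : Fin e, algebraMap K S (e * qtRatio z q t a r)⁻¹ *
      (algebraMap K S (1 - z ^ (a : ℕ) * q ^ r) *
        (∑ k : Fin e, algebraMap K S (η ^ ((a : ℕ) * (k : ℕ))) * x ⟨k, i k⟩ ^ r) * psumAt η⁻¹ y a r) := by
    unfold kerLog
    rw [← Finset.sum_sub_distrib]
    refine Finset.sum_congr rfl fun a _ => ?_
    rw [hη, psumAt_cycPt hz.pow_eq_one]
    ring
  have h6 : ∑ k, ∑ j : Fin (m k), (x ⟨k, i k⟩ * y ⟨k, j⟩) ^ r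
      = ∑ k, x ⟨k, i k⟩ ^ r * ∑ j, y ⟨k, j⟩ ^ r := by
    simp only [mul_pow, Finset.mul_sum]
  have h7 : ∑ k, ∑ j : Fin (m k),
        (algebraMap K S t * x ⟨prevRow ε k, i (prevRow ε k)⟩ * y ⟨k, j⟩) ^ r
      = ∑ k, algebraMap K S (t ^ r) * (x ⟨k, i k⟩ ^ r * ∑ j, y ⟨nextRow ε k, j⟩ ^ r) := by
    refine Eq.trans ?_ (sum_prevRow ε _)
    refine Finset.sum_congr rfl fun k _ => ?_
    rw [nextRow_prevRow]
    simp only [mul_pow, map_pow, Finset.mul_sum, mul_assoc]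
  rw [h5, h6, h7, h3]
  ring

/-- The power sums in `kerLog_cycPt` are the logarithmic derivatives of products of linear factors.
Both sides therefore have the same logarithmic derivative, and both have constant term one. -/
theorem kerSeries_cycPt [NeZero e] [IsDomain S] [CharZero S] [CharZero K] {z q t : K}
    (hz : IsPrimitiveRoot z e) (hq : ∀ a r, 0 < r → 1 - z ^ a * q ^ r ≠ 0) (ε : Bool)
    (i : ColIdx m) (x y : Box m → S) :
    kerSeries z q t (signRoot z ε) (cycPt ε (algebraMap K S q) i x) y *
      cycDen ε (PowerSeries.C (algebraMap K S t)) i (fun b => PowerSeries.C (x b) * PowerSeries.X)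
        (fun b => PowerSeries.C (y b))
    = kerSeries z q t (signRoot z ε) x y *
      cycNum i (fun b => PowerSeries.C (x b) * PowerSeries.X) (fun b => PowerSeries.C (y b)) := by
  set η := signRoot z ε
  have hker : ∀ x : Box m → S, HasLogDeriv (kerSeries z q t η x y)
      (PowerSeries.mk fun r => kerLog z q t η x y (r + 1)) := by
    intro x
    unfold HasLogDeriv kerSeries
    ext n
    rw [PowerSeries.coeff_derivative, PowerSeries.coeff_mk, mul_comm, ← Nat.cast_add_one,
      natCast_mul_kerCoeff, PowerSeries.coeff_mul,
      Finset.Nat.sum_antidiagonal_eq_sum_range_succ_mk]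
    rw [← Finset.Ico_add_one_right_eq_Icc, Finset.sum_Ico_eq_sum_range]
    refine Finset.sum_congr rfl fun r _ => ?_
    rw [PowerSeries.coeff_mk, PowerSeries.coeff_mk, add_comm 1 r, Nat.add_sub_add_right]
  have hfac : ∀ c d : S, HasLogDeriv (1 - PowerSeries.C c * PowerSeries.X * PowerSeries.C d)
      (-geomSeries (c * d)) := by
    intro c d
    have := hasLogDeriv_one_sub (c * d)
    rwa [map_mul, mul_right_comm] at this
  have hfac' : ∀ c c' d : S, HasLogDeriv (1 - PowerSeries.C c' * (PowerSeries.C c * PowerSeries.X) *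
      PowerSeries.C d) (-geomSeries (c' * c * d)) := by
    intro c c' d
    have := hfac (c' * c) d
    rwa [map_mul, mul_assoc (PowerSeries.C c')] at this
  have hnum := HasLogDeriv.prod (Finset.univ : Finset (Fin e)) _ _ fun k =>
    HasLogDeriv.prod (Finset.univ : Finset (Fin (m k))) _ _ fun j => hfac (x ⟨k, i k⟩) (y ⟨k, j⟩)
  have hden := HasLogDeriv.prod (Finset.univ : Finset (Fin e)) _ _ fun k =>
    HasLogDeriv.prod (Finset.univ : Finset (Fin (m k))) _ _ fun j =>
      hfac' (x ⟨prevRow ε k, i (prevRow ε k)⟩) (algebraMap K S t) (y ⟨k, j⟩)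
  have hL := (hker (cycPt ε (algebraMap K S q) i x)).mul hden
  have hR := (hker x).mul hnum
  refine HasLogDeriv.eq hL ?_ ?_
  · have hlog : (PowerSeries.mk fun r =>
          kerLog z q t η (cycPt ε (algebraMap K S q) i x) y (r + 1)) +
        ∑ k, ∑ j : Fin (m k), -geomSeries (algebraMap K S t *
          x ⟨prevRow ε k, i (prevRow ε k)⟩ * y ⟨k, j⟩)
        = (PowerSeries.mk fun r => kerLog z q t η x y (r + 1)) +
          ∑ k, ∑ j : Fin (m k), -geomSeries (x ⟨k, i k⟩ * y ⟨k, j⟩) := by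
      ext r
      have := kerLog_cycPt (S := S) (t := t) hz hq ε i x y (Nat.succ_pos r)
      simp only [map_add, map_sum, map_neg, PowerSeries.coeff_mk, geomSeries,
        Finset.sum_neg_distrib]
      linear_combination this
    rw [hlog]
    exact hR
  · simp [cycDen, cycNum, kerSeries, kerCoeff_zero]

end Shift

/-! ### Symmetry of the kernel under the Macdonald operators -/

section KernelSymmetry

variable {e n : ℕ} {m : Fin e → ℕ} {K S : Type*} [Field K] [CommRing S] [Algebra K S]

theorem map_rowAlt {A B : Type*} [CommRing A] [CommRing B] (f : A →+* B) (β : Box m → ℕ)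
    (x : Box m → A) : f (rowAlt β x) = rowAlt β fun b => f (x b) := by
  unfold rowAlt
  rw [map_prod]
  refine Finset.prod_congr rfl fun k _ => ?_
  rw [RingHom.map_det]
  congr 1
  ext i j
  simp

theorem rowAlt_mul_const {A : Type*} [CommRing A] (β : Box m → ℕ) (x : Box m → A) (c : A) :
    rowAlt β (fun b => x b * c) = c ^ (∑ b, β b) * rowAlt β x := by
  unfold rowAlt
  rw [Fintype.sum_sigma, ← Finset.prod_pow_eq_pow_sum, ← Finset.prod_mul_distrib]
  refine Finset.prod_congr rfl fun k _ => ?_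
  rw [← Finset.prod_pow_eq_pow_sum, ← Matrix.det_mul_row]
  congr 1
  ext i j
  simp [mul_pow, mul_comm]

theorem map_cycPt [NeZero e] {A B : Type*} [CommRing A] [CommRing B] (f : A →+* B) (ε : Bool) (u : A)
    (i : ColIdx m) (x : Box m → A) (b : Box m) :
    f (cycPt ε u i x b) = cycPt ε (f u) i (fun b => f (x b)) b := by
  unfold cycPt
  split_ifs <;> simp

theorem cycPt_mul_const [NeZero e] {A : Type*} [CommRing A] (ε : Bool) (u : A)
    (i : ColIdx m) (x : Box m → A) (c : A) (b : Box m) :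
    cycPt ε u i (fun b => x b * c) b = cycPt ε u i x b * c := by
  unfold cycPt
  split_ifs
  · ring
  · rfl

theorem map_cycNum {A B : Type*} [CommRing A] [CommRing B] (f : A →+* B) (i : ColIdx m)
    (x y : Box m → A) : f (cycNum i x y) = cycNum i (fun b => f (x b)) fun b => f (y b) := by
  simp [cycNum]

theorem map_cycDen [NeZero e] {A B : Type*} [CommRing A] [CommRing B] (f : A →+* B) (ε : Bool) (t : A)
    (i : ColIdx m) (x y : Box m → A) :
    f (cycDen ε t i x y) = cycDen ε (f t) i (fun b => f (x b)) fun b => f (y b) := by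
  simp [cycDen]

theorem cycNum_move {A : Type*} [CommRing A] (i : ColIdx m) (x y : Box m → A) (c : A) :
    cycNum i (fun b => x b * c) y = cycNum i x fun b => y b * c := by
  unfold cycNum
  exact Finset.prod_congr rfl fun k _ => Finset.prod_congr rfl fun j _ => by ring

theorem cycDen_move [NeZero e] {A : Type*} [CommRing A] (ε : Bool) (t : A) (i : ColIdx m) (x y : Box m → A)
    (c : A) : cycDen ε t i (fun b => x b * c) y = cycDen ε t i x fun b => y b * c := by
  unfold cycDen
  exact Finset.prod_congr rfl fun k _ => Finset.prod_congr rfl fun j _ => by ring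

theorem signRoot_not (z : K) (ε : Bool) : signRoot z (!ε) = (signRoot z ε)⁻¹ := by
  cases ε <;> simp [signRoot]

/-- The adjointness of the two Macdonald operators, for the reproducing kernel. -/
theorem rowAlt_mul_sum_kerSeries [NeZero e] [IsDomain S] [CharZero S] [CharZero K] {z q t : K}
    (hz : IsPrimitiveRoot z e) (hq : ∀ a r, 0 < r → 1 - z ^ a * q ^ r ≠ 0) (ε : Bool)
    {x y : Box m → S} (hx0 : ∀ b, x b ≠ 0) (hx : Function.Injective x) (hy0 : ∀ b, y b ≠ 0)
    (hy : Function.Injective y) :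
    PowerSeries.C (rowAlt (delta m) y) *
      ∑ i, PowerSeries.C (rowAlt (delta m) (cycPt ε (algebraMap K S t) i x)) *
        kerSeries z q t (signRoot z ε) (cycPt ε (algebraMap K S q) i x) y
    = PowerSeries.C (rowAlt (delta m) x) *
      ∑ i, PowerSeries.C (rowAlt (delta m) (cycPt (!ε) (algebraMap K S t) i y)) *
        kerSeries z q t (signRoot z ε) x (cycPt (!ε) (algebraMap K S q) i y) := by
  obtain ⟨L, _, φ, hφ⟩ : ∃ (L : Type _) (_ : Field L) (φ : PowerSeries S →+* L),
      Function.Injective φ :=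
    ⟨FractionRing (PowerSeries S), inferInstance, algebraMap _ _, IsFractionRing.injective _ _⟩
  -- The series variable is absorbed into `x`. Then all `1 - x' y'` and `1 - t' x' y'` have constant
  -- term one and are nonzero in the fraction field, as the Cauchy identity requires.
  let x' : Box m → L := fun b => φ (PowerSeries.C (x b) * PowerSeries.X)
  let y' : Box m → L := fun b => φ (PowerSeries.C (y b))
  let t' : L := φ (PowerSeries.C (algebraMap K S t))
  let u : L := φ PowerSeries.X
  have hu : u ≠ 0 := fun h => PowerSeries.X_ne_zero (hφ (h.trans (map_zero φ).symm))
  have hC : Function.Injective (fun a : S => φ (PowerSeries.C a)) :=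
    hφ.comp PowerSeries.C_injective
  have hne : ∀ c d : S, φ (1 - PowerSeries.C c * PowerSeries.X * PowerSeries.C d) ≠ 0 := by
    intro c d h
    have := congrArg PowerSeries.constantCoeff (hφ (h.trans (map_zero φ).symm))
    simp at this
  have h1 : ∀ a b : Box m, 1 - x' a * y' b ≠ 0 := by
    intro a b
    have := hne (x a) (y b)
    rwa [map_sub, map_one, map_mul] at this
  have h2 : ∀ a b : Box m, 1 - t' * x' a * y' b ≠ 0 := by
    intro a b
    have := hne (algebraMap K S t * x a) (y b)
    rw [map_mul, mul_assoc (PowerSeries.C _)] at this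
    rwa [map_sub, map_one, map_mul, map_mul] at this
  have hx'0 : ∀ b, x' b ≠ 0 := fun b h => by
    rw [show x' b = φ (PowerSeries.C (x b)) * u from map_mul _ _ _] at h
    exact hx0 b (hC (((mul_eq_zero.1 h).resolve_right hu).trans (by simp)))
  have hy'0 : ∀ b, y' b ≠ 0 := fun b h => hy0 b (hC (h.trans (by simp)))
  have hx' : Function.Injective x' := fun a b h => by
    refine hx (hC (mul_right_cancel₀ hu ?_))
    simpa only [x', map_mul] using h
  have hy' : Function.Injective y' := fun a b h => hy (hC h)
  have key := rowAlt_mul_sum_cycPt (ε := ε) h1 h2 hx'0 hx' hy'0 hy'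
  have hD1 : ∀ i, cycDen ε t' i x' y' ≠ 0 := fun i =>
    Finset.prod_ne_zero_iff.2 fun k _ => Finset.prod_ne_zero_iff.2 fun j _ => h2 _ _
  have hD2 : ∀ i, cycDen (!ε) t' i y' x' ≠ 0 := fun i =>
    Finset.prod_ne_zero_iff.2 fun k _ => Finset.prod_ne_zero_iff.2 fun j _ => by
      rw [mul_right_comm]; exact h2 _ _
  have hk1 : ∀ i, φ (kerSeries z q t (signRoot z ε) (cycPt ε (algebraMap K S q) i x) y)
      = φ (kerSeries z q t (signRoot z ε) x y) * (cycNum i x' y' * (cycDen ε t' i x' y')⁻¹) := by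
    intro i
    have h := congrArg φ (kerSeries_cycPt (t := t) hz hq ε i x y)
    rw [map_mul, map_mul, map_cycNum, map_cycDen] at h
    rw [← mul_assoc, eq_mul_inv_iff_mul_eq₀ (hD1 i)]
    exact h
  have hk2 : ∀ i, φ (kerSeries z q t (signRoot z ε) x (cycPt (!ε) (algebraMap K S q) i y))
      = φ (kerSeries z q t (signRoot z ε) x y) *
        (cycNum i y' x' * (cycDen (!ε) t' i y' x')⁻¹) := by
    intro i
    have h := congrArg φ (kerSeries_cycPt (t := t) hz hq (!ε) i y x)
    rw [signRoot_not, kerSeries_swap, kerSeries_swap, cycNum_move, cycDen_move, map_mul, map_mul,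
      map_cycNum, map_cycDen] at h
    rw [← mul_assoc, eq_mul_inv_iff_mul_eq₀ (hD2 i)]
    exact h
  have ha1 : ∀ i, rowAlt (delta m) (cycPt ε t' i x')
      = u ^ (∑ b, delta m b) * φ (PowerSeries.C (rowAlt (delta m)
        (cycPt ε (algebraMap K S t) i x))) := by
    intro i
    have : cycPt ε t' i x' = fun b => φ (PowerSeries.C (cycPt ε (algebraMap K S t) i x b)) * u := by
      funext b
      rw [map_cycPt, map_cycPt, ← cycPt_mul_const]
      simp only [x', map_mul]
      rfl
    rw [this, rowAlt_mul_const, map_rowAlt, map_rowAlt]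
  have ha2 : ∀ i, rowAlt (delta m) (cycPt (!ε) t' i y')
      = φ (PowerSeries.C (rowAlt (delta m) (cycPt (!ε) (algebraMap K S t) i y))) := by
    intro i
    rw [map_rowAlt, map_rowAlt]
    congr 1
    funext b
    rw [map_cycPt, map_cycPt]
  have ha3 : rowAlt (delta m) x'
      = u ^ (∑ b, delta m b) * φ (PowerSeries.C (rowAlt (delta m) x)) := by
    rw [map_rowAlt, map_rowAlt, ← rowAlt_mul_const]
    simp only [x', map_mul]
    rfl
  have ha4 : rowAlt (delta m) y' = φ (PowerSeries.C (rowAlt (delta m) y)) := by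
    rw [map_rowAlt, map_rowAlt]
  -- Rescaling `x` multiplies every alternant in `x` by this power of the series variable, which is
  -- common to both sides.
  refine hφ (mul_left_cancel₀ (pow_ne_zero (∑ b, delta m b) hu) ?_)
  simp only [map_mul, map_sum, hk1, hk2]
  simp only [ha1, ha2, ha3, ha4] at key
  have h5 := congrArg (φ (kerSeries z q t (signRoot z ε) x y) * ·) key
  simp only [Finset.mul_sum] at h5 ⊢
  refine Eq.trans (Finset.sum_congr rfl fun i _ => ?_)
    (h5.trans (Finset.sum_congr rfl fun i _ => ?_))
  · ring
  · ring

theorem rowAlt_mul_sum_kerCoeff [NeZero e] [IsDomain S] [CharZero S] [CharZero K] {z q t : K}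
    (hz : IsPrimitiveRoot z e) (hq : ∀ a r, 0 < r → 1 - z ^ a * q ^ r ≠ 0) (ε : Bool)
    {x y : Box m → S} (hx0 : ∀ b, x b ≠ 0) (hx : Function.Injective x) (hy0 : ∀ b, y b ≠ 0)
    (hy : Function.Injective y) (n : ℕ) :
    rowAlt (delta m) y *
      ∑ i, rowAlt (delta m) (cycPt ε (algebraMap K S t) i x) *
        kerCoeff z q t (signRoot z ε) (cycPt ε (algebraMap K S q) i x) y n
    = rowAlt (delta m) x *
      ∑ i, rowAlt (delta m) (cycPt (!ε) (algebraMap K S t) i y) *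
        kerCoeff z q t (signRoot z ε) x (cycPt (!ε) (algebraMap K S q) i y) n := by
  have h := congrArg (PowerSeries.coeff n)
    (rowAlt_mul_sum_kerSeries (t := t) hz hq ε hx0 hx hy0 hy)
  simpa only [PowerSeries.coeff_C_mul, map_sum, kerSeries, PowerSeries.coeff_mk] using h

end KernelSymmetry

/-! ### Independence of products in disjoint variables -/

section TensorIndependence

/-- Viewed as polynomials in the first variables over the ring of the second, the relation gives one
relation among the `g k` for each monomial; the resulting coefficients then form a relation among
the `f i`. -/
theorem eq_zero_of_sum_rename_mul_rename {K ι κ σ τ : Type*} [Field K] [Fintype ι] [Fintype κ]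
    {f : ι → MvPolynomial σ K} {g : κ → MvPolynomial τ K} (hf : LinearIndependent K f)
    (hg : LinearIndependent K g) (c : ι → κ → K)
    (h : ∑ i, ∑ k, c i k • (rename Sum.inl (f i) * rename Sum.inr (g k) : MvPolynomial (σ ⊕ τ) K)
      = 0) (i : ι) (k : κ) : c i k = 0 := by
  have hinl : ∀ p : MvPolynomial σ K, sumRingEquiv K σ τ (rename Sum.inl p) = map C p := by
    intro p
    induction p using MvPolynomial.induction_on with
    | C a => simp [sumRingEquiv_C]
    | add p q hp hq => simp [hp, hq]
    | mul_X p b hp => simp [hp, sumRingEquiv_X_inl]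
  have hinr : ∀ p : MvPolynomial τ K, sumRingEquiv K σ τ (rename Sum.inr p) = C p := by
    intro p
    induction p using MvPolynomial.induction_on with
    | C a => simp [sumRingEquiv_C]
    | add p q hp hq => simp [hp, hq]
    | mul_X p b hp => simp [hp, sumRingEquiv_X_inr]
  have h1 := congrArg (sumRingEquiv K σ τ) h
  simp only [map_sum, smul_eq_C_mul, map_mul, map_zero, hinl, hinr, sumRingEquiv_C] at h1
  have h2 : ∀ a, ∑ k, (∑ i, c i k * coeff a (f i)) • g k = 0 := by
    intro a
    have h3 := congrArg (coeff a) h1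
    simp only [coeff_sum, coeff_C_mul, coeff_zero, mul_comm _ (C (g _)), coeff_map] at h3
    rw [Finset.sum_comm] at h3
    refine Eq.trans (Finset.sum_congr rfl fun k _ => ?_) h3
    rw [smul_eq_C_mul, map_sum, Finset.sum_mul]
    exact Finset.sum_congr rfl fun i _ => by
      rw [map_mul]
      ring
  have h4 : ∀ a, ∑ i, c i k * coeff a (f i) = 0 := fun a =>
    Fintype.linearIndependent_iff.1 hg _ (h2 a) k
  refine Fintype.linearIndependent_iff.1 hf (fun i => c i k) ?_ i
  ext a
  rw [coeff_sum, coeff_zero, ← h4 a]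
  exact Finset.sum_congr rfl fun i _ => by rw [coeff_smul, smul_eq_mul]

end TensorIndependence

/-! ### Conjugation of coefficients -/

section Conj

variable {e n : ℕ} {m : Fin e → ℕ} {ζ : ℂ}

/-- Conjugation of the coefficients of a polynomial. -/
noncomputable def conjPoly (m : Fin e → ℕ) : PolyF m →+* PolyF m := map (conjF : Fqt →+* Fqt)

theorem conjF_cHom (z : ℂ) : conjF (cHom z) = cHom (starRingEnd ℂ z) := by
  rw [cHom, RingHom.comp_apply, conjF_algebraMap, map_C, RingHom.comp_apply]

theorem conjF_qF : conjF qF = qF := by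
  rw [qF, conjF_algebraMap, map_X]

theorem conjF_tF : conjF tF = tF := by
  rw [tF, conjF_algebraMap, map_X]

theorem conjPoly_alternant (β : Box m → ℕ) : conjPoly m (alternant β) = alternant β := by
  rw [alternant_eq_rowAlt, map_rowAlt]
  simp [conjPoly]

theorem conj_eq_inv (hζ : IsPrimitiveRoot ζ e) [NeZero e] : starRingEnd ℂ ζ = ζ⁻¹ :=
  (Complex.inv_eq_conj (hζ.norm'_eq_one (NeZero.ne e))).symm

/-- Conjugation inverts `ζ`, so the kernel built with `ζ` in `x` and `ζ⁻¹` in `y` is the one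
belonging to the sesquilinear form. -/
theorem conjPoly_powerPoly [NeZero e] (hζ : IsPrimitiveRoot ζ e) (α : EPartition e n) :
    conjPoly m (powerPoly ζ m α) = powerPoly ζ⁻¹ m α := by
  simp only [powerPoly, map_prod, map_list_prod, List.map_map]
  refine Finset.prod_congr rfl fun k _ => ?_
  congr 2
  funext r
  simp only [Function.comp_apply, twistedPsum, conjPoly, map_sum, map_mul, map_pow, map_C, map_X,
    cF_eq]
  refine Finset.sum_congr rfl fun j _ => ?_
  rw [show ((conjF : Fqt →+* Fqt) (cHom ζ)) = cHom ζ⁻¹ from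
    (conjF_cHom ζ).trans (congrArg cHom (conj_eq_inv hζ))]

theorem conjPoly_opT [NeZero e] (ε : Bool) {u : Fqt} (hu : conjF u = u) (i : ColIdx m) (f : PolyF m) :
    conjPoly m (opT ε u i f) = opT ε u i (conjPoly m f) := by
  unfold conjPoly opT
  induction f using MvPolynomial.induction_on with
  | C a => rw [map_C, algHom_C, algHom_C, algebraMap_eq, map_C]
  | add p q hp hq => rw [map_add, map_add, map_add, map_add, hp, hq]
  | mul_X p b hp =>
    rw [map_mul, map_mul, map_mul, map_mul, hp, map_X, aeval_X]
    congr 1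
    split_ifs
    · rw [map_mul, map_C, map_X]
      congr 2
    · rw [map_X]

theorem IsRowSymm.conjPoly {f : PolyF m} (hf : IsRowSymm f) : IsRowSymm (conjPoly m f) := by
  intro w
  unfold _root_.conjPoly
  rw [← map_rename, hf w]

theorem conjPoly_opD [NeZero e] (ε : Bool) {f : PolyF m} (hf : IsRowSymm f) :
    conjPoly m (opD m ε f) = opD m ε (conjPoly m f) := by
  refine (opD_unique ε hf.conjPoly ?_).symm
  rw [← conjPoly_alternant, ← map_mul, alternant_mul_opD ε hf]
  unfold opNum
  rw [map_sum]
  refine Finset.sum_congr rfl fun i _ => ?_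
  rw [map_mul, conjPoly_opT ε conjF_tF, conjPoly_opT ε conjF_qF, conjPoly_alternant]

/-- The selected entries of `δ` agree along the cycle of rows in one direction exactly when they
agree in the other. -/
theorem normConst_not [NeZero e] (ε : Bool) : normConst m (!ε) = normConst m ε := by
  unfold normConst
  refine Finset.sum_congr (Finset.filter_congr fun i _ => ?_) fun _ _ => rfl
  rw [cycMat_delta_iff, cycMat_delta_iff]
  have h : ∀ (d : Fin e → ℕ) (ε : Bool), (∀ k, d k = d (prevRow ε k)) →
      ∀ k, d k = d (prevRow (!ε) k) := by
    intro d ε hd k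
    have h1 := hd (nextRow ε k)
    rw [prevRow_nextRow] at h1
    rw [← h1]
    cases ε <;> rfl
  exact ⟨fun hd => Bool.not_not ε ▸ h (fun k => delta m ⟨k, i k⟩) (!ε) hd,
    h (fun k => delta m ⟨k, i k⟩) ε⟩

theorem conjF_normConst [NeZero e] (ε : Bool) : conjF (normConst m ε) = normConst m ε := by
  unfold normConst
  rw [map_sum]
  refine Finset.sum_congr rfl fun i _ => ?_
  rw [map_zpow₀, conjF_tF]

theorem conjPoly_opEm [NeZero e] (ε : Bool) {f : PolyF m} (hf : IsRowSymm f) :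
    conjPoly m (opEm m ε f) = opEm m ε (conjPoly m f) := by
  unfold opEm
  rw [smul_eq_C_mul, smul_eq_C_mul, smul_eq_C_mul, smul_eq_C_mul, map_sub, map_mul, map_mul,
    conjPoly_opD ε hf]
  have h1 : conjPoly m (C (tF ^ (-((∑ k, m k : ℕ) : ℤ)))) = C (tF ^ (-((∑ k, m k : ℕ) : ℤ))) := by
    rw [conjPoly, map_C]
    exact congrArg C ((map_zpow₀ conjF _ _).trans (by rw [conjF_tF]))
  have h2 : conjPoly m (C (normConst m ε)) = C (normConst m ε) := by
    rw [conjPoly, map_C]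
    exact congrArg C (conjF_normConst ε)
  rw [h1, h2]

end Conj

/-! ### The kernel identity for the operators on power sums -/

section Adjoint

variable {e n : ℕ} {m : Fin e → ℕ} {ζ : ℂ}

theorem cHom_injective : Function.Injective cHom := cHom.injective

theorem one_sub_cHom_pow_ne_zero (ζ : ℂ) (a : ℕ) {r : ℕ} (hr : 0 < r) :
    1 - cHom ζ ^ a * qF ^ r ≠ 0 := by
  have h : 1 - cHom ζ ^ a * qF ^ r
      = algebraMap (MvPolynomial (Fin 2) ℂ) Fqt (1 - C (ζ ^ a) * X 0 ^ r) := by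
    simp [cHom, qF]
  rw [h]
  intro h0
  rw [IsFractionRing.to_map_eq_zero_iff] at h0
  have := congrArg (eval 0) h0
  simp [hr.ne'] at this

theorem tupleZ_parts (α : EPartition e n) : tupleZ (cHom ζ) qF tF α.parts = zqt ζ α := by
  have h : ∀ (k : Fin e) (c : ℕ → Fqt) (s : Multiset ℕ),
      multisetZ (fun i => (e : Fqt) * i * c i) s = (e : Fqt) ^ s.card *
        ((∏ i ∈ s.toFinset, i ^ s.count i * (s.count i).factorial : ℕ) : Fqt) *
        (s.map c).prod := by
    intro k c s
    rw [multisetZ, Multiset.prod_map_mul, Multiset.prod_map_mul, Multiset.map_const',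
      Multiset.prod_replicate, Finset.prod_mul_distrib, Nat.cast_mul,
      ← Finset.prod_multiset_count, Nat.cast_multiset_prod]
    ring
  unfold tupleZ zqt zE
  rw [Finset.prod_congr rfl fun k _ => h k _ _, Finset.prod_mul_distrib, Finset.prod_mul_distrib,
    Finset.prod_pow_eq_pow_sum]
  have h2 : ∀ k, (α.parts k).card = (α.1 k).colLen 0 := fun k => by
    rw [EPartition.parts, Multiset.coe_card, YoungDiagram.length_rowLens]
  simp only [h2]
  rw [Nat.cast_mul, Nat.cast_pow, Nat.cast_prod]
  congr 1
  · refine congrArg _ (Finset.prod_congr rfl fun k _ => congrArg Nat.cast ?_)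
    unfold zPart EPartition.parts
    refine Finset.prod_congr (by ext; simp) fun i _ => ?_
    rw [Multiset.coe_count]
  · refine Finset.prod_congr rfl fun k _ => ?_
    rw [EPartition.parts, Multiset.map_coe, Multiset.prod_coe]
    congr 2
    funext a
    rw [qtRatio, cF_eq, map_pow]

theorem psumAt_eq_aeval {S : Type*} [CommRing S] [Algebra Fqt S] (x : Box m → S) (a r : ℕ) :
    psumAt (K := Fqt) (cHom ζ) x a r = aeval x (twistedPsum ζ m a r) := by
  unfold psumAt twistedPsum
  simp only [map_sum, map_mul, map_pow, aeval_X, cF_eq]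
  refine Finset.sum_congr rfl fun k _ => ?_
  rw [algHom_C]

theorem prod_psumAt_eq_aeval {S : Type*} [CommRing S] [Algebra Fqt S] (x : Box m → S)
    (α : EPartition e n) :
    ∏ k : Fin e, ((α.parts k).map (psumAt (K := Fqt) (cHom ζ) x k)).prod
      = aeval x (powerPoly ζ m α) := by
  rw [powerPoly_eq, powerProd, map_prod]
  refine Finset.prod_congr rfl fun k _ => ?_
  rw [map_multiset_prod, Multiset.map_map]
  congr 2
  funext r
  exact psumAt_eq_aeval x k r

theorem kerCoeff_eq_sum_aeval {S : Type*} [CommRing S] [Algebra Fqt S] (x y : Box m → S) (n : ℕ) :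
    kerCoeff (K := Fqt) (cHom ζ) qF tF (signRoot (cHom ζ) true) x y n
      = ∑ α : EPartition e n, algebraMap Fqt S (zqt ζ α)⁻¹ * aeval x (powerPoly ζ m α) *
        aeval y (powerPoly ζ⁻¹ m α) := by
  unfold kerCoeff kerTerm
  refine Finset.sum_congr rfl fun α _ => ?_
  rw [tupleZ_parts, ← prod_psumAt_eq_aeval, ← prod_psumAt_eq_aeval, map_inv₀ cHom]
  simp only [signRoot, if_true]

theorem aeval_alternant_mul_opD [NeZero e] {S : Type*} [CommRing S] [Algebra Fqt S] (ε : Bool)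
    (x : Box m → S) {f : PolyF m} (hf : IsRowSymm f) :
    rowAlt (delta m) x * aeval x (opD m ε f) = ∑ i,
      rowAlt (delta m) (cycPt ε (algebraMap Fqt S tF) i x) *
        aeval (cycPt ε (algebraMap Fqt S qF) i x) f := by
  rw [← aeval_alternant, ← map_mul, alternant_mul_opD ε hf, opNum, map_sum]
  refine Finset.sum_congr rfl fun i _ => ?_
  rw [map_mul, aeval_opT, aeval_opT, aeval_alternant]

theorem isRowSymm_powerPoly (α : EPartition e n) : IsRowSymm (powerPoly ζ m α) := by
  rw [powerPoly_eq]
  exact isRowSymm_powerProd _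

/-- This is the symmetry of the kernel after division by both alternants, which are nonzero because
the coordinates of each point are distinct. -/
theorem sum_aeval_opD_mul_aeval [NeZero e] {S : Type*} [CommRing S] [Algebra Fqt S] [IsDomain S] [CharZero S]
    (hζ : IsPrimitiveRoot ζ e) {x y : Box m → S} (hx0 : ∀ b, x b ≠ 0)
    (hx : Function.Injective x) (hy0 : ∀ b, y b ≠ 0) (hy : Function.Injective y) (n : ℕ) :
    ∑ α : EPartition e n, algebraMap Fqt S (zqt ζ α)⁻¹ *
        (aeval x (opD m true (powerPoly ζ m α)) * aeval y (powerPoly ζ⁻¹ m α))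
      = ∑ α : EPartition e n, algebraMap Fqt S (zqt ζ α)⁻¹ *
        (aeval x (powerPoly ζ m α) * aeval y (opD m false (powerPoly ζ⁻¹ m α))) := by
  have h := rowAlt_mul_sum_kerCoeff (K := Fqt) (z := cHom ζ) (q := qF) (t := tF)
    (hζ.map_of_injective cHom_injective) (fun a r hr => one_sub_cHom_pow_ne_zero ζ a hr) true
    hx0 hx hy0 hy n
  simp only [kerCoeff_eq_sum_aeval, Finset.mul_sum] at h
  rw [Finset.sum_comm] at h
  conv_rhs at h => rw [Finset.sum_comm]
  refine mul_left_cancel₀ (mul_ne_zero (rowAlt_delta_ne_zero x hx) (rowAlt_delta_ne_zero y hy)) ?_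
  rw [Finset.mul_sum, Finset.mul_sum]
  refine Eq.trans (Finset.sum_congr rfl fun α _ => ?_)
    (h.trans (Finset.sum_congr rfl fun α _ => ?_))
  · have h1 := aeval_alternant_mul_opD true x (isRowSymm_powerPoly (ζ := ζ) (m := m) α)
    calc _ = rowAlt (delta m) y * algebraMap Fqt S (zqt ζ α)⁻¹ * aeval y (powerPoly ζ⁻¹ m α) *
          (rowAlt (delta m) x * aeval x (opD m true (powerPoly ζ m α))) := by ring
      _ = _ := by
        rw [h1, Finset.mul_sum]
        exact Finset.sum_congr rfl fun i _ => by ring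
  · have h1 := aeval_alternant_mul_opD false y (isRowSymm_powerPoly (ζ := ζ⁻¹) (m := m) α)
    symm
    calc _ = rowAlt (delta m) x * algebraMap Fqt S (zqt ζ α)⁻¹ * aeval x (powerPoly ζ m α) *
          (rowAlt (delta m) y * aeval y (opD m false (powerPoly ζ⁻¹ m α))) := by ring
      _ = _ := by
        rw [h1, Finset.mul_sum]
        exact Finset.sum_congr rfl fun i _ => by
          simp only [Bool.not_true]
          ring

end Adjoint

/-! ### From a kernel identity to adjointness -/

section AdjointAbstract

/-- Comparison of the coefficients of the independent products `f k ⊗ g i` in the kernel identity.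
-/
theorem mul_eq_mul_of_sum_rename {K ι σ τ : Type*} [Field K] [Fintype ι]
    {f : ι → MvPolynomial σ K} {g : ι → MvPolynomial τ K} (hf : LinearIndependent K f)
    (hg : LinearIndependent K g) (w : ι → K) (A B : ι → ι → K)
    (h : ∑ i, algebraMap K (MvPolynomial (σ ⊕ τ) K) (w i) *
        (aeval (fun b => X (Sum.inl b)) (∑ k, A i k • f k) * aeval (fun b => X (Sum.inr b)) (g i))
      = ∑ i, algebraMap K (MvPolynomial (σ ⊕ τ) K) (w i) *
        (aeval (fun b => X (Sum.inl b)) (f i) * aeval (fun b => X (Sum.inr b)) (∑ k, B i k • g k)))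
    (i k : ι) : w i * A i k = w k * B k i := by
  have h1 := eq_zero_of_sum_rename_mul_rename hf hg (fun k i => w i * A i k - w k * B k i) ?_ k i
  · exact sub_eq_zero.1 h1
  simp only [sub_smul, Finset.sum_sub_distrib, sub_eq_zero]
  rw [Finset.sum_comm]
  have hr1 : ∀ p : MvPolynomial σ K, (rename Sum.inl p : MvPolynomial (σ ⊕ τ) K)
      = aeval (fun b => X (Sum.inl b)) p := fun p => by
    rw [MvPolynomial.rename_eq_aeval]
    rfl
  have hr2 : ∀ p : MvPolynomial τ K, (rename Sum.inr p : MvPolynomial (σ ⊕ τ) K)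
      = aeval (fun b => X (Sum.inr b)) p := fun p => by
    rw [MvPolynomial.rename_eq_aeval]
    rfl
  simp only [hr1, hr2]
  refine Eq.trans (Finset.sum_congr rfl fun i _ => ?_)
    (h.trans (Finset.sum_congr rfl fun i _ => ?_))
  · rw [map_sum, Finset.sum_mul, Finset.mul_sum]
    refine Finset.sum_congr rfl fun k _ => ?_
    simp only [Algebra.smul_def, map_mul, AlgHom.commutes]
    ring
  · rw [map_sum, Finset.mul_sum, Finset.mul_sum]
    refine Finset.sum_congr rfl fun k _ => ?_
    simp only [Algebra.smul_def, map_mul, AlgHom.commutes]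
    ring

theorem map_eq_sum_repr_smul {K V U ι : Type*} [Field K] [AddCommGroup V] [Module K V]
    [AddCommGroup U] [Module K U] [Fintype ι] (b : Module.Basis ι K V) (g : V →ₗ[K] U) (w : ι → U)
    (hw : ∀ i, g (b i) = w i) (v : V) : g v = ∑ i, b.repr v i • w i := by
  conv_lhs => rw [← b.sum_repr v]
  simp only [map_sum, map_smul, hw]

theorem diagForm_adjoint {K V ι : Type*} [Field K] [AddCommGroup V] [Module K V] [Fintype ι]
    (b : Module.Basis ι K V) (σ : K →+* K) (z : ι → K) (hz : ∀ i, z i ≠ 0) (T U : V →ₗ[K] V)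
    (h : ∀ i k, (z i)⁻¹ * b.repr (T (b i)) k = (z k)⁻¹ * σ (b.repr (U (b k)) i)) (f g : V) :
    diagForm b σ z (T f) g = diagForm b σ z f (U g) := by
  classical
  have h1 : ∀ i k, diagForm b σ z (T (b i)) (b k) = diagForm b σ z (b i) (U (b k)) := by
    intro i k
    rw [diagForm_apply, diagForm_apply, Finset.sum_eq_single k, Finset.sum_eq_single i]
    · have h2 := h i k
      simp only [Module.Basis.repr_self, Finsupp.single_eq_same, map_one, mul_one, one_mul]
      have hi := hz i
      have hk := hz k
      field_simp at h2
      linear_combination h2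
    · intro j _ hj
      rw [Module.Basis.repr_self, Finsupp.single_eq_of_ne hj, zero_mul, zero_mul]
    · simp
    · intro j _ hj
      rw [Module.Basis.repr_self, Finsupp.single_eq_of_ne hj, map_zero, mul_zero, zero_mul]
    · simp
  conv_lhs => rw [← b.sum_repr f, ← b.sum_repr g]
  conv_rhs => rw [← b.sum_repr f, ← b.sum_repr g]
  simp only [map_sum, map_smul, map_smulₛₗ, LinearMap.sum_apply, LinearMap.smul_apply, h1]

end AdjointAbstract

/-! ### Adjointness of `E⁺` and `E⁻` -/

section Adjoint

variable {e n : ℕ} {m : Fin e → ℕ} {ζ : ℂ}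

theorem aeval_opEm [NeZero e] {S : Type*} [CommRing S] [Algebra Fqt S] (ε : Bool) (x : Box m → S)
    (f : PolyF m) : aeval x (opEm m ε f)
      = algebraMap Fqt S (tF ^ (-((∑ k, m k : ℕ) : ℤ))) * aeval x (opD m ε f)
        - algebraMap Fqt S (normConst m ε) * aeval x f := by
  rw [opEm, smul_eq_C_mul, smul_eq_C_mul, map_sub, map_mul, map_mul, algHom_C, algHom_C]

theorem sum_aeval_opEm_mul_aeval [NeZero e] {S : Type*} [CommRing S] [Algebra Fqt S] [IsDomain S] [CharZero S]
    (hζ : IsPrimitiveRoot ζ e) {x y : Box m → S} (hx0 : ∀ b, x b ≠ 0)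
    (hx : Function.Injective x) (hy0 : ∀ b, y b ≠ 0) (hy : Function.Injective y) (n : ℕ) :
    ∑ α : EPartition e n, algebraMap Fqt S (zqt ζ α)⁻¹ *
        (aeval x (opEm m true (powerPoly ζ m α)) * aeval y (powerPoly ζ⁻¹ m α))
      = ∑ α : EPartition e n, algebraMap Fqt S (zqt ζ α)⁻¹ *
        (aeval x (powerPoly ζ m α) * aeval y (opEm m false (powerPoly ζ⁻¹ m α))) := by
  have h := congrArg (algebraMap Fqt S (tF ^ (-((∑ k, m k : ℕ) : ℤ))) * ·)
    (sum_aeval_opD_mul_aeval hζ hx0 hx hy0 hy n)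
  simp only [Finset.mul_sum] at h
  have h2 := congrArg (· - ∑ α : EPartition e n, algebraMap Fqt S (normConst m true) *
    (algebraMap Fqt S (zqt ζ α)⁻¹ * (aeval x (powerPoly ζ m α) * aeval y (powerPoly ζ⁻¹ m α)))) h
  simp only [← Finset.sum_sub_distrib] at h2
  refine Eq.trans (Finset.sum_congr rfl fun α _ => ?_)
    (h2.trans (Finset.sum_congr rfl fun α _ => ?_))
  · rw [aeval_opEm]
    ring
  · rw [aeval_opEm, ← normConst_not true]
    simp only [Bool.not_true]
    ring

theorem opEm_powerPoly [NeZero e] (hζ : IsPrimitiveRoot ζ e) (ε : Bool) (α : EPartition e n) :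
    opEm (shiftBy m n) ε (powerPoly ζ (shiftBy m n) α)
      = ∑ γ, (powerBasis hζ m n).repr (opXi m n ε (powerXi ζ m α)) γ •
        powerPoly ζ (shiftBy m n) γ :=
  map_eq_sum_repr_smul (K := Fqt) (V := Xi m n) (U := PolyF (shiftBy m n)) (powerBasis hζ m n)
    (evalXi m n) (fun γ => powerPoly ζ (shiftBy m n) γ)
    (fun γ => by rw [powerBasis_apply]; rfl) (opXi m n ε (powerXi ζ m α))

theorem opEm_powerPoly_inv [NeZero e] (hζ : IsPrimitiveRoot ζ e) (ε : Bool) (α : EPartition e n) :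
    opEm (shiftBy m n) ε (powerPoly ζ⁻¹ (shiftBy m n) α)
      = ∑ γ, conjF ((powerBasis hζ m n).repr (opXi m n ε (powerXi ζ m α)) γ) •
        powerPoly ζ⁻¹ (shiftBy m n) γ := by
  rw [← conjPoly_powerPoly hζ, ← conjPoly_opEm ε (isRowSymm_powerPoly α), opEm_powerPoly hζ,
    map_sum]
  refine Finset.sum_congr rfl fun γ _ => ?_
  rw [smul_eq_C_mul, smul_eq_C_mul, map_mul, conjPoly_powerPoly hζ]
  congr 1
  exact map_C _ _

theorem zqt_ne_zero (α : EPartition e n) : zqt ζ α ≠ 0 := by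
  classical
  have h := sum_mul_conjF_mul_zqt_ne_zero (ζ := ζ) (c := Pi.single α 1) fun h =>
    one_ne_zero (α := Fqt) (by simpa using congrFun h α)
  rw [Finset.sum_eq_single α (fun β _ hβ => by rw [Pi.single_eq_of_ne hβ, zero_mul, zero_mul])
    (by simp), Pi.single_eq_same, map_one, one_mul, one_mul] at h
  exact h

/-- The operators `E^+` and `E^-` are adjoint. -/
theorem formXi_opXi [NeZero e] (hζ : IsPrimitiveRoot ζ e) (f g : Xi m n) :
    formXi hζ m n (opXi m n true f) g = formXi hζ m n f (opXi m n false g) := by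
  -- The points are two disjoint sets of variables at the stage `m + n`, where the power sums of
  -- degree `n` are still linearly independent.
  have h := sum_aeval_opEm_mul_aeval (m := shiftBy m n)
    (S := MvPolynomial (Box (shiftBy m n) ⊕ Box (shiftBy m n)) Fqt) hζ
    (x := fun b => X (Sum.inl b)) (y := fun b => X (Sum.inr b)) (fun b => X_ne_zero _)
    (fun a b h => Sum.inl_injective (X_injective h)) (fun b => X_ne_zero _)
    (fun a b h => Sum.inr_injective (X_injective h)) n
  simp only [opEm_powerPoly hζ, opEm_powerPoly_inv hζ] at h
  have h2 := mul_eq_mul_of_sum_rename (K := Fqt) (linearIndependent_powerPoly hζ)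
    (linearIndependent_powerPoly hζ.inv) _ _ _ h
  have h3 := diagForm_adjoint (K := Fqt) (V := Xi m n) (powerBasis hζ m n) (conjF : Fqt →+* Fqt)
    (zqt ζ) zqt_ne_zero (opXi m n true) (opXi m n false) (fun α γ => by
      rw [powerBasis_apply, powerBasis_apply]
      exact h2 α γ) f g
  unfold formXi
  exact h3

end Adjoint

/-! ### Sylvester's theorem on intertwining matrices -/

section Sylvester

/-- A matrix that intertwines two endomorphisms without common eigenvalues vanishes. -/
theorem eq_zero_of_intertwines {L V W : Type*} [Field L] [IsAlgClosed L] [AddCommGroup V]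
    [Module L V] [AddCommGroup W] [Module L W] [FiniteDimensional L V] [FiniteDimensional L W]
    (A : Module.End L V) (B : Module.End L W) (h : ∀ x, ¬ (A.HasEigenvalue x ∧ B.HasEigenvalue x))
    (X : W →ₗ[L] V) (hX : A ∘ₗ X = X ∘ₗ B) : X = 0 := by
  by_contra hne
  have hX' : ∀ w, A (X w) = X (B w) := fun w => LinearMap.congr_fun hX w
  have hinv : ∀ v ∈ LinearMap.range X, A v ∈ LinearMap.range X := by
    rintro _ ⟨w, rfl⟩
    exact ⟨B w, (hX' w).symm⟩
  have hnt : Nontrivial (LinearMap.range X) := by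
    rw [Submodule.nontrivial_iff_ne_bot]
    exact fun h0 => hne (LinearMap.range_eq_bot.1 h0)
  obtain ⟨x, hx⟩ := Module.End.exists_eigenvalue (A.restrict hinv)
  obtain ⟨v, hv⟩ := hx.exists_hasEigenvector
  have hv1 : A v = x • (v : V) := congrArg Subtype.val hv.apply_eq_smul
  have hv0 : (v : V) ≠ 0 := fun h0 => hv.2 (Subtype.ext h0)
  have hA : A.HasEigenvalue x :=
    Module.End.hasEigenvalue_of_hasEigenvector ⟨Module.End.mem_eigenspace_iff.2 hv1, hv0⟩
  have hB : ¬ B.HasEigenvalue x := fun hB => h x ⟨hA, hB⟩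
  -- An eigenvalue `x` of `A` on the range of `X` is no eigenvalue of `B`, so `B - x` is surjective.
  -- Hence `A - x` is surjective, thus injective, on the range, contrary to the eigenvector.
  have hinj : Function.Injective (B - algebraMap L (Module.End L W) x) := by
    rw [← LinearMap.ker_eq_bot]
    by_contra h0
    exact hB (by rwa [Module.End.hasEigenvalue_iff, Module.End.eigenspace_def])
  have hsurj := LinearMap.injective_iff_surjective.1 hinj
  have hs : Function.Surjective
      (A.restrict hinv - algebraMap L (Module.End L (LinearMap.range X)) x) := by
    rintro ⟨_, w, rfl⟩
    obtain ⟨w', rfl⟩ := hsurj w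
    refine ⟨⟨X w', w', rfl⟩, Subtype.ext ?_⟩
    simp [hX', Module.algebraMap_end_apply]
  refine hv.2 (LinearMap.injective_iff_surjective.2 hs ?_)
  simp [hv.apply_eq_smul, Module.algebraMap_end_apply]

theorem matrix_eq_zero_of_intertwines {K ι κ : Type*} [Field K] [Fintype ι] [Fintype κ]
    [DecidableEq ι] [DecidableEq κ] (A : Matrix ι ι K) (B : Matrix κ κ K)
    (h : ∀ x : AlgebraicClosure K, ¬ (Module.End.HasEigenvalue
          (Matrix.toLin' (A.map (algebraMap K (AlgebraicClosure K)))) x ∧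
        Module.End.HasEigenvalue
          (Matrix.toLin' (B.map (algebraMap K (AlgebraicClosure K)))) x))
    (X : Matrix ι κ K) (hX : A * X = X * B) : X = 0 := by
  have hinj := (algebraMap K (AlgebraicClosure K)).injective
  have h1 := eq_zero_of_intertwines _ _ h
    (Matrix.toLin' (X.map (algebraMap K (AlgebraicClosure K)))) (by
      rw [← Matrix.toLin'_mul, ← Matrix.toLin'_mul, ← Matrix.map_mul, ← Matrix.map_mul, hX])
  rw [LinearEquiv.map_eq_zero_iff] at h1
  ext i j
  exact hinj ((congrFun (congrFun h1 i) j).trans (map_zero _).symm)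

end Sylvester

/-! ### Orthogonal projection for anisotropic sesquilinear forms -/

section Forms

variable {K V : Type*} [Field K] [AddCommGroup V] [Module K V] {σ : K →+* K}

/-- Orthogonality of two vectors, with the first one in the first or the second place. -/
def SignOrth (B : V →ₗ[K] V →ₛₗ[σ] K) (ε : Bool) (v w : V) : Prop :=
  if ε then B v w = 0 else B w v = 0

theorem SignOrth.add_left {B : V →ₗ[K] V →ₛₗ[σ] K} {ε : Bool} {v v' w : V} (h : SignOrth B ε v w)
    (h' : SignOrth B ε v' w) : SignOrth B ε (v + v') w := by
  cases ε <;> simp_all [SignOrth]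

theorem SignOrth.smul_left {B : V →ₗ[K] V →ₛₗ[σ] K} {ε : Bool} {v w : V} (c : K)
    (h : SignOrth B ε v w) : SignOrth B ε (c • v) w := by
  cases ε <;> simp_all [SignOrth]

theorem signOrth_zero_left (B : V →ₗ[K] V →ₛₗ[σ] K) (ε : Bool) (w : V) : SignOrth B ε 0 w := by
  cases ε <;> simp [SignOrth]

theorem signOrth_not (B : V →ₗ[K] V →ₛₗ[σ] K) (ε : Bool) (v w : V) :
    SignOrth B (!ε) v w ↔ SignOrth B ε w v := by
  cases ε <;> simp [SignOrth]

theorem SignOrth.sub_left {B : V →ₗ[K] V →ₛₗ[σ] K} {ε : Bool} {v v' w : V} (h : SignOrth B ε v w)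
    (h' : SignOrth B ε v' w) : SignOrth B ε (v - v') w := by
  rw [sub_eq_add_neg, ← neg_one_smul K v']
  exact h.add_left (h'.smul_left _)

theorem SignOrth.span_right {B : V →ₗ[K] V →ₛₗ[σ] K} {ε : Bool} {v : V} {s : Set V}
    (h : ∀ w ∈ s, SignOrth B ε v w) {w : V} (hw : w ∈ Submodule.span K s) : SignOrth B ε v w := by
  induction hw using Submodule.span_induction with
  | mem w hw => exact h w hw
  | zero => exact (signOrth_not B ε 0 v).1 (signOrth_zero_left B _ v)
  | add x y _ _ hx hy =>
    exact (signOrth_not B ε _ v).1 (((signOrth_not B ε _ v).2 hx).add_left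
      ((signOrth_not B ε _ v).2 hy))
  | smul c x _ hx =>
    exact (signOrth_not B ε _ v).1 (((signOrth_not B ε _ v).2 hx).smul_left c)

theorem eq_zero_of_signOrth {B : V →ₗ[K] V →ₛₗ[σ] K} (hB : ∀ v, B v v = 0 → v = 0) {ε : Bool}
    {W : Submodule K V} {v : V} (hv : v ∈ W) (h : ∀ w ∈ W, SignOrth B ε v w) : v = 0 := by
  have := h v hv
  cases ε <;> exact hB v (by simpa [SignOrth] using this)

/-- Projection along the orthogonal complement of a finite-dimensional subspace. -/
theorem exists_mem_signOrth [Module.Finite K V] {τ : K →+* K} (hτ : ∀ c, τ (σ c) = c)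
    {B : V →ₗ[K] V →ₛₗ[σ] K} (hB : ∀ v, B v v = 0 → v = 0)
    (ε : Bool) (W : Submodule K V) (v : V) : ∃ u ∈ W, ∀ w ∈ W, SignOrth B ε (v + u) w := by
  let b := Module.finBasis K W
  obtain ⟨ψ, hψ⟩ : ∃ ψ : V →ₗ[K] (Fin (Module.finrank K W) → K),
      ∀ v j, ψ v j = 0 ↔ SignOrth B ε v (b j) := by
    cases ε
    -- In its second variable the form is only semilinear; applying the inverse `τ` of the twist
    -- restores linearity.
    · refine ⟨{ toFun := fun v j => τ (B (b j) v)
                map_add' := fun v v' => ?_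
                map_smul' := fun c v => ?_ }, fun v j => ?_⟩
      · funext j; simp
      · funext j; simp [hτ]
      · simp [SignOrth]
    · refine ⟨{ toFun := fun v j => B v (b j)
                map_add' := fun v v' => ?_
                map_smul' := fun c v => ?_ }, fun v j => ?_⟩
      · funext j; simp
      · funext j; simp
      · simp [SignOrth]
  have hψ' : ∀ v, ψ v = 0 → ∀ w ∈ W, SignOrth B ε v w := by
    intro v hv w hw
    refine SignOrth.span_right (s := Set.range fun j => (b j : V)) ?_ ?_
    · rintro _ ⟨j, rfl⟩
      exact (hψ v j).1 (congrFun hv j)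
    · have h1 := Submodule.mem_map_of_mem (f := W.subtype) (b.mem_span ⟨w, hw⟩)
      rw [Submodule.map_span, ← Set.range_comp] at h1
      exact h1
  -- Anisotropy makes the pairing of `W` with itself injective, hence surjective by dimension, and a
  -- correction `u` of `v` can be found inside `W`.
  have hinj : Function.Injective (ψ ∘ₗ W.subtype) := by
    rw [← LinearMap.ker_eq_bot, LinearMap.ker_eq_bot']
    exact fun w hw => Subtype.ext (eq_zero_of_signOrth hB w.2 (hψ' w hw))
  have hsurj := (LinearMap.injective_iff_surjective_of_finrank_eq_finrank (by simp)).1 hinj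
  obtain ⟨u, hu⟩ := hsurj (-ψ v)
  refine ⟨u, u.2, hψ' _ ?_⟩
  have hu' : ψ u = -ψ v := hu
  rw [map_add, hu', add_neg_cancel]

end Forms

/-! ### Admissible orders and preceding families -/

section Order

variable {e n : ℕ} {m : Fin e → ℕ} {r : EPartition e n → EPartition e n → Prop}

/-- The `e`-partitions that precede `α` and do not belong to its family. -/
def precFamily (m : Fin e → ℕ) (r : EPartition e n → EPartition e n → Prop) (α : EPartition e n) :
    Set (EPartition e n) := {β | r β α ∧ ¬ SimilarSymbols m β α}

namespace AdmissibleOrder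

/-- Families are intervals, so members of one family lie on the same side of any other family. Hence
the set of strictly preceding elements is closed under passing down in dominance. -/
theorem mem_of_familyLE (hr : AdmissibleOrder m r) {α β γ : EPartition e n}
    (hγ : γ ∈ precFamily m r α) (h : FamilyLE m β γ) : β ∈ precFamily m r α := by
  have := hr.total
  rcases h.sim_or_lt with h | h
  · refine ⟨?_, fun hs => hγ.2 (h.symm'.trans' hs)⟩
    rcases trichotomous_of r β α with h1 | h1 | h1
    · exact h1
    · exact absurd (h1 ▸ h.symm') hγ.2
    · exact absurd (hr.interval γ α β h.symm' hγ.1 h1) hγ.2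
  · have h1 := hr.of_lt h
    exact ⟨_root_.trans h1 hγ.1, fun hs => h.1 (hr.interval β γ α hs h1 hγ.1)⟩

theorem mem_of_familyLT (hr : AdmissibleOrder m r) {α β : EPartition e n} (h : FamilyLT m β α) :
    β ∈ precFamily m r α := ⟨hr.of_lt h, h.1⟩

theorem subset_of_sim (hr : AdmissibleOrder m r) {α β : EPartition e n}
    (h : SimilarSymbols m α β) : precFamily m r α ⊆ precFamily m r β := by
  have := hr.total
  intro γ hγ
  refine ⟨?_, fun hs => hγ.2 (hs.trans' h.symm')⟩
  rcases trichotomous_of r γ β with h1 | h1 | h1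
  · exact h1
  · exact absurd (h1 ▸ h.symm') hγ.2
  · exact absurd ((hr.interval β γ α h.symm' h1 hγ.1).symm'.trans' h.symm') hγ.2

theorem subset_of_mem (hr : AdmissibleOrder m r) {α β : EPartition e n}
    (h : α ∈ precFamily m r β) : precFamily m r α ⊆ precFamily m r β := by
  have := hr.total
  exact fun γ hγ => ⟨_root_.trans hγ.1 h.1, fun hs => hγ.2 (hr.interval γ α β hs hγ.1 h.1)⟩

theorem mem_or_mem (hr : AdmissibleOrder m r) {α β : EPartition e n}
    (h : ¬ SimilarSymbols m α β) : α ∈ precFamily m r β ∨ β ∈ precFamily m r α := by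
  have := hr.total
  rcases trichotomous_of r α β with h1 | h1 | h1
  · exact Or.inl ⟨h1, h⟩
  · exact absurd (h1 ▸ similarSymbols_refl α) h
  · exact Or.inr ⟨h1, fun hs => h hs.symm'⟩

theorem precFamily_wf (hr : AdmissibleOrder m r) :
    WellFounded fun β α : EPartition e n => β ∈ precFamily m r α := by
  have := hr.total
  exact Subrelation.wf (fun h => h.1) (Finite.wellFounded_of_trans_of_irrefl r)

end AdmissibleOrder

end Order

/-! ### Block triangular systems and uniqueness of solutions -/

section LinearAlgebra

theorem span_image_le_of_lower {K V ι : Type*} [Field K] [AddCommGroup V] [Module K V]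
    {lt : ι → ι → Prop} {u v : ι → V} (h : ∀ a, u a - v a ∈ Submodule.span K (v '' {b | lt b a}))
    {L : Set ι} (hL : ∀ a ∈ L, ∀ b, lt b a → b ∈ L) :
    Submodule.span K (u '' L) ≤ Submodule.span K (v '' L) := by
  rw [Submodule.span_le]
  rintro _ ⟨a, ha, rfl⟩
  have h1 : Submodule.span K (v '' {b | lt b a}) ≤ Submodule.span K (v '' L) :=
    Submodule.span_mono (Set.image_mono (hL a ha))
  have h2 : v a ∈ Submodule.span K (v '' L) := Submodule.subset_span ⟨a, ha, rfl⟩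
  simpa using Submodule.add_mem _ (h1 (h a)) h2

variable {e n : ℕ} {m : Fin e → ℕ}

open scoped Classical in
/-- A matrix that intertwines a block triangular matrix with its block diagonal part is
determined by its diagonal blocks, if distinct diagonal blocks are not intertwined. -/
theorem eq_zero_of_block_intertwines {K : Type*} [Field K] (h : EPartition e n → EPartition e n → K)
    (hle : ∀ α β, h α β ≠ 0 → FamilyLE m β α)
    (hS : ∀ α β, ¬ SimilarSymbols m α β →
      ∀ X : Matrix {γ // SimilarSymbols m γ α} {γ // SimilarSymbols m γ β} K,
        (Matrix.of fun γ γ' : {γ // SimilarSymbols m γ α} => h γ.1 γ'.1) * X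
          = X * (Matrix.of fun γ γ' : {γ // SimilarSymbols m γ β} => h γ.1 γ'.1) → X = 0)
    (Z : EPartition e n → EPartition e n → Prop)
    (hZ : ∀ α α' β β', SimilarSymbols m α α' → FamilyLE m β β' → Z α β → Z α' β')
    (D : EPartition e n → EPartition e n → K)
    (hD : ∀ α β, Z α β → SimilarSymbols m α β → D α β = 0)
    (hcomm : ∀ α β, ∑ γ, D α γ * h γ β = ∑ γ with SimilarSymbols m γ α, h α γ * D γ β)
    (α β : EPartition e n) (hαβ : Z α β) : D α β = 0 := by
  -- The induction runs downward from the largest families. Block triangularity allows only `γ ≥ β`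
  -- in the commutation relation, and those strictly above `β` are already settled, so the blocks of
  -- `α` and `β` alone remain.
  have hwf : WellFounded fun β γ : EPartition e n => FamilyLT m γ β := by
    have h1 : IsTrans _ fun β γ : EPartition e n => FamilyLT m γ β :=
      ⟨fun _ _ _ h h' => h'.trans_le h.le⟩
    have h2 : Std.Irrefl fun β γ : EPartition e n => FamilyLT m γ β := ⟨fun _ h => h.1 rfl⟩
    exact Finite.wellFounded_of_trans_of_irrefl _
  induction β using hwf.induction generalizing α with
  | _ β ih =>
    by_cases hs : SimilarSymbols m α β
    · exact hD α β hαβ hs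
    have hX := hS α β hs (Matrix.of fun γ γ' => D γ.1 γ'.1) (by
      ext ⟨α', hα'⟩ ⟨β', hβ'⟩
      simp only [Matrix.mul_apply, Matrix.of_apply]
      rw [← Finset.sum_subtype (Finset.univ.filter fun γ => SimilarSymbols m γ α) (by simp)
          (fun γ => h α' γ * D γ β'),
        ← Finset.sum_subtype (Finset.univ.filter fun γ => SimilarSymbols m γ β) (by simp)
          (fun γ => D α' γ * h γ β')]
      have h1 : (Finset.univ.filter fun γ => SimilarSymbols m γ α)
          = Finset.univ.filter fun γ => SimilarSymbols m γ α' := by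
        ext γ
        simp only [Finset.mem_filter, Finset.mem_univ, true_and]
        exact ⟨fun h => h.trans' hα'.symm', fun h => h.trans' hα'⟩
      rw [h1, ← hcomm α' β']
      refine (Finset.sum_subset (Finset.subset_univ _) fun γ _ hγ => ?_).symm
      by_cases h0 : h γ β' = 0
      · rw [h0, mul_zero]
      have h2 : FamilyLE m β γ := hβ'.symm'.le.trans (hle _ _ h0)
      have h3 : FamilyLT m β γ :=
        h2.sim_or_lt.resolve_left fun h => hγ (by simpa using h.symm')
      rw [ih γ h3 α' (hZ _ _ _ _ hα'.symm' h2 hαβ), zero_mul])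
    exact congrFun (congrFun hX ⟨α, similarSymbols_refl α⟩) ⟨β, similarSymbols_refl β⟩

variable {K V : Type*} [Field K] [AddCommGroup V] [Module K V]

theorem repr_map_basis {ι : Type*} [Fintype ι] (b : Module.Basis ι K V) (T : V →ₗ[K] V)
    (h : ι → ι → K) (hT : ∀ α, T (b α) = ∑ β, h α β • b β) (v : V) (β : ι) :
    b.repr (T v) β = ∑ γ, b.repr v γ * h γ β := by
  classical
  conv_lhs => rw [← b.sum_repr v]
  simp only [map_sum, map_smul, hT, Finsupp.coe_finsetSum, Finset.sum_apply, Finsupp.smul_apply,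
    smul_eq_mul, b.repr_self]
  refine Finset.sum_congr rfl fun γ _ => ?_
  congr 1
  rw [Finset.sum_eq_single β]
  · simp
  · intro c _ hc
    simp [hc]
  · simp

theorem repr_eq_of_sub_mem_span {ι : Type*} (b : Module.Basis ι K V) {v v' : V} {s : Set ι}
    (h : v - v' ∈ Submodule.span K (b '' s)) {β : ι} (hβ : β ∉ s) : b.repr v β = b.repr v' β := by
  rw [← sub_eq_zero, ← Finsupp.sub_apply, ← map_sub]
  by_contra h0
  exact hβ (b.mem_span_image.1 h (Finsupp.mem_support_iff.2 h0))

open scoped Classical in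
/-- The hypothesis on the coefficients in `eq_zero_of_block_intertwines` holds for solutions of
the block eigenvalue equation. -/
theorem repr_block_intertwines (b : Module.Basis (EPartition e n) K V) (T : V →ₗ[K] V)
    (h : EPartition e n → EPartition e n → K) (hT : ∀ α, T (b α) = ∑ β, h α β • b β)
    {R : EPartition e n → V}
    (hR : ∀ α, T (R α) = ∑ β with SimilarSymbols m β α, h α β • R β) (α β : EPartition e n) :
    ∑ γ, b.repr (R α) γ * h γ β
      = ∑ γ with SimilarSymbols m γ α, h α γ * b.repr (R γ) β := by
  rw [← repr_map_basis b T h hT, hR]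
  simp [Finsupp.coe_finsetSum]

open scoped Classical in
-- The difference of the two coefficient matrices satisfies the same intertwining relation and has
-- zero diagonal blocks.
theorem eq_of_unitriangular_of_block_eigen (b : Module.Basis (EPartition e n) K V) (T : V →ₗ[K] V)
    (h : EPartition e n → EPartition e n → K) (hT : ∀ α, T (b α) = ∑ β, h α β • b β)
    (hle : ∀ α β, h α β ≠ 0 → FamilyLE m β α)
    (hS : ∀ α β, ¬ SimilarSymbols m α β →
      ∀ X : Matrix {γ // SimilarSymbols m γ α} {γ // SimilarSymbols m γ β} K,
        (Matrix.of fun γ γ' : {γ // SimilarSymbols m γ α} => h γ.1 γ'.1) * X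
          = X * (Matrix.of fun γ γ' : {γ // SimilarSymbols m γ β} => h γ.1 γ'.1) → X = 0)
    {R R' : EPartition e n → V}
    (hR : ∀ α, T (R α) = ∑ β with SimilarSymbols m β α, h α β • R β)
    (hR' : ∀ α, T (R' α) = ∑ β with SimilarSymbols m β α, h α β • R' β)
    (hu : ∀ α, R α - b α ∈ Submodule.span K (b '' {β | FamilyLT m β α}))
    (hu' : ∀ α, R' α - b α ∈ Submodule.span K (b '' {β | FamilyLT m β α})) : R = R' := by
  funext α
  refine b.ext_elem fun β => sub_eq_zero.1 ?_
  refine eq_zero_of_block_intertwines h hle hS (fun _ _ => True) (fun _ _ _ _ _ _ h => h)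
    (fun α β => b.repr (R α) β - b.repr (R' α) β) (fun α β _ hs => ?_) (fun α β => ?_) α β trivial
  · have h1 : β ∉ {β | FamilyLT m β α} := fun h => h.1 hs.symm'
    rw [repr_eq_of_sub_mem_span b (hu α) h1, repr_eq_of_sub_mem_span b (hu' α) h1, sub_self]
  · simp only [sub_mul, mul_sub, Finset.sum_sub_distrib, repr_block_intertwines b T h hT hR,
      repr_block_intertwines b T h hT hR']

open scoped Classical in
-- Here the vanishing argument is restricted to the pairs with `β ≰ α`, a set containing no diagonal
-- block. It improves triangularity for the chosen order `≺` to triangularity for `<`.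
theorem unitriangular_of_block_eigen {r : EPartition e n → EPartition e n → Prop}
    (b : Module.Basis (EPartition e n) K V) (T : V →ₗ[K] V)
    (h : EPartition e n → EPartition e n → K) (hT : ∀ α, T (b α) = ∑ β, h α β • b β)
    (hle : ∀ α β, h α β ≠ 0 → FamilyLE m β α)
    (hS : ∀ α β, ¬ SimilarSymbols m α β →
      ∀ X : Matrix {γ // SimilarSymbols m γ α} {γ // SimilarSymbols m γ β} K,
        (Matrix.of fun γ γ' : {γ // SimilarSymbols m γ α} => h γ.1 γ'.1) * X
          = X * (Matrix.of fun γ γ' : {γ // SimilarSymbols m γ β} => h γ.1 γ'.1) → X = 0)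
    {R : EPartition e n → V}
    (hR : ∀ α, T (R α) = ∑ β with SimilarSymbols m β α, h α β • R β)
    (hu : ∀ α, R α - b α ∈ Submodule.span K (b '' precFamily m r α)) (α : EPartition e n) :
    R α - b α ∈ Submodule.span K (b '' {β | FamilyLT m β α}) := by
  rw [b.mem_span_image]
  intro β hβ
  rw [Finset.mem_coe, Finsupp.mem_support_iff, map_sub, Finsupp.sub_apply] at hβ
  have h1 : ¬ SimilarSymbols m β α := fun hs => hβ <| by
    rw [repr_eq_of_sub_mem_span b (hu α) fun h => h.2 hs, sub_self]
  refine ⟨h1, ?_⟩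
  change FamilyLE m β α
  by_contra h2
  have h3 := eq_zero_of_block_intertwines h hle hS (fun α β => ¬ FamilyLE m β α)
    (fun α α' β β' hα hβ hn hc => hn ((hβ.trans hc).trans hα.symm'.le))
    (fun α β => b.repr (R α) β) (fun α β hn hs => absurd hs.symm'.le hn)
    (repr_block_intertwines b T h hT hR) α β h2
  have h4 : α ≠ β := fun h => h1 (h ▸ similarSymbols_refl α)
  apply hβ
  rw [h3, b.repr_self, Finsupp.single_eq_of_ne h4.symm, sub_zero]

end LinearAlgebra

/-! ### Existence, uniqueness and block eigenvalue equation -/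

section MacdonaldSystem

variable {e n : ℕ} {m : Fin e → ℕ} {r : EPartition e n → EPartition e n → Prop}
  {K V : Type*} [Field K] [AddCommGroup V] [Module K V] {σ τ : K →+* K}

theorem SignOrth.sum_left {B : V →ₗ[K] V →ₛₗ[σ] K} {ε : Bool} {ι : Type*} {s : Finset ι}
    {v : ι → V} {w : V} (h : ∀ i ∈ s, SignOrth B ε (v i) w) : SignOrth B ε (∑ i ∈ s, v i) w :=
  Finset.sum_induction v (fun v => SignOrth B ε v w) (fun _ _ => SignOrth.add_left)
    (signOrth_zero_left B ε w) h

/-- The defining property of the Macdonald functions, for vectors `s` in place of the Schur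
functions and a form `B`. -/
def IsOrthSystem (m : Fin e → ℕ) (r : EPartition e n → EPartition e n → Prop)
    (s : EPartition e n → V) (B : V →ₗ[K] V →ₛₗ[σ] K) (P : Bool → EPartition e n → V) : Prop :=
  (∀ ε α, P ε α - s α ∈ Submodule.span K (s '' precFamily m r α)) ∧
    ∀ α β, ¬ SimilarSymbols m α β → B (P true α) (P false β) = 0

/-- Orthogonality to the functions of the other sign becomes orthogonality to a subspace free of
them: the preceding `s_β` lie in the span of the preceding `P_β` of that sign. -/
theorem IsOrthSystem.signOrth (hr : AdmissibleOrder m r) {s : EPartition e n → V}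
    {B : V →ₗ[K] V →ₛₗ[σ] K} {P : Bool → EPartition e n → V} (h : IsOrthSystem m r s B P)
    (ε : Bool) (α : EPartition e n) :
    ∀ w ∈ Submodule.span K (s '' precFamily m r α), SignOrth B ε (P ε α) w := by
  intro w hw
  have h1 := span_image_le_of_lower (lt := fun β γ => β ∈ precFamily m r γ) (u := s) (v := P (!ε))
    (fun a => sub_mem_span_of_wf hr.precFamily_wf
      (fun _ _ _ h h' => hr.subset_of_mem h' h) (P (!ε)) s (h.1 (!ε)) a)
    (L := precFamily m r α) (fun a ha b hb => hr.subset_of_mem ha hb)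
  refine SignOrth.span_right ?_ (h1 hw)
  rintro _ ⟨γ, hγ, rfl⟩
  cases ε
  · exact h.2 _ _ hγ.2
  · exact h.2 _ _ fun hs => hγ.2 hs.symm'

theorem isOrthSystem_of_signOrth (hr : AdmissibleOrder m r) {s : EPartition e n → V}
    {B : V →ₗ[K] V →ₛₗ[σ] K} {P : Bool → EPartition e n → V}
    (h : ∀ ε α, P ε α - s α ∈ Submodule.span K (s '' precFamily m r α))
    (ho : ∀ ε α, ∀ w ∈ Submodule.span K (s '' precFamily m r α), SignOrth B ε (P ε α) w) :
    IsOrthSystem m r s B P := by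
  have key : ∀ ε α β, α ∈ precFamily m r β → P ε α ∈ Submodule.span K (s '' precFamily m r β) := by
    intro ε α β hα
    have h1 := Submodule.span_mono (R := K) (Set.image_mono (f := s) (hr.subset_of_mem hα)) (h ε α)
    have h2 : s α ∈ Submodule.span K (s '' precFamily m r β) :=
      Submodule.subset_span ⟨α, hα, rfl⟩
    simpa using Submodule.add_mem _ h1 h2
  refine ⟨h, fun α β hs => ?_⟩
  rcases hr.mem_or_mem hs with h1 | h1
  · exact ho false β _ (key true α β h1)
  · exact ho true α _ (key false β α h1)

/-- Existence is orthogonal projection for each `α` and sign separately. The difference of two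
solutions lies in the span of the preceding `s_β` and is orthogonal to it, so anisotropy makes it
zero. -/
theorem existsUnique_isOrthSystem [Module.Finite K V] (hτ : ∀ c, τ (σ c) = c)
    (hr : AdmissibleOrder m r) (s : EPartition e n → V) {B : V →ₗ[K] V →ₛₗ[σ] K}
    (hB : ∀ v, B v v = 0 → v = 0) : ∃! P, IsOrthSystem m r s B P := by
  choose u hu hu' using fun (ε : Bool) (α : EPartition e n) =>
    exists_mem_signOrth hτ hB ε (Submodule.span K (s '' precFamily m r α)) (s α)
  have hP := isOrthSystem_of_signOrth (B := B) (P := fun ε α => s α + u ε α) hr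
    (fun ε α => by simpa using hu ε α) hu'
  refine ⟨_, hP, fun P hP' => ?_⟩
  funext ε α
  refine sub_eq_zero.1 (eq_zero_of_signOrth hB (ε := ε)
    (W := Submodule.span K (s '' precFamily m r α)) ?_ fun w hw =>
      (hP'.signOrth hr ε α w hw).sub_left (hP.signOrth hr ε α w hw))
  have := Submodule.sub_mem _ (hP'.1 ε α) (hP.1 ε α)
  rwa [sub_sub_sub_cancel_right] at this

open scoped Classical in
-- The two sides differ by an element of the span `W_α` of the preceding families, since `T` is
-- block triangular. The difference is also orthogonal to `W_α`: the adjoint of `T` preserves `W_α`,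
-- and all `P_β` with `β ∼ α` are orthogonal to it.
theorem IsOrthSystem.block_eigen (hr : AdmissibleOrder m r) {s b : EPartition e n → V}
    (hsb : ∀ α, s α - b α ∈ Submodule.span K (b '' {β | FamilyLT m β α}))
    (hbs : ∀ α, b α - s α ∈ Submodule.span K (s '' {β | FamilyLT m β α}))
    {B : V →ₗ[K] V →ₛₗ[σ] K} (hB : ∀ v, B v v = 0 → v = 0)
    (T : Bool → V →ₗ[K] V) (h : Bool → EPartition e n → EPartition e n → K)
    (hT : ∀ ε α, T ε (b α) = ∑ β, h ε α β • b β)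
    (hle : ∀ ε α β, h ε α β ≠ 0 → FamilyLE m β α)
    (hadj : ∀ v w, B (T true v) w = B v (T false w))
    {P : Bool → EPartition e n → V} (hP : IsOrthSystem m r s B P) :
    (∀ ε α, P ε α - b α ∈ Submodule.span K (b '' precFamily m r α)) ∧
    ∀ ε α, T ε (P ε α) = ∑ β with SimilarSymbols m β α, h ε α β • P ε β := by
  have hW : ∀ α, Submodule.span K (s '' precFamily m r α)
      = Submodule.span K (b '' precFamily m r α) := fun α =>
    le_antisymm
      (span_image_le_of_lower hsb fun a ha c hc => hr.mem_of_familyLE ha hc.le)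
      (span_image_le_of_lower hbs fun a ha c hc => hr.mem_of_familyLE ha hc.le)
  have hPb : ∀ ε α, P ε α - b α ∈ Submodule.span K (b '' precFamily m r α) := by
    intro ε α
    have h1 := hP.1 ε α
    rw [hW] at h1
    have h2 : Submodule.span K (b '' {β | FamilyLT m β α})
        ≤ Submodule.span K (b '' precFamily m r α) :=
      Submodule.span_mono (Set.image_mono fun β hβ => hr.mem_of_familyLT hβ)
    simpa using Submodule.add_mem _ h1 (h2 (hsb α))
  have hTW : ∀ ε α, ∀ w ∈ Submodule.span K (b '' precFamily m r α),
      T ε w ∈ Submodule.span K (b '' precFamily m r α) := by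
    intro ε α w hw
    induction hw using Submodule.span_induction with
    | mem w hw =>
      obtain ⟨γ, hγ, rfl⟩ := hw
      rw [hT]
      refine Submodule.sum_mem _ fun β _ => ?_
      by_cases h0 : h ε γ β = 0
      · rw [h0, zero_smul]
        exact Submodule.zero_mem _
      · exact Submodule.smul_mem _ _ (Submodule.subset_span
          ⟨β, hr.mem_of_familyLE hγ (hle _ _ _ h0), rfl⟩)
    | zero => rw [map_zero]; exact Submodule.zero_mem _
    | add x y _ _ hx hy => rw [map_add]; exact Submodule.add_mem _ hx hy
    | smul c x _ hx => rw [map_smul]; exact Submodule.smul_mem _ _ hx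
  have hadj' : ∀ ε v w, SignOrth B ε v (T (!ε) w) → SignOrth B ε (T ε v) w := by
    intro ε v w hvw
    cases ε
    · simp only [SignOrth, Bool.false_eq_true, if_false, Bool.not_false] at hvw ⊢
      rw [← hadj]
      exact hvw
    · simp only [SignOrth, if_true, Bool.not_true] at hvw ⊢
      rw [hadj]
      exact hvw
  refine ⟨hPb, fun ε α => sub_eq_zero.1 (eq_zero_of_signOrth hB (ε := ε)
    (W := Submodule.span K (b '' precFamily m r α)) ?_ fun w hw => ?_)⟩
  · have h1 : ∀ β, SimilarSymbols m β α →
        P ε β - b β ∈ Submodule.span K (b '' precFamily m r α) := fun β hβ =>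
      Submodule.span_mono (Set.image_mono (hr.subset_of_sim hβ)) (hPb ε β)
    have h2 : T ε (b α) - ∑ β with SimilarSymbols m β α, h ε α β • b β
        ∈ Submodule.span K (b '' precFamily m r α) := by
      rw [hT, ← Finset.sum_filter_add_sum_filter_not Finset.univ (fun β => SimilarSymbols m β α),
        add_sub_cancel_left]
      refine Submodule.sum_mem _ fun β hβ => ?_
      by_cases h0 : h ε α β = 0
      · rw [h0, zero_smul]
        exact Submodule.zero_mem _
      · exact Submodule.smul_mem _ _ (Submodule.subset_span ⟨β, hr.mem_of_familyLT
          ((hle _ _ _ h0).sim_or_lt.resolve_left (Finset.mem_filter.1 hβ).2), rfl⟩)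
    have h3 : ∑ β with SimilarSymbols m β α, h ε α β • (P ε β - b β)
        ∈ Submodule.span K (b '' precFamily m r α) :=
      Submodule.sum_mem _ fun β hβ => Submodule.smul_mem _ _ (h1 β (Finset.mem_filter.1 hβ).2)
    have h4 := Submodule.sub_mem _ (Submodule.add_mem _ (hTW ε α _ (hPb ε α)) h2) h3
    have h5 : T ε (P ε α) - ∑ β with SimilarSymbols m β α, h ε α β • P ε β
        = T ε (P ε α - b α) + (T ε (b α) - ∑ β with SimilarSymbols m β α, h ε α β • b β)
          - ∑ β with SimilarSymbols m β α, h ε α β • (P ε β - b β) := by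
      rw [map_sub]
      simp only [smul_sub, Finset.sum_sub_distrib]
      abel
    rw [h5]
    exact h4
  · refine SignOrth.sub_left (hadj' ε _ _ (hP.signOrth hr ε α _ ?_))
      (SignOrth.sum_left fun β hβ => SignOrth.smul_left _ (hP.signOrth hr ε β w ?_))
    · rw [hW]
      exact hTW _ α w hw
    · rw [hW]
      exact Submodule.span_mono
        (Set.image_mono (hr.subset_of_sim (Finset.mem_filter.1 hβ).2.symm')) hw

open scoped Classical in
theorem IsOrthSystem.characterization (hr : AdmissibleOrder m r)
    (b : Module.Basis (EPartition e n) K V) {s : EPartition e n → V}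
    (hsb : ∀ α, s α - b α ∈ Submodule.span K (b '' {β | FamilyLT m β α}))
    (hbs : ∀ α, b α - s α ∈ Submodule.span K (s '' {β | FamilyLT m β α}))
    {B : V →ₗ[K] V →ₛₗ[σ] K} (hB : ∀ v, B v v = 0 → v = 0)
    (T : Bool → V →ₗ[K] V) (h : Bool → EPartition e n → EPartition e n → K)
    (hT : ∀ ε α, T ε (b α) = ∑ β, h ε α β • b β)
    (hle : ∀ ε α β, h ε α β ≠ 0 → FamilyLE m β α)
    (hadj : ∀ v w, B (T true v) w = B v (T false w)) (ε : Bool)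
    (hA : ∀ α β, ¬ SimilarSymbols m α β → ∀ x : AlgebraicClosure K,
      ¬ (Module.End.HasEigenvalue (Matrix.toLin' ((Matrix.of
            fun γ γ' : {γ // SimilarSymbols m γ α} => h ε γ.1 γ'.1).map
              (algebraMap K (AlgebraicClosure K)))) x ∧
        Module.End.HasEigenvalue (Matrix.toLin' ((Matrix.of
            fun γ γ' : {γ // SimilarSymbols m γ β} => h ε γ.1 γ'.1).map
              (algebraMap K (AlgebraicClosure K)))) x))
    {P : Bool → EPartition e n → V} (hP : IsOrthSystem m r s B P) (R : EPartition e n → V) :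
    ((∀ α, R α - b α ∈ Submodule.span K (b '' {β | FamilyLT m β α})) ∧
      ∀ α, T ε (R α) = ∑ β with SimilarSymbols m β α, h ε α β • R β) ↔ R = P ε := by
  obtain ⟨h1, h2⟩ := hP.block_eigen hr hsb hbs hB T h hT hle hadj
  have hS := fun α β hs => matrix_eq_zero_of_intertwines _ _ (hA α β hs)
  have h3 := unitriangular_of_block_eigen b (T ε) (h ε) (hT ε) (hle ε) hS (h2 ε) (h1 ε)
  refine ⟨fun hR => ?_, ?_⟩
  · exact eq_of_unitriangular_of_block_eigen b (T ε) (h ε) (hT ε) (hle ε) hS hR.2 (h2 ε) hR.1 h3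
  · rintro rfl
    exact ⟨h3, h2 ε⟩

end MacdonaldSystem

theorem sub_mem_span_image_iff {K U ι : Type*} [Field K] [AddCommGroup U] [Module K U] [Fintype ι]
    {W : Submodule K U} (v : ι → W) (p : ι → Prop) [DecidablePred p] (x y : W) :
    x - y ∈ Submodule.span K (v '' {b | p b}) ↔
      ∃ u : ι → K, (x : U) = y + ∑ b with p b, u b • (v b : U) := by
  have h : {b | p b} = ((Finset.univ.filter p : Finset ι) : Set ι) := by ext; simp
  rw [h, Submodule.mem_span_image_finset_iff_exists_fun']
  refine exists_congr fun u => ?_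
  rw [eq_comm, sub_eq_iff_eq_add', Subtype.ext_iff]
  simp

/-! ### Translation to symmetric functions and the theorem -/

section Final

variable {e n : ℕ} {m : Fin e → ℕ} {ζ : ℂ}

theorem isMacdonald_iff [NeZero e] (hζ : IsPrimitiveRoot ζ e)
    (r : EPartition e n → EPartition e n → Prop) (P : Bool → EPartition e n → Xi m n) :
    IsMacdonald ζ m r (fun ε α => (P ε α : PolySeq m)) ↔
      IsOrthSystem (K := Fqt) (V := Xi m n) m r (schurXi m) (formXi hζ m n) P := by
  classical
  have h1 : ∀ ε, (∃ u : EPartition e n → EPartition e n → Fqt, ∀ α,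
      (P ε α : PolySeq m) = schurSym m α
        + ∑ β with r β α ∧ ¬ SimilarSymbols m β α, u α β • schurSym m β) ↔
      ∀ α, P ε α - schurXi m α ∈ Submodule.span Fqt (schurXi m '' precFamily m r α) := by
    intro ε
    rw [← Classical.skolem (p := fun (α : EPartition e n) (u : EPartition e n → Fqt) =>
      (P ε α : PolySeq m) = schurSym m α
        + ∑ β with r β α ∧ ¬ SimilarSymbols m β α, u β • schurSym m β)]
    refine forall_congr' fun α => ?_
    have h := sub_mem_span_image_iff (K := Fqt) (W := Xi m n) (schurXi m)
      (fun β => r β α ∧ ¬ SimilarSymbols m β α) (P ε α) (schurXi m α)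
    exact h.symm
  refine ⟨fun h => ⟨fun ε => (h1 ε).1 ?_, fun α β hs => ?_⟩, fun h => ⟨fun ε α => (P ε α).2,
    fun ε => ?_, fun α β hs => ?_⟩⟩
  · convert h.expansion ε
  · rw [← scalarProd_eq]
    exact h.orthogonal α β hs
  · convert (h1 ε).2 (h.1 ε)
  · rw [scalarProd_eq hζ]
    exact h.2 α β hs

theorem isUnitriangular_iff (R : EPartition e n → Xi m n) :
    IsUnitriangular m (fun α => (R α : PolySeq m)) ↔
      ∀ α, R α - monoXi m α ∈ Submodule.span Fqt (monoXi m '' {β | FamilyLT m β α}) := by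
  classical
  have h1 : (∃ u : EPartition e n → EPartition e n → Fqt, ∀ α,
      (R α : PolySeq m) = monoSym m α + ∑ β with FamilyLT m β α, u α β • monoSym m β) ↔
      ∀ α, R α - monoXi m α ∈ Submodule.span Fqt (monoXi m '' {β | FamilyLT m β α}) := by
    rw [← Classical.skolem (p := fun (α : EPartition e n) (u : EPartition e n → Fqt) =>
      (R α : PolySeq m) = monoSym m α + ∑ β with FamilyLT m β α, u β • monoSym m β)]
    refine forall_congr' fun α => ?_
    have h := sub_mem_span_image_iff (K := Fqt) (W := Xi m n) (monoXi m)
      (fun β => FamilyLT m β α) (R α) (monoXi m α)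
    exact h.symm
  rw [← h1]
  unfold IsUnitriangular
  convert Iff.rfl

open scoped Classical in
theorem isBlockEigen_iff [NeZero e] (ε : Bool) (R : EPartition e n → Xi m n) :
    IsBlockEigen m ε (fun α => (R α : PolySeq m)) ↔
      ∀ α, opXi m n ε (R α) = ∑ β with SimilarSymbols m β α, hCoeff m ε α β • R β := by
  refine forall_congr' fun α => ?_
  rw [Subtype.ext_iff, Submodule.coe_sum]
  exact Iff.rfl

theorem existsUnique_isMacdonald [NeZero e] (hζ : IsPrimitiveRoot ζ e)
    {r : EPartition e n → EPartition e n → Prop} (hr : AdmissibleOrder m r) :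
    ∃! P : Bool → EPartition e n → PolySeq m, IsMacdonald ζ m r P := by
  have hfin : Module.Finite Fqt (Xi m n) := Module.Finite.of_basis (monoBasis m n)
  have h := existsUnique_isOrthSystem (K := Fqt) (V := Xi m n) (σ := (conjF : Fqt →+* Fqt))
    (τ := (conjF.symm : Fqt →+* Fqt)) (fun c => conjF.symm_apply_apply c) hr (schurXi m)
    (B := formXi hζ m n) (fun v hv => by
      by_contra h0
      exact formXi_self_ne_zero hζ h0 hv)
  obtain ⟨P, hP, hu⟩ := h
  refine ⟨_, (isMacdonald_iff hζ r P).2 hP, fun P' hP' => ?_⟩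
  have h1 := hu (fun ε α => ⟨P' ε α, hP'.mem ε α⟩) ((isMacdonald_iff hζ r _).1 hP')
  funext ε α
  exact congrArg Subtype.val (congrFun (congrFun h1 ε) α)

theorem IsMacdonald.characterization [NeZero e] (hζ : IsPrimitiveRoot ζ e) {ε : Bool}
    (hA : ConjectureA m n ε) {r : EPartition e n → EPartition e n → Prop}
    (hr : AdmissibleOrder m r) {P : Bool → EPartition e n → PolySeq m} (hP : IsMacdonald ζ m r P)
    (R : EPartition e n → PolySeq m) :
    ((∀ α, R α ∈ Xi m n) ∧ IsUnitriangular m R ∧ IsBlockEigen m ε R) ↔ R = P ε := by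
  classical
  have hP' := (isMacdonald_iff hζ r (fun ε α => ⟨P ε α, hP.mem ε α⟩)).1 hP
  have key := fun R => IsOrthSystem.characterization (K := Fqt) (V := Xi m n) hr (monoBasis m n)
    (s := schurXi m) (fun α => by
      have h := span_schur_le (m := m) α
      rw [show (monoBasis m n : EPartition e n → Xi m n) = monoXi m from funext monoBasis_apply]
      exact h) (fun α => by
      have h := monoXi_sub_schurXi_mem (m := m) α
      rw [monoBasis_apply]
      exact h)
    (B := formXi hζ m n) (fun v hv => by
      by_contra h0
      exact formXi_self_ne_zero hζ h0 hv) (opXi m n) (hCoeff m) (fun ε α => by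
      have h := opXi_monoXi (m := m) ε α
      rw [show (monoBasis m n : EPartition e n → Xi m n) = monoXi m from funext monoBasis_apply]
      exact h) (fun ε _ _ => familyLE_of_hCoeff_ne_zero ε) (formXi_opXi hζ) ε
      (fun α β hs x hx => hA α β hs x (by convert hx <;> rfl)) hP' R
  rw [show (monoBasis m n : EPartition e n → Xi m n) = monoXi m from funext monoBasis_apply] at key
  have key' : ∀ R : EPartition e n → Xi m n,
      (IsUnitriangular m (fun α => (R α : PolySeq m)) ∧
        IsBlockEigen m ε (fun α => (R α : PolySeq m))) ↔
        R = fun α => ⟨P ε α, hP.mem ε α⟩ := by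
    intro R
    rw [isUnitriangular_iff, isBlockEigen_iff, ← key R]
  constructor
  · rintro ⟨h1, h2⟩
    have h3 := (key' fun α => ⟨R α, h1 α⟩).1 h2
    funext α
    exact congrArg Subtype.val (congrFun h3 α)
  · rintro rfl
    exact ⟨hP.mem ε, (key' _).2 rfl⟩

end Final

theorem theorem3p6 (e : ℕ) [NeZero e] (ζ : ℂ) (hζ : IsPrimitiveRoot ζ e)
    (m : Fin e → ℕ) (hm : ∀ k, 0 < m k) (n : ℕ) :
    -- the matrix `h` is the matrix of `E^±` on the monomial symmetric functions
    (∀ (ε : Bool) (α : EPartition e n),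
      opE m ε (monoSym m α) = ∑ β, hCoeff m ε α β • monoSym m β) ∧
    -- the Macdonald functions are well defined for every choice of the total order
    (∀ r : EPartition e n → EPartition e n → Prop, AdmissibleOrder m r →
      ∃! P : Bool → EPartition e n → PolySeq m, IsMacdonald ζ m r P) ∧
    ∀ ε : Bool, ConjectureA m n ε →
      -- they are characterized by the two properties
      (∀ r : EPartition e n → EPartition e n → Prop, AdmissibleOrder m r →
        ∀ P : Bool → EPartition e n → PolySeq m, IsMacdonald ζ m r P →
          ∀ R : EPartition e n → PolySeq m,
            ((∀ α, R α ∈ Xi m n) ∧ IsUnitriangular m R ∧ IsBlockEigen m ε R) ↔ R = P ε) ∧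
      -- and they do not depend on the total order
      (∀ r r' : EPartition e n → EPartition e n → Prop,
        AdmissibleOrder m r → AdmissibleOrder m r' →
        ∀ P P' : Bool → EPartition e n → PolySeq m,
          IsMacdonald ζ m r P → IsMacdonald ζ m r' P' → P ε = P' ε) := by
  refine ⟨fun ε α => ?_, fun r hr => existsUnique_isMacdonald hζ hr, fun ε hA =>
    ⟨fun r hr P hP R => hP.characterization hζ hA hr R, fun r r' hr hr' P P' hP hP' => ?_⟩⟩
  · have h := congrArg Subtype.val (opXi_monoXi (m := m) ε α)
    rw [Submodule.coe_sum] at h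
    exact h
  -- The functions built with `r` have the two characterizing properties, which do not involve the
  -- order, and so coincide with those built with `r'`.
  · exact (hP'.characterization hζ hA hr' _).1 ((hP.characterization hζ hA hr _).2 rfl)
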